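/- Let $n\ge 1$, $0<s<n$, and let $V:\mathbb{R}^n\to[0,+\infty]$ be such that $S_V=\{V<+\infty\}$ is open and non-empty, $V$ is continuous on $S_V$, and $\int_{\mathbb{R}^n}e^{-V(x)}\,dx<+\infty$ (with $e^{-\infty}=0$). For $\beta>0$ and $N\in\mathbb{N}$ consider the Gibbs measure of the Riesz gas on $(\mathbb{R}^n)^N$, $$\mathbb{P}_N[d\mathbf{x}]=\frac1{Z_N}\exp\Big(-\beta\sum_{1\le i<j\le N}|x_i-x_j|^{-s}-\sum_{j=1}^N V(x_j)\Big)\,dx_1\cdots dx_N ,$$ where $Z_N$ is the normalization constant. Let $\gamma\ge 0$, and for probability measures $\mu$ on $\mathbb{R}^n$ let $$\mathscr{F}_\gamma(\mu)=\frac{\gamma}{2}\iint|x-z|^{-s}\,\mu(dz)\,\mu(dx)+\mathrm{H}(\mu\,|\,\mu_0),\qquad \mu_0(dx)=\frac{e^{-V(x)}\,dx}{\int e^{-V(y)}\,dy},$$ where $\mathrm{H}(\cdot\,|\,\mu_0)$ is the relative entropy (for $\gamma=0$ the first term is $0$). Then $\mathscr{F}_\gamma$ has a unique minimizer $\mu_\gamma$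 among the probability measures on $\mathbb{R}^n$; it has a density with respect to Lebesgue measure, again denoted by $\mu_\gamma$, which is continuous on $S_V$; and for every $E\in S_V$ one has $\mu_\gamma(E)>0$ and, for every sequence $\beta=\beta_N>0$ with $N\beta_N\to\gamma$ as $N\to+\infty$, under $\mathbb{P}_N$ the point process $$\Xi_N=\sum_{j=1}^N\delta_{N^{1/n}(x_j-E)}$$ converges in distribution as $N\to+\infty$ to a homogeneous Poisson point process on $\mathbb{R}^n$ with intensity $\mu_\gamma(E)$ (with respect to Lebesgue measure). Here a Poisson point process with intensity measure $\theta$ is a simple point process $\Xi$ with $\mathbb{E}[e^{-\Xi(f)}]=\exp\big(\int(e^{-f}-1)\,d\theta\big)$ for all Borel $f:\mathbb{R}^n\to[0,+\infty)$, and $\Xi_N$ converges to $\Xi$ in distribution if $\mathbb{E}[e^{-\Xi_N(f)}]\to\mathbb{E}[e^{-\Xi(f)}]$ for all continuous $f:\mathbb{R}^n\to[0,+\infty)$ with compact support. -/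

import Mathlib

/-!
The Riesz kernel is a positive mixture of Gaussians, hence positive definite, so the free energy is
strictly convex: minimizing sequences are Cauchy for the Hellinger distance, and the minimizer `μ`
exists, is unique, and solves the mean-field equation `μ ∝ exp (-γ ∫ |· - y|^{-s} μ(dy)) μ₀`. As
`s < n`, the potential of `μ` is bounded and continuous, which gives the regularity of the density.

Up to a small remainder the kernel is also bounded. Positive definiteness and the mean-field
equation then bound the Gibbs measure by `e^{κN} μ^{⊗N}`, for every `κ > 0` and large `N`. Since
deviations from the law of large numbers are exponentially unlikely under `μ^{⊗N}`, under the Gibbs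
measure too an additional particle feels only the mean field, so that it is nearly independent of
the others, with law `μ`. Removing one particle at a time, the expectation of `∏ (1 - φ_N(x_j))` is
close to `(1 - ∫ φ_N dμ)^N`; for `φ_N(x) = 1 - exp (-f (N^{1/n} (x - E)))` this converges to the
Laplace functional of the Poisson process with intensity `μ(E)`.
-/

open MeasureTheory Filter Topology
open scoped NNReal ENNReal

noncomputable section

namespace RieszGas

/-- Euclidean space `ℝⁿ`. -/
abbrev Space (n : ℕ) : Type := EuclideanSpace ℝ (Fin n)

/-- `e^{-t}` for `t ∈ [0, ∞]`, with `e^{-∞} = 0`. -/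
def expNeg (t : ℝ≥0∞) : ℝ≥0∞ := EReal.exp (-(t : EReal))

/-- The Riesz kernel `|x - u|^{-s}`, equal to `∞` on the diagonal when `s > 0`. -/
def rieszKernel {n : ℕ} (s : ℝ) (u x : Space n) : ℝ≥0∞ := ‖x - u‖ₑ ^ (-s)

/-- The energy `β ∑_{i < j} g_s(x_i, x_j) + ∑_j V(x_j)` of a configuration of `N` particles. -/
def hamiltonian {n : ℕ} (s β : ℝ) (V : Space n → ℝ≥0∞) {N : ℕ} (x : Fin N → Space n) : ℝ≥0∞ :=
  ENNReal.ofReal β * ∑ i, ∑ j ∈ Finset.Ioi i, rieszKernel s (x i) (x j) + ∑ j, V (x j)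

/-- The partition function. -/
def partitionFunction {n : ℕ} (s β : ℝ) (V : Space n → ℝ≥0∞) (N : ℕ) : ℝ≥0∞ :=
  ∫⁻ x : Fin N → Space n, expNeg (hamiltonian s β V x)

/-- The Gibbs measure of `N` particles on `(ℝⁿ)^N`. -/
def gibbs {n : ℕ} (s β : ℝ) (V : Space n → ℝ≥0∞) (N : ℕ) : Measure (Fin N → Space n) :=
  (partitionFunction s β V N)⁻¹ • volume.withDensity (fun x => expNeg (hamiltonian s β V x))

/-- The local point process `∑_j δ_{N^{1/n} (x_j - E)}` around `E`. -/
def localProcess {n : ℕ} (E : Space n) (N : ℕ) (x : Fin N → Space n) : Measure (Space n) :=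
  ∑ j, Measure.dirac (((N : ℝ) ^ (1 / (n : ℝ))) • (x j - E))

/-- The reference probability measure `μ₀`, proportional to `e^{-V(x)} dx`. -/
def referenceMeasure {n : ℕ} (V : Space n → ℝ≥0∞) : Measure (Space n) :=
  (∫⁻ x, expNeg (V x))⁻¹ • volume.withDensity (fun x => expNeg (V x))

/-- The interaction energy `∬ g_s(x, z) μ(dz) μ(dx)`. -/
def interactionEnergy {n : ℕ} (s : ℝ) (μ : Measure (Space n)) : ℝ≥0∞ :=
  ∫⁻ x, ∫⁻ z, rieszKernel s x z ∂μ ∂μ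

/-- The free energy `(γ / 2) ℰ(μ) + H(μ | μ₀)`, `H` being the relative entropy. -/
def freeEnergy {n : ℕ} (s γ : ℝ) (V : Space n → ℝ≥0∞) (μ : ProbabilityMeasure (Space n)) : ℝ≥0∞ :=
  ENNReal.ofReal (γ / 2) * interactionEnergy s (μ : Measure (Space n)) +
    InformationTheory.klDiv (μ : Measure (Space n)) (referenceMeasure V)

/-- `μ` minimizes the free energy over all probability measures on `ℝⁿ`. -/
def IsFreeEnergyMinimizer {n : ℕ} (s γ : ℝ) (V : Space n → ℝ≥0∞)
    (μ : ProbabilityMeasure (Space n)) : Prop :=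
  ∀ ν : ProbabilityMeasure (Space n), freeEnergy s γ V μ ≤ freeEnergy s γ V ν

/-- A (simple) point process: a random measure which is almost surely of the form
`∑_{λ ∈ Λ} δ_λ` with `Λ` countable and without accumulation points. -/
structure IsPointProcess {X : Type*} [TopologicalSpace X] [MeasurableSpace X]
    {Ω : Type*} [MeasurableSpace Ω] (P : Measure Ω) (Ξ : Ω → Measure X) : Prop where
  measurable : Measurable Ξ
  ae_eq_sum : ∀ᵐ ω ∂P, ∃ Λ : Set X, Λ.Countable ∧ (∀ x, ¬ AccPt x (𝓟 Λ)) ∧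
    Ξ ω = Measure.sum (fun l : Λ => Measure.dirac (l : X))

/-- The Laplace functional `ψ(f) = 𝔼[e^{-Ξ(f)}]` of a random measure. -/
def laplaceFunctional {X : Type*} [MeasurableSpace X] {Ω : Type*} [MeasurableSpace Ω]
    (P : Measure Ω) (Ξ : Ω → Measure X) (f : X → ℝ≥0) : ℝ≥0∞ :=
  ∫⁻ ω, expNeg (∫⁻ x, (f x : ℝ≥0∞) ∂(Ξ ω)) ∂P

/-- A Poisson point process with intensity measure `θ`: a point process with Laplace functional
`exp (∫ (e^{-f} - 1) dθ)`. -/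
structure IsPoissonPointProcess {X : Type*} [TopologicalSpace X] [MeasurableSpace X]
    {Ω : Type*} [MeasurableSpace Ω] (P : Measure Ω) (Ξ : Ω → Measure X) (θ : Measure X) :
    Prop where
  isPointProcess : IsPointProcess P Ξ
  laplace_eq : ∀ f : X → ℝ≥0, Measurable f →
    laplaceFunctional P Ξ f = expNeg (∫⁻ x, (1 - expNeg (f x : ℝ≥0∞)) ∂θ)

/-- Convergence in distribution of point processes: the Laplace functionals converge on
nonnegative continuous functions with compact support. -/
def ConvergesInDistribution {X : Type*} [TopologicalSpace X] [MeasurableSpace X]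
    {Ω' : ℕ → Type*} [∀ N, MeasurableSpace (Ω' N)] (P' : ∀ N, Measure (Ω' N))
    (Ξ' : ∀ N, Ω' N → Measure X) {Ω : Type*} [MeasurableSpace Ω] (P : Measure Ω)
    (Ξ : Ω → Measure X) : Prop :=
  ∀ f : X → ℝ≥0, Continuous f → HasCompactSupport f →
    Tendsto (fun N => laplaceFunctional (P' N) (Ξ' N) f) atTop (𝓝 (laplaceFunctional P Ξ f))

end RieszGas

end

namespace RieszGas

section expNeg

@[simp] lemma expNeg_top : expNeg ⊤ = 0 := by simp [expNeg]

@[simp] lemma expNeg_zero : expNeg 0 = 1 := by simp [expNeg]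

lemma expNeg_of_ne_top {t : ℝ≥0∞} (ht : t ≠ ⊤) :
    expNeg t = ENNReal.ofReal (Real.exp (-t.toReal)) := by
  lift t to ℝ≥0 using ht
  rw [expNeg, EReal.coe_nnreal_eq_coe_real, ← EReal.coe_neg, EReal.exp_coe, ENNReal.coe_toReal]

lemma expNeg_coe (t : ℝ≥0) : expNeg (t : ℝ≥0∞) = ENNReal.ofReal (Real.exp (-t)) := by
  rw [expNeg_of_ne_top ENNReal.coe_ne_top, ENNReal.coe_toReal]

lemma expNeg_ofReal {t : ℝ} (ht : 0 ≤ t) :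
    expNeg (ENNReal.ofReal t) = ENNReal.ofReal (Real.exp (-t)) := by
  rw [expNeg_of_ne_top ENNReal.ofReal_ne_top, ENNReal.toReal_ofReal ht]

lemma expNeg_antitone : Antitone expNeg := fun _ _ hab =>
  EReal.exp_monotone (EReal.neg_le_neg_iff.2 (EReal.coe_ennreal_le_coe_ennreal_iff.2 hab))

lemma expNeg_le_one (t : ℝ≥0∞) : expNeg t ≤ 1 := by
  simpa only [expNeg_zero] using expNeg_antitone (zero_le (a := t))

lemma expNeg_ne_top (t : ℝ≥0∞) : expNeg t ≠ ⊤ :=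
  ((expNeg_le_one t).trans_lt ENNReal.one_lt_top).ne

lemma expNeg_pos {t : ℝ≥0∞} (ht : t ≠ ⊤) : 0 < expNeg t := by
  rw [expNeg_of_ne_top ht]
  exact ENNReal.ofReal_pos.2 (Real.exp_pos _)

lemma expNeg_add (a b : ℝ≥0∞) : expNeg (a + b) = expNeg a * expNeg b := by
  rcases eq_or_ne a ⊤ with rfl | ha
  · simp
  rcases eq_or_ne b ⊤ with rfl | hb
  · simp
  rw [expNeg_of_ne_top ha, expNeg_of_ne_top hb, expNeg_of_ne_top (ENNReal.add_ne_top.2 ⟨ha, hb⟩),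
    ← ENNReal.ofReal_mul (Real.exp_pos _).le, ← Real.exp_add, ENNReal.toReal_add ha hb, neg_add]

lemma expNeg_sum {ι : Type*} (S : Finset ι) (a : ι → ℝ≥0∞) :
    expNeg (∑ i ∈ S, a i) = ∏ i ∈ S, expNeg (a i) := by
  classical
  induction S using Finset.induction_on with
  | empty => simp
  | insert i S hi ih => rw [Finset.sum_insert hi, Finset.prod_insert hi, expNeg_add, ih]

lemma continuous_expNeg : Continuous expNeg :=
  ENNReal.continuous_exp.comp (continuous_neg.comp continuous_coe_ennreal_ereal)

@[fun_prop] lemma measurable_expNeg : Measurable expNeg := continuous_expNeg.measurable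

/-- The graph of `t ↦ e^{-t}` lies above its tangent at `c`; the linear terms are moved to the
sides where they are nonnegative. -/
lemma expNeg_tangent_le (c t : ℝ≥0∞) :
    expNeg c + expNeg c * c ≤ expNeg t + expNeg c * t := by
  rcases eq_or_ne c ⊤ with rfl | hc
  · simp
  rcases eq_or_ne t ⊤ with rfl | ht
  · simp [ENNReal.mul_top (expNeg_pos hc).ne']
  lift c to ℝ≥0 using hc
  lift t to ℝ≥0 using ht
  have tangent : Real.exp (-c) * (c - t + 1) ≤ Real.exp (-t) := by
    calc Real.exp (-c) * (c - t + 1) ≤ Real.exp (-c) * Real.exp (c - t) := by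
          gcongr; exact Real.add_one_le_exp _
      _ = Real.exp (-t) := by rw [← Real.exp_add]; ring_nf
  simp only [expNeg_coe, ENNReal.ofReal, ← ENNReal.coe_mul, ← ENNReal.coe_add,
    ENNReal.coe_le_coe, ← NNReal.coe_le_coe, NNReal.coe_add, NNReal.coe_mul,
    Real.coe_toNNReal _ (Real.exp_pos _).le]
  linarith

lemma expNeg_lintegral_le {α : Type*} [MeasurableSpace α] (P : Measure α) [IsProbabilityMeasure P]
    {f : α → ℝ≥0∞} (hf : Measurable f) :
    expNeg (∫⁻ a, f a ∂P) ≤ ∫⁻ a, expNeg (f a) ∂P := by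
  set c := ∫⁻ a, f a ∂P
  rcases eq_or_ne c ⊤ with hc | hc
  · simp [hc]
  have averaged : expNeg c + expNeg c * c ≤ ∫⁻ a, expNeg (f a) ∂P + expNeg c * c := by
    calc expNeg c + expNeg c * c = ∫⁻ _, expNeg c + expNeg c * c ∂P := by simp
      _ ≤ ∫⁻ a, expNeg (f a) + expNeg c * f a ∂P :=
          lintegral_mono fun a => expNeg_tangent_le c (f a)
      _ = ∫⁻ a, expNeg (f a) ∂P + expNeg c * c := by
          rw [lintegral_add_left (by fun_prop), lintegral_const_mul _ hf]
  exact ENNReal.le_of_add_le_add_right (ENNReal.mul_ne_top (expNeg_ne_top c) hc) averaged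

end expNeg

section PositiveDefinite

variable {X : Type*} [MeasurableSpace X]

/-- The mutual energy `∬ k(x, y) ν(dy) μ(dx)` of two charge distributions. -/
noncomputable def kernelEnergy (k : X → X → ℝ≥0∞) (μ ν : Measure X) : ℝ≥0∞ :=
  ∫⁻ x, ∫⁻ y, k x y ∂ν ∂μ

/-- A symmetric kernel which is positive definite, i.e. `∬ k d(μ - ν) d(μ - ν) ≥ 0`. Since `k` may
be infinite on the diagonal, the inequality is written without subtraction. -/
structure IsPosDefKernel (k : X → X → ℝ≥0∞) : Prop where
  measurable_uncurry : Measurable (Function.uncurry k)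
  symm : ∀ x y, k x y = k y x
  two_mul_energy_le : ∀ (μ ν : Measure X) [SFinite μ] [SFinite ν],
    2 * kernelEnergy k μ ν ≤ kernelEnergy k μ μ + kernelEnergy k ν ν

lemma ennreal_two_mul_le_add_sq (a b : ℝ≥0∞) : 2 * (a * b) ≤ a * a + b * b := by
  rcases eq_or_ne a ⊤ with rfl | ha
  · simp
  rcases eq_or_ne b ⊤ with rfl | hb
  · simp
  lift a to ℝ≥0 using ha
  lift b to ℝ≥0 using hb
  norm_cast
  rw [← NNReal.coe_le_coe]
  push_cast
  nlinarith [sq_nonneg ((a : ℝ) - b)]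

lemma kernelEnergy_lintegral_mul {Z : Type*} [MeasurableSpace Z] (κ : Measure Z) [SFinite κ]
    (μ ν : Measure X) [SFinite μ] [SFinite ν] {h : X → Z → ℝ≥0∞}
    (hh : Measurable (Function.uncurry h)) :
    kernelEnergy (fun x y => ∫⁻ z, h x z * h y z ∂κ) μ ν =
      ∫⁻ z, (∫⁻ x, h x z ∂μ) * ∫⁻ y, h y z ∂ν ∂κ := by
  have inner (x : X) : ∫⁻ y, ∫⁻ z, h x z * h y z ∂κ ∂ν = ∫⁻ z, h x z * ∫⁻ y, h y z ∂ν ∂κ := by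
    rw [lintegral_lintegral_swap (by fun_prop)]
    exact lintegral_congr fun z => lintegral_const_mul _ (by fun_prop)
  simp only [kernelEnergy, inner]
  rw [lintegral_lintegral_swap (by fun_prop)]
  exact lintegral_congr fun z => lintegral_mul_const _ (by fun_prop)

lemma isPosDefKernel_lintegral_mul {Z : Type*} [MeasurableSpace Z] (κ : Measure Z) [SFinite κ]
    {h : X → Z → ℝ≥0∞} (hh : Measurable (Function.uncurry h)) :
    IsPosDefKernel fun x y => ∫⁻ z, h x z * h y z ∂κ where
  measurable_uncurry := by
    refine Measurable.lintegral_prod_right'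
      (f := fun p : (X × X) × Z => h p.1.1 p.2 * h p.1.2 p.2) ?_
    fun_prop
  symm x y := by simp only [mul_comm]
  two_mul_energy_le μ ν _ _ := by
    simp only [kernelEnergy_lintegral_mul κ _ _ hh]
    rw [← lintegral_const_mul _ (by fun_prop), ← lintegral_add_left (by fun_prop)]
    exact lintegral_mono fun z => ennreal_two_mul_le_add_sq _ _

lemma kernelEnergy_const_mul {k : X → X → ℝ≥0∞} (hk : Measurable (Function.uncurry k))
    (c : ℝ≥0∞) (μ ν : Measure X) [SFinite ν] :
    kernelEnergy (fun x y => c * k x y) μ ν = c * kernelEnergy k μ ν := by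
  simp only [kernelEnergy, lintegral_const_mul c hk.of_uncurry_left]
  exact lintegral_const_mul c hk.lintegral_prod_right'

lemma kernelEnergy_comm {k : X → X → ℝ≥0∞} (hk : Measurable (Function.uncurry k))
    (hk_symm : ∀ x y, k x y = k y x) (μ ν : Measure X) [SFinite μ] [SFinite ν] :
    kernelEnergy k μ ν = kernelEnergy k ν μ := by
  rw [kernelEnergy, lintegral_lintegral_swap hk.aemeasurable, kernelEnergy]
  simp only [hk_symm]

lemma kernelEnergy_smul_add_smul {k : X → X → ℝ≥0∞} (hk : Measurable (Function.uncurry k))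
    (hk_symm : ∀ x y, k x y = k y x) (μ ν : Measure X) [SFinite μ] [SFinite ν] (a b : ℝ≥0∞) :
    kernelEnergy k (a • μ + b • ν) (a • μ + b • ν) = a * a * kernelEnergy k μ μ +
      2 * (a * b) * kernelEnergy k μ ν + b * b * kernelEnergy k ν ν := by
  have measurable_potential (ρ : Measure X) [SFinite ρ] : Measurable fun x => ∫⁻ y, k x y ∂ρ :=
    hk.lintegral_prod_right'
  have hμ := measurable_potential μ
  have hν := measurable_potential ν
  have cross : ∫⁻ x, ∫⁻ y, k x y ∂μ ∂ν = kernelEnergy k μ ν := kernelEnergy_comm hk hk_symm ν μ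
  simp only [kernelEnergy, lintegral_add_measure, lintegral_smul_measure, smul_eq_mul]
  rw [lintegral_add_left (by fun_prop), lintegral_add_left (by fun_prop),
    lintegral_const_mul _ hμ, lintegral_const_mul _ hν, lintegral_const_mul _ hμ,
    lintegral_const_mul _ hν, cross, kernelEnergy]
  ring

namespace IsPosDefKernel

variable {k : X → X → ℝ≥0∞}

lemma measurable_right (hk : IsPosDefKernel k) (x : X) : Measurable (k x) :=
  hk.measurable_uncurry.of_uncurry_left

lemma const_mul (hk : IsPosDefKernel k) (c : ℝ≥0∞) : IsPosDefKernel fun x y => c * k x y where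
  measurable_uncurry := hk.measurable_uncurry.const_mul c
  symm x y := by rw [hk.symm]
  two_mul_energy_le μ ν _ _ := by
    simp only [kernelEnergy_const_mul hk.measurable_uncurry, mul_left_comm 2 c, ← mul_add]
    gcongr
    exact hk.two_mul_energy_le μ ν

lemma energy_smul_add_smul_le (hk : IsPosDefKernel k) (μ ν : Measure X) [SFinite μ] [SFinite ν]
    {a b : ℝ≥0∞} (hab : a + b = 1) :
    kernelEnergy k (a • μ + b • ν) (a • μ + b • ν) ≤
      a * kernelEnergy k μ μ + b * kernelEnergy k ν ν := by
  rw [kernelEnergy_smul_add_smul hk.measurable_uncurry hk.symm]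
  set A := kernelEnergy k μ μ
  set B := kernelEnergy k ν ν
  calc a * a * A + 2 * (a * b) * kernelEnergy k μ ν + b * b * B
      = a * a * A + a * b * (2 * kernelEnergy k μ ν) + b * b * B := by ring
    _ ≤ a * a * A + a * b * (A + B) + b * b * B := by
        gcongr; exact hk.two_mul_energy_le μ ν
    _ = (a + b) * (a * A + b * B) := by ring
    _ = a * A + b * B := by rw [hab, one_mul]

lemma lintegral {T : Type*} [MeasurableSpace T] (κ : Measure T) [SFinite κ]
    {k : T → X → X → ℝ≥0∞} (hk_meas : Measurable fun p : T × X × X => k p.1 p.2.1 p.2.2)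
    (hk : ∀ᵐ t ∂κ, IsPosDefKernel (k t)) : IsPosDefKernel fun x y => ∫⁻ t, k t x y ∂κ where
  measurable_uncurry := hk_meas.lintegral_prod_left'
  symm x y := lintegral_congr_ae (by filter_upwards [hk] with t ht using ht.symm x y)
  two_mul_energy_le μ ν _ _ := by
    have measurable_inner (ν : Measure X) [SFinite ν] :
        Measurable fun p : T × X => ∫⁻ y, k p.1 p.2 y ∂ν :=
      Measurable.lintegral_prod_right' (f := fun q : (T × X) × X => k q.1.1 q.1.2 q.2)
        (hk_meas.comp (f := fun q : (T × X) × X => (q.1.1, q.1.2, q.2)) (by fun_prop))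
    have energy_lintegral (μ ν : Measure X) [SFinite μ] [SFinite ν] :
        kernelEnergy (fun x y => ∫⁻ t, k t x y ∂κ) μ ν = ∫⁻ t, kernelEnergy (k t) μ ν ∂κ := by
      have inner (x : X) : ∫⁻ y, ∫⁻ t, k t x y ∂κ ∂ν = ∫⁻ t, ∫⁻ y, k t x y ∂ν ∂κ :=
        lintegral_lintegral_swap (hk_meas.comp (f := fun q : X × T => (q.2, x, q.1))
          (by fun_prop)).aemeasurable
      simp only [kernelEnergy, inner]
      exact lintegral_lintegral_swap ((measurable_inner ν).comp measurable_swap).aemeasurable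
    have measurable_energy (μ ν : Measure X) [SFinite μ] [SFinite ν] :
        Measurable fun t => kernelEnergy (k t) μ ν := (measurable_inner ν).lintegral_prod_right'
    simp only [energy_lintegral]
    rw [← lintegral_const_mul _ (measurable_energy μ ν),
      ← lintegral_add_left (measurable_energy μ μ)]
    exact lintegral_mono_ae (by filter_upwards [hk] with t ht using ht.two_mul_energy_le μ ν)

end IsPosDefKernel

end PositiveDefinite

section Gaussian

variable {E : Type*} [NormedAddCommGroup E]

/-- The unnormalized Gaussian `e^{-t|x - y|²}`. -/
noncomputable def gaussianKernel (t : ℝ) (x y : E) : ℝ≥0∞ :=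
  ENNReal.ofReal (Real.exp (-t * ‖x - y‖ ^ 2))

lemma gaussianKernel_le_one {t : ℝ} (ht : 0 ≤ t) (x y : E) : gaussianKernel t x y ≤ 1 := by
  rw [gaussianKernel, ENNReal.ofReal_le_one, Real.exp_le_one_iff]
  nlinarith [sq_nonneg ‖x - y‖]

variable [InnerProductSpace ℝ E]

lemma gaussianKernel_mul_gaussianKernel (t : ℝ) (x y z : E) :
    gaussianKernel (2 * t) x z * gaussianKernel (2 * t) y z =
      gaussianKernel t x y * gaussianKernel (4 * t) ((2 : ℝ)⁻¹ • (x + y)) z := by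
  have midpoint : ‖(2 : ℝ)⁻¹ • (x + y) - z‖ = 2⁻¹ * ‖(x - z) + (y - z)‖ := by
    rw [show (2 : ℝ)⁻¹ • (x + y) - z = (2 : ℝ)⁻¹ • ((x - z) + (y - z)) by module, norm_smul]
    norm_num
  have parallelogram := parallelogram_law_with_norm ℝ (x - z) (y - z)
  rw [sub_sub_sub_cancel_right] at parallelogram
  simp only [gaussianKernel, ← ENNReal.ofReal_mul (Real.exp_pos _).le, ← Real.exp_add, midpoint]
  congr 2
  linear_combination t * parallelogram

variable [FiniteDimensional ℝ E] [MeasurableSpace E] [BorelSpace E]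

@[fun_prop] lemma measurable_gaussianKernel {α : Type*} [MeasurableSpace α] {t : α → ℝ}
    {f g : α → E} (ht : Measurable t) (hf : Measurable f) (hg : Measurable g) :
    Measurable fun a => gaussianKernel (t a) (f a) (g a) := by
  unfold gaussianKernel
  fun_prop

lemma lintegral_gaussianKernel {t : ℝ} (ht : 0 < t) (x : E) :
    ∫⁻ y, gaussianKernel t x y = ENNReal.ofReal ((Real.pi / t) ^ (Module.finrank ℝ E / 2 : ℝ)) := by
  have hint : Integrable fun z : E => Real.exp (-t * ‖z‖ ^ 2) := by
    by_contra h
    have := GaussianFourier.integral_rexp_neg_mul_sq_norm (V := E) ht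
    rw [integral_undef h] at this
    exact (Real.rpow_pos_of_pos (div_pos Real.pi_pos ht) _).ne this
  rw [← GaussianFourier.integral_rexp_neg_mul_sq_norm ht,
    ofReal_integral_eq_lintegral_ofReal hint (ae_of_all _ fun _ => (Real.exp_pos _).le)]
  simp only [gaussianKernel]
  exact lintegral_sub_left_eq_self (fun z => ENNReal.ofReal (Real.exp (-t * ‖z‖ ^ 2))) x

lemma isPosDefKernel_gaussianKernel {t : ℝ} (ht : 0 < t) :
    IsPosDefKernel (gaussianKernel t : E → E → ℝ≥0∞) := by
  set c := ENNReal.ofReal ((Real.pi / (4 * t)) ^ (Module.finrank ℝ E / 2 : ℝ))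
  have hc : c ≠ 0 := (ENNReal.ofReal_pos.2 (by positivity)).ne'
  have convolution (x y : E) :
      c⁻¹ * ∫⁻ z, gaussianKernel (2 * t) x z * gaussianKernel (2 * t) y z =
        gaussianKernel t x y := by
    simp only [gaussianKernel_mul_gaussianKernel]
    rw [lintegral_const_mul _ (by fun_prop), lintegral_gaussianKernel (by positivity), mul_comm,
      mul_assoc, ENNReal.mul_inv_cancel hc ENNReal.ofReal_ne_top, mul_one]
  simpa only [convolution] using (isPosDefKernel_lintegral_mul volume
    (h := fun x z : E => gaussianKernel (2 * t) x z) (by fun_prop)).const_mul c⁻¹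

end Gaussian

section GaussianMixture

/-- The weight `t^{s/2-1} / Γ(s/2)` for which `|x|^{-s} = ∫_0^∞ e^{-t|x|²} w(t) dt`. -/
noncomputable def mixtureWeight (s t : ℝ) : ℝ≥0∞ :=
  ENNReal.ofReal (t ^ (s / 2 - 1) / Real.Gamma (s / 2))

@[fun_prop] lemma measurable_mixtureWeight (s : ℝ) : Measurable (mixtureWeight s) := by
  unfold mixtureWeight
  fun_prop

lemma lintegral_mixtureWeight_Ioc_lt_top {s : ℝ} (hs : 0 < s) (T : ℝ) :
    ∫⁻ t in Set.Ioc 0 T, mixtureWeight s t < ⊤ := by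
  rcases le_total T 0 with hT | hT
  · simp [Set.Ioc_eq_empty_of_le hT]
  have hint := (intervalIntegral.intervalIntegrable_rpow' (r := s / 2 - 1) (a := 0) (b := T)
    (by linarith)).div_const (Real.Gamma (s / 2))
  rw [intervalIntegrable_iff_integrableOn_Ioc_of_le hT] at hint
  exact hint.lintegral_lt_top

lemma lintegral_mixtureWeight_mul_exp {s : ℝ} (hs : 0 < s) {r : ℝ} (hr : 0 < r) :
    ∫⁻ t in Set.Ioi 0, mixtureWeight s t * ENNReal.ofReal (Real.exp (-t * r)) =
      ENNReal.ofReal (r ^ (-(s / 2))) := by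
  have hΓ := Real.Gamma_pos_of_pos (half_pos hs)
  have gamma_integral := Real.integral_rpow_mul_exp_neg_mul_Ioi (half_pos hs) hr
  have hint : Integrable (fun t => t ^ (s / 2 - 1) * Real.exp (-(r * t)))
      (volume.restrict (Set.Ioi 0)) := by
    by_contra h
    rw [integral_undef h] at gamma_integral
    exact (by positivity : (1 / r) ^ (s / 2) * Real.Gamma (s / 2) ≠ 0) gamma_integral.symm
  calc ∫⁻ t in Set.Ioi 0, mixtureWeight s t * ENNReal.ofReal (Real.exp (-t * r))
      = ∫⁻ t in Set.Ioi 0,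
          ENNReal.ofReal (t ^ (s / 2 - 1) * Real.exp (-(r * t)) / Real.Gamma (s / 2)) := by
        refine setLIntegral_congr_fun measurableSet_Ioi fun t ht => ?_
        rw [mixtureWeight, ← ENNReal.ofReal_mul
          (div_nonneg (Real.rpow_nonneg (Set.mem_Ioi.1 ht).le _) hΓ.le)]
        congr 1
        ring_nf
    _ = ENNReal.ofReal (r ^ (-(s / 2))) := by
        rw [← ofReal_integral_eq_lintegral_ofReal (hint.div_const _), integral_div, gamma_integral,
          mul_div_cancel_right₀ _ hΓ.ne', one_div, Real.inv_rpow hr.le, Real.rpow_neg hr.le]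
        filter_upwards [ae_restrict_mem measurableSet_Ioi] with t ht
        have := Real.rpow_nonneg (Set.mem_Ioi.1 ht).le (s / 2 - 1)
        positivity

lemma lintegral_mixtureWeight_eq_top {s : ℝ} (hs : 0 < s) :
    ∫⁻ t in Set.Ioi 0, mixtureWeight s t = ⊤ := by
  have hΓ := Real.Gamma_pos_of_pos (half_pos hs)
  by_contra h
  have nonneg : 0 ≤ᵐ[volume.restrict (Set.Ioi 0)]
      fun t : ℝ => t ^ (s / 2 - 1) / Real.Gamma (s / 2) := by
    filter_upwards [ae_restrict_mem measurableSet_Ioi] with t ht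
    exact div_nonneg (Real.rpow_nonneg (Set.mem_Ioi.1 ht).le _) hΓ.le
  have hint : IntegrableOn (fun t : ℝ => t ^ (s / 2 - 1) / Real.Gamma (s / 2)) (Set.Ioi 0) :=
    (lintegral_ofReal_ne_top_iff_integrable (by fun_prop) nonneg).1 h
  refine not_integrableOn_Ioi_rpow (s / 2 - 1) ?_
  simpa only [IntegrableOn, div_mul_cancel₀ _ hΓ.ne'] using hint.mul_const (Real.Gamma (s / 2))

variable {E : Type*} [NormedAddCommGroup E]

/-- The part of the Gaussian decomposition of the Riesz kernel carried by `t ∈ S`. Small `t` give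
a bounded kernel, large `t` the singularity. -/
noncomputable def gaussianMixture (s : ℝ) (S : Set ℝ) (x y : E) : ℝ≥0∞ :=
  ∫⁻ t in S, mixtureWeight s t * gaussianKernel t x y

lemma gaussianMixture_Ioi_zero {s : ℝ} (hs : 0 < s) {n : ℕ} :
    gaussianMixture s (Set.Ioi 0) = (rieszKernel s : Space n → Space n → ℝ≥0∞) := by
  ext x y
  rcases eq_or_ne x y with rfl | hxy
  · simp [gaussianMixture, gaussianKernel, rieszKernel, lintegral_mixtureWeight_eq_top hs,
      ENNReal.zero_rpow_of_neg (neg_lt_zero.2 hs)]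
  have hr : 0 < ‖x - y‖ := norm_sub_pos_iff.2 hxy
  rw [gaussianMixture, rieszKernel]
  simp only [gaussianKernel]
  rw [lintegral_mixtureWeight_mul_exp hs (by positivity), ← enorm_neg, neg_sub,
    ← ofReal_norm, ENNReal.ofReal_rpow_of_pos hr, ← Real.rpow_natCast, ← Real.rpow_mul hr.le]
  congr 2
  push_cast
  ring

lemma gaussianMixture_add (s : ℝ) {S S' : Set ℝ} (hS' : MeasurableSet S') (h : Disjoint S S')
    (x y : E) :
    gaussianMixture s S x y + gaussianMixture s S' x y = gaussianMixture s (S ∪ S') x y :=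
  (lintegral_union hS' h).symm

lemma gaussianMixture_le (s : ℝ) {S : Set ℝ} (hS : S ⊆ Set.Ioi 0) (hS_meas : MeasurableSet S)
    (x y : E) : gaussianMixture s S x y ≤ ∫⁻ t in S, mixtureWeight s t :=
  setLIntegral_mono' hS_meas
    fun _ ht => mul_le_of_le_one_right' (gaussianKernel_le_one (hS ht).le x y)

variable [InnerProductSpace ℝ E] [FiniteDimensional ℝ E] [MeasurableSpace E] [BorelSpace E]

lemma isPosDefKernel_gaussianMixture (s : ℝ) {S : Set ℝ} (hS : S ⊆ Set.Ioi 0)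
    (hS_meas : MeasurableSet S) :
    IsPosDefKernel (gaussianMixture s S : E → E → ℝ≥0∞) := by
  refine IsPosDefKernel.lintegral _ (by fun_prop) ?_
  filter_upwards [ae_restrict_mem hS_meas] with t ht
  exact (isPosDefKernel_gaussianKernel (hS ht)).const_mul _

lemma isPosDefKernel_rieszKernel {s : ℝ} (hs : 0 < s) {n : ℕ} :
    IsPosDefKernel (rieszKernel s : Space n → Space n → ℝ≥0∞) := by
  rw [← gaussianMixture_Ioi_zero hs]
  exact isPosDefKernel_gaussianMixture s subset_rfl measurableSet_Ioi

lemma lintegral_gaussianMixture (s : ℝ) {S : Set ℝ} (hS : S ⊆ Set.Ioi 0)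
    (hS_meas : MeasurableSet S) (x : E) :
    ∫⁻ y, gaussianMixture s S x y = ∫⁻ t in S, mixtureWeight s t *
      ENNReal.ofReal ((Real.pi / t) ^ (Module.finrank ℝ E / 2 : ℝ)) := by
  simp only [gaussianMixture]
  rw [lintegral_lintegral_swap (by fun_prop)]
  refine setLIntegral_congr_fun hS_meas fun t ht => ?_
  rw [lintegral_const_mul _ (by fun_prop), lintegral_gaussianKernel (hS ht)]

lemma exists_lintegral_mixtureWeight_Ioi_le {s d : ℝ} (hs : 0 < s) (hsd : s < d) {τ : ℝ≥0∞}
    (hτ : τ ≠ 0) : ∃ T > 0,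
      ∫⁻ t in Set.Ioi T, mixtureWeight s t * ENNReal.ofReal ((Real.pi / t) ^ (d / 2)) ≤ τ := by
  set a := s / 2 - 1 - d / 2 with ha_def
  have ha : a < -1 := by linarith
  set c := Real.pi ^ (d / 2) / Real.Gamma (s / 2)
  have hc : 0 ≤ c := div_nonneg (by positivity) (Real.Gamma_pos_of_pos (half_pos hs)).le
  have tail_eq {T : ℝ} (hT : 0 < T) :
      ∫⁻ t in Set.Ioi T, mixtureWeight s t * ENNReal.ofReal ((Real.pi / t) ^ (d / 2)) =
        ENNReal.ofReal (c * (-T ^ (a + 1) / (a + 1))) := by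
    rw [← integral_Ioi_rpow_of_lt ha hT, ← integral_const_mul, ofReal_integral_eq_lintegral_ofReal
      ((integrableOn_Ioi_rpow_of_lt ha hT).const_mul c)]
    · refine setLIntegral_congr_fun measurableSet_Ioi fun t (ht : T < t) => ?_
      have ht' : 0 < t := hT.trans ht
      simp only [mixtureWeight, c, a]
      rw [← ENNReal.ofReal_mul' (by positivity), Real.div_rpow Real.pi_pos.le ht'.le,
        Real.rpow_sub ht' (s / 2 - 1)]
      ring_nf
    · filter_upwards [ae_restrict_mem measurableSet_Ioi] with t (ht : T < t)
      exact mul_nonneg hc (Real.rpow_nonneg (hT.trans ht).le a)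
  have vanish :
      Tendsto (fun T : ℝ => ENNReal.ofReal (c * (-T ^ (a + 1) / (a + 1)))) atTop (𝓝 0) := by
    have := tendsto_rpow_neg_atTop (y := -(a + 1)) (by linarith)
    rw [neg_neg] at this
    simpa using ENNReal.tendsto_ofReal ((this.neg.div_const (a + 1)).const_mul c)
  obtain ⟨T, hT_le, hT⟩ :=
    ((vanish.eventually (ge_mem_nhds (pos_iff_ne_zero.2 hτ))).and (eventually_gt_atTop 0)).exists
  exact ⟨T, hT, (tail_eq hT).trans_le hT_le⟩

/-- Charges of bounded density do not feel the singularity of the kernel: this is where `s < n`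
enters. -/
lemma exists_lintegral_gaussianMixture_Ioi_le {s : ℝ} (hs : 0 < s)
    (hsd : s < Module.finrank ℝ E) {C : ℝ≥0} {μ : Measure E} (hμ : μ ≤ C • volume)
    {τ : ℝ≥0∞} (hτ : τ ≠ 0) :
    ∃ T > 0, ∀ x, ∫⁻ y, gaussianMixture s (Set.Ioi T) x y ∂μ ≤ τ := by
  obtain ⟨T, hT, hT_le⟩ := exists_lintegral_mixtureWeight_Ioi_le hs hsd
    (ENNReal.div_ne_zero.2 ⟨hτ, ENNReal.coe_ne_top (r := C)⟩)
  refine ⟨T, hT, fun x => ?_⟩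
  calc ∫⁻ y, gaussianMixture s (Set.Ioi T) x y ∂μ
      ≤ ∫⁻ y, gaussianMixture s (Set.Ioi T) x y ∂(C • volume) := lintegral_mono' hμ le_rfl
    _ = C * ∫⁻ y, gaussianMixture s (Set.Ioi T) x y := lintegral_smul_measure _ _
    _ ≤ C * (τ / C) := by
        rw [lintegral_gaussianMixture s (Set.Ioi_subset_Ioi hT.le) measurableSet_Ioi]
        gcongr
    _ ≤ τ := ENNReal.mul_div_le

end GaussianMixture

section Potential

lemma continuous_lintegral_of_dominated {A α : Type*} [TopologicalSpace A]
    [FirstCountableTopology A] [MeasurableSpace α] {μ : Measure α} {f : A → α → ℝ≥0∞}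
    (g : α → ℝ≥0∞) (hf_meas : ∀ a, Measurable (f a)) (hfg : ∀ a, f a ≤ᵐ[μ] g)
    (hg : ∫⁻ x, g x ∂μ ≠ ⊤) (hf : ∀ x, Continuous fun a => f a x) :
    Continuous fun a => ∫⁻ x, f a x ∂μ :=
  continuous_iff_continuousAt.2 fun a => tendsto_lintegral_filter_of_dominated_convergence g
    (Eventually.of_forall hf_meas) (Eventually.of_forall hfg) hg
    (ae_of_all _ fun x => (hf x).tendsto a)

lemma continuous_of_uniform_le_add {A : Type*} [TopologicalSpace A] {U : A → ℝ≥0∞}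
    (hU : ∀ a, U a ≠ ⊤)
    (h : ∀ τ : ℝ≥0∞, τ ≠ 0 → ∃ F : A → ℝ≥0∞, Continuous F ∧ ∀ a, F a ≤ U a ∧ U a ≤ F a + τ) :
    Continuous U := by
  refine continuous_iff_continuousAt.2 fun a => (ENNReal.tendsto_nhds (hU a)).2 fun ε hε => ?_
  obtain ⟨F, hF, hFU⟩ := h (ε / 2) (ENNReal.half_pos hε.ne').ne'
  have hFa : F a ≠ ⊤ := ne_top_of_le_ne_top (hU a) (hFU a).1
  filter_upwards [(ENNReal.tendsto_nhds hFa).1 (hF.tendsto a) (ε / 2) (ENNReal.half_pos hε.ne')]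
    with b ⟨lower, upper⟩
  rw [tsub_le_iff_right] at lower
  constructor
  · rw [tsub_le_iff_right]
    calc U a ≤ F b + ε / 2 + ε / 2 := (hFU a).2.trans (by gcongr)
      _ ≤ U b + ε := by rw [add_assoc, ENNReal.add_halves]; gcongr; exact (hFU b).1
  · calc U b ≤ F a + ε / 2 + ε / 2 := (hFU b).2.trans (by gcongr)
      _ ≤ U a + ε := by rw [add_assoc, ENNReal.add_halves]; gcongr; exact (hFU a).1

variable {n : ℕ} {s : ℝ} {C : ℝ≥0} {μ : Measure (Space n)}

lemma gaussianMixture_Ioc_add_Ioi (hs : 0 < s) {T : ℝ} (hT : 0 < T) (x y : Space n) :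
    gaussianMixture s (Set.Ioc 0 T) x y + gaussianMixture s (Set.Ioi T) x y =
      rieszKernel s x y := by
  rw [gaussianMixture_add s measurableSet_Ioi (Set.Ioc_disjoint_Ioi le_rfl),
    Set.Ioc_union_Ioi_eq_Ioi hT.le, gaussianMixture_Ioi_zero hs]

lemma lintegral_rieszKernel_eq (hs : 0 < s) {T : ℝ} (hT : 0 < T) (x : Space n) :
    ∫⁻ y, rieszKernel s x y ∂μ =
      ∫⁻ y, gaussianMixture s (Set.Ioc 0 T) x y ∂μ +
        ∫⁻ y, gaussianMixture s (Set.Ioi T) x y ∂μ := by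
  simp only [← gaussianMixture_Ioc_add_Ioi hs hT]
  exact lintegral_add_left ((isPosDefKernel_gaussianMixture s Set.Ioc_subset_Ioi_self
    measurableSet_Ioc).measurable_right x) _

lemma exists_lintegral_rieszKernel_le (hs : 0 < s) (hsn : s < n) [IsFiniteMeasure μ]
    (hμ : μ ≤ C • volume) : ∃ B : ℝ≥0, ∀ x, ∫⁻ y, rieszKernel s x y ∂μ ≤ B := by
  obtain ⟨T, hT, hT_le⟩ :=
    exists_lintegral_gaussianMixture_Ioi_le hs (by simpa using hsn) hμ one_ne_zero
  set W := ∫⁻ t in Set.Ioc 0 T, mixtureWeight s t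
  have hW : W * μ Set.univ + 1 ≠ ⊤ := by
    finiteness [(lintegral_mixtureWeight_Ioc_lt_top hs T).ne]
  refine ⟨(W * μ Set.univ + 1).toNNReal, fun x => ?_⟩
  rw [ENNReal.coe_toNNReal hW, lintegral_rieszKernel_eq hs hT]
  gcongr
  · calc _ ≤ ∫⁻ _, W ∂μ := lintegral_mono fun y =>
          gaussianMixture_le s Set.Ioc_subset_Ioi_self measurableSet_Ioc x y
      _ = W * μ Set.univ := lintegral_const W
  · exact hT_le x

lemma continuous_gaussianMixture_Ioc (hs : 0 < s) (T : ℝ) (y : Space n) :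
    Continuous fun x => gaussianMixture s (Set.Ioc 0 T) x y := by
  refine continuous_lintegral_of_dominated (mixtureWeight s) (fun x => by fun_prop) (fun x => ?_)
    (lintegral_mixtureWeight_Ioc_lt_top hs T).ne fun t => ?_
  · filter_upwards [ae_restrict_mem measurableSet_Ioc] with t ht
    exact mul_le_of_le_one_right' (gaussianKernel_le_one ht.1.le x y)
  · refine (ENNReal.continuous_const_mul ENNReal.ofReal_ne_top).comp ?_
    exact ENNReal.continuous_ofReal.comp (by fun_prop)

lemma continuous_lintegral_rieszKernel (hs : 0 < s) (hsn : s < n) [IsFiniteMeasure μ]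
    (hμ : μ ≤ C • volume) : Continuous fun x => ∫⁻ y, rieszKernel s x y ∂μ := by
  obtain ⟨B, hB⟩ := exists_lintegral_rieszKernel_le hs hsn hμ
  refine continuous_of_uniform_le_add (fun x => ((hB x).trans_lt ENNReal.coe_lt_top).ne)
    fun τ hτ => ?_
  obtain ⟨T, hT, hT_le⟩ := exists_lintegral_gaussianMixture_Ioi_le hs (by simpa using hsn) hμ hτ
  refine ⟨fun x => ∫⁻ y, gaussianMixture s (Set.Ioc 0 T) x y ∂μ, ?_, fun x => ?_⟩
  · set W := ∫⁻ t in Set.Ioc 0 T, mixtureWeight s t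
    refine continuous_lintegral_of_dominated (fun _ => W) (fun x => ?_)
      (fun x => ae_of_all _ fun y =>
        gaussianMixture_le s Set.Ioc_subset_Ioi_self measurableSet_Ioc x y) ?_
      (continuous_gaussianMixture_Ioc hs T)
    · exact (isPosDefKernel_gaussianMixture s Set.Ioc_subset_Ioi_self
        measurableSet_Ioc).measurable_right x
    · rw [lintegral_const]
      finiteness [(lintegral_mixtureWeight_Ioc_lt_top hs T).ne]
  · rw [lintegral_rieszKernel_eq hs hT]
    exact ⟨le_self_add, by gcongr; exact hT_le x⟩

end Potential

section FreeEnergy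

open InformationTheory

variable {X : Type*} [MeasurableSpace X]

/-- The free energy `∬ k dμ dμ + H(μ | π)`. The temperature and the factor `1/2` are absorbed in
the kernel. -/
noncomputable def kernelFreeEnergy (k : X → X → ℝ≥0∞) (π μ : Measure X) : ℝ≥0∞ :=
  kernelEnergy k μ μ + klDiv μ π

/-- `p` is a probability density with respect to `π`. -/
structure IsDensity (π : Measure X) (p : X → ℝ≥0) : Prop where
  measurable : Measurable p
  lintegral_eq_one : ∫⁻ x, (p x : ℝ≥0∞) ∂π = 1

/-- The measure with density `p` with respect to `π`. -/
noncomputable abbrev densityMeasure (π : Measure X) (p : X → ℝ≥0) : Measure X :=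
  π.withDensity fun x => (p x : ℝ≥0∞)

/-- The relative entropy of the measure with density `p` with respect to `π`. -/
noncomputable def densityEntropy (π : Measure X) (p : X → ℝ≥0) : ℝ≥0∞ :=
  ∫⁻ x, ENNReal.ofReal (klFun (p x)) ∂π

variable {π : Measure X} {p q : X → ℝ≥0}

lemma IsDensity.isProbabilityMeasure (hp : IsDensity π p) :
    IsProbabilityMeasure (densityMeasure π p) :=
  ⟨by rw [withDensity_apply _ MeasurableSet.univ, Measure.restrict_univ, hp.lintegral_eq_one]⟩

lemma klDiv_densityMeasure [IsFiniteMeasure π] (hp : IsDensity π p) :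
    klDiv (densityMeasure π p) π = densityEntropy π p := by
  have := hp.isProbabilityMeasure
  rw [klDiv_eq_lintegral_klFun_of_ac (withDensity_absolutelyContinuous _ _), densityEntropy]
  refine lintegral_congr_ae ?_
  filter_upwards [Measure.rnDeriv_withDensity π hp.measurable.coe_nnreal_ennreal] with x hx
  rw [hx, ENNReal.coe_toReal]

lemma exists_isDensity_of_absolutelyContinuous [IsFiniteMeasure π] {μ : Measure X}
    [IsProbabilityMeasure μ] (h : μ ≪ π) : ∃ p, IsDensity π p ∧ densityMeasure π p = μ := by
  have density_eq : densityMeasure π (fun x => (μ.rnDeriv π x).toNNReal) = μ := by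
    refine (withDensity_congr_ae ?_).trans (Measure.withDensity_rnDeriv_eq μ π h)
    filter_upwards [Measure.rnDeriv_lt_top μ π] with x hx
    rw [ENNReal.coe_toNNReal hx.ne]
  refine ⟨_, ⟨(Measure.measurable_rnDeriv μ π).ennreal_toNNReal, ?_⟩, density_eq⟩
  have mass := measure_univ (μ := μ)
  rwa [← density_eq, withDensity_apply _ MeasurableSet.univ, Measure.restrict_univ] at mass

lemma IsDensity.smul_add_smul (hp : IsDensity π p) (hq : IsDensity π q) {a b : ℝ≥0}
    (hab : a + b = 1) : IsDensity π (a • p + b • q) := by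
  have hp_meas := hp.measurable
  have hq_meas := hq.measurable
  refine ⟨by fun_prop, ?_⟩
  simp only [Pi.add_apply, Pi.smul_apply, smul_eq_mul, ENNReal.coe_add, ENNReal.coe_mul]
  rw [lintegral_add_left (by fun_prop), lintegral_const_mul _ (by fun_prop),
    lintegral_const_mul _ (by fun_prop), hp.lintegral_eq_one, hq.lintegral_eq_one, mul_one, mul_one]
  exact_mod_cast hab

lemma densityMeasure_smul_add_smul (hp : Measurable p) (hq : Measurable q) (a b : ℝ≥0) :
    densityMeasure π (a • p + b • q) =
      (a : ℝ≥0∞) • densityMeasure π p + (b : ℝ≥0∞) • densityMeasure π q := by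
  rw [← withDensity_smul _ (by fun_prop), ← withDensity_smul _ (by fun_prop),
    ← withDensity_add_left (by fun_prop)]
  rfl

lemma densityEntropy_smul_add_smul_le (hp : Measurable p) (hq : Measurable q) {a b : ℝ≥0}
    (hab : a + b = 1) :
    densityEntropy π (a • p + b • q) ≤ a * densityEntropy π p + b * densityEntropy π q := by
  rw [densityEntropy, densityEntropy, densityEntropy, ← lintegral_const_mul _ (by fun_prop),
    ← lintegral_const_mul _ (by fun_prop), ← lintegral_add_left (by fun_prop)]
  refine lintegral_mono fun x => ?_
  have convex := convexOn_klFun.2 (p x).coe_nonneg (q x).coe_nonneg a.coe_nonneg b.coe_nonneg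
    (mod_cast hab)
  simp only [← ENNReal.ofReal_coe_nnreal, ← ENNReal.ofReal_mul NNReal.zero_le_coe]
  rw [← ENNReal.ofReal_add (mul_nonneg a.coe_nonneg (klFun_nonneg (p x).coe_nonneg))
    (mul_nonneg b.coe_nonneg (klFun_nonneg (q x).coe_nonneg))]
  exact ENNReal.ofReal_le_ofReal convex

lemma mul_log_add_le_mul_log {a m : ℝ} (ha : 0 ≤ a) (hm : 0 < m) :
    2 * a - 2 * √a * √m + a * Real.log m ≤ a * Real.log a := by
  rcases ha.eq_or_lt with rfl | ha
  · simp
  have sqrt_a_pos : 0 < √a := Real.sqrt_pos.2 ha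
  have sqrt_m_pos : 0 < √m := Real.sqrt_pos.2 hm
  have log_le : Real.log (√m / √a) ≤ √m / √a - 1 := Real.log_le_sub_one_of_pos (by positivity)
  rw [Real.log_div sqrt_m_pos.ne' sqrt_a_pos.ne', Real.log_sqrt hm.le, Real.log_sqrt ha.le]
    at log_le
  have mul_div : a * (√m / √a) = √a * √m := by
    rw [mul_div_left_comm, Real.div_sqrt, mul_comm]
  nlinarith

lemma klFun_midpoint_add_le {a b : ℝ} (ha : 0 ≤ a) (hb : 0 ≤ b) :
    klFun ((a + b) / 2) + (√a - √b) ^ 2 / 4 ≤ (klFun a + klFun b) / 2 := by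
  set m := (a + b) / 2 with hm
  have hab : a + b = 2 * m := by rw [hm]; ring
  rcases (by positivity : 0 ≤ m).eq_or_lt with hm_zero | hm_pos
  · obtain rfl : a = 0 := by linarith
    obtain rfl : b = 0 := by linarith
    simp [← hm_zero]
  have log_a := mul_log_add_le_mul_log ha hm_pos
  have log_b := mul_log_add_le_mul_log hb hm_pos
  have sq_a := Real.sq_sqrt ha
  have sq_b := Real.sq_sqrt hb
  have sq_m := Real.sq_sqrt hm_pos.le
  have hellinger : (√a - √b) ^ 2 / 4 ≤ 2 * m - √m * (√a + √b) := by
    rw [show (√a - √b) ^ 2 = (2 * √m - (√a + √b)) * (2 * √m + (√a + √b)) by nlinarith]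
    nlinarith [mul_self_nonneg (2 * √m - (√a + √b))]
  have log_ab : (a + b) * Real.log m = 2 * m * Real.log m := by rw [hab]
  simp only [klFun_apply]
  nlinarith

/-- The squared Hellinger distance of two densities, up to the factor `1/4`. -/
noncomputable def hellinger (π : Measure X) (p q : X → ℝ≥0) : ℝ≥0∞ :=
  ∫⁻ x, ENNReal.ofReal ((√(p x) - √(q x)) ^ 2 / 4) ∂π

lemma densityEntropy_midpoint_add_le (hp : Measurable p) (hq : Measurable q) :
    densityEntropy π ((2⁻¹ : ℝ≥0) • p + (2⁻¹ : ℝ≥0) • q) + hellinger π p q ≤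
      2⁻¹ * (densityEntropy π p + densityEntropy π q) := by
  simp only [densityEntropy, hellinger]
  rw [← lintegral_add_left (by fun_prop), ← lintegral_add_left (by fun_prop),
    ← lintegral_const_mul _ (by fun_prop)]
  refine lintegral_mono fun x => ?_
  have midpoint : ((((2⁻¹ : ℝ≥0) • p + (2⁻¹ : ℝ≥0) • q) x : ℝ≥0) : ℝ) = ((p x : ℝ) + q x) / 2 := by
    simp; ring
  have half : (2⁻¹ : ℝ≥0∞) = ENNReal.ofReal 2⁻¹ := by
    rw [ENNReal.ofReal_inv_of_pos two_pos, ENNReal.ofReal_ofNat]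
  rw [midpoint, half, ← ENNReal.ofReal_add (klFun_nonneg (p x).coe_nonneg)
    (klFun_nonneg (q x).coe_nonneg), ← ENNReal.ofReal_mul (by norm_num),
    ← ENNReal.ofReal_add (klFun_nonneg (by positivity)) (by positivity), inv_mul_eq_div]
  exact ENNReal.ofReal_le_ofReal (klFun_midpoint_add_le (p x).coe_nonneg (q x).coe_nonneg)

lemma ae_eq_of_hellinger_eq_zero (hp : Measurable p) (hq : Measurable q)
    (h : hellinger π p q = 0) : p =ᵐ[π] q := by
  rw [hellinger, lintegral_eq_zero_iff (by fun_prop)] at h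
  filter_upwards [h] with x hx
  have sq_eq : (√(p x : ℝ) - √(q x)) ^ 2 = 0 :=
    le_antisymm (by linarith [ENNReal.ofReal_eq_zero.1 hx]) (sq_nonneg _)
  have sqrt_eq := sub_eq_zero.1 (pow_eq_zero_iff two_ne_zero |>.1 sq_eq)
  exact NNReal.coe_injective ((Real.sqrt_inj (p x).coe_nonneg (q x).coe_nonneg).1 sqrt_eq)

lemma kernelFreeEnergy_midpoint_add_le [IsFiniteMeasure π] {k : X → X → ℝ≥0∞}
    (hk : IsPosDefKernel k) (hp : IsDensity π p) (hq : IsDensity π q) :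
    kernelFreeEnergy k π (densityMeasure π ((2⁻¹ : ℝ≥0) • p + (2⁻¹ : ℝ≥0) • q)) + hellinger π p q ≤
      2⁻¹ * (kernelFreeEnergy k π (densityMeasure π p) +
        kernelFreeEnergy k π (densityMeasure π q)) := by
  have := hp.isProbabilityMeasure
  have := hq.isProbabilityMeasure
  have half_add_half : (2⁻¹ : ℝ≥0) + 2⁻¹ = 1 := by ring
  rw [kernelFreeEnergy, klDiv_densityMeasure (hp.smul_add_smul hq half_add_half),
    densityMeasure_smul_add_smul hp.measurable hq.measurable, kernelFreeEnergy, kernelFreeEnergy,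
    klDiv_densityMeasure hp, klDiv_densityMeasure hq, add_assoc]
  refine (add_le_add (hk.energy_smul_add_smul_le _ _ (mod_cast half_add_half))
    (densityEntropy_midpoint_add_le hp.measurable hq.measurable)).trans_eq ?_
  rw [ENNReal.coe_inv two_ne_zero, ENNReal.coe_ofNat]
  ring

end FreeEnergy

section Existence

open InformationTheory

variable {X : Type*} [MeasurableSpace X] {π : Measure X} {p q : X → ℝ≥0}

lemma eLpNorm_two_sq (f : X → ℝ) : eLpNorm f 2 π ^ 2 = ∫⁻ x, ENNReal.ofReal (f x ^ 2) ∂π := by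
  have rpow := eLpNorm_nnreal_pow_eq_lintegral (μ := π) (f := f) (two_ne_zero' ℝ≥0)
  simp only [NNReal.coe_ofNat, ENNReal.rpow_ofNat, ENNReal.coe_ofNat] at rpow
  rw [rpow]
  exact lintegral_congr fun x => by
    rw [← ofReal_norm, ← ENNReal.ofReal_pow (norm_nonneg _), Real.norm_eq_abs, sq_abs]

lemma eLpNorm_sqrt_sub_sqrt_sq (p q : X → ℝ≥0) :
    eLpNorm (fun x => √(p x : ℝ) - √(q x)) 2 π ^ 2 = 4 * hellinger π p q := by
  rw [eLpNorm_two_sq, hellinger, ← lintegral_const_mul' _ _ (by norm_num)]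
  refine lintegral_congr fun x => ?_
  rw [← ENNReal.ofReal_ofNat 4, ← ENNReal.ofReal_mul (by norm_num)]
  congr 1
  ring

lemma IsDensity.eLpNorm_sqrt (hp : IsDensity π p) : eLpNorm (fun x => √(p x : ℝ)) 2 π = 1 := by
  have sq_eq_one : eLpNorm (fun x => √(p x : ℝ)) 2 π ^ 2 = 1 := by
    simp only [eLpNorm_two_sq, Real.sq_sqrt, NNReal.zero_le_coe, ENNReal.ofReal_coe_nnreal,
      hp.lintegral_eq_one]
  exact (ENNReal.pow_right_strictMono two_ne_zero).injective (sq_eq_one.trans (one_pow 2).symm)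

lemma IsDensity.memLp_sqrt (hp : IsDensity π p) : MemLp (fun x => √(p x : ℝ)) 2 π := by
  have hp_meas := hp.measurable
  exact ⟨by fun_prop, hp.eLpNorm_sqrt.trans_lt ENNReal.one_lt_top⟩

lemma cauchySeq_toLp_sqrt {p : ℕ → X → ℝ≥0} (hp : ∀ k, IsDensity π (p k)) {ε : ℕ → ℝ≥0∞}
    (hε : Tendsto ε atTop (𝓝 0))
    (h : ∀ N k l, N ≤ k → N ≤ l → hellinger π (p k) (p l) ≤ ε N) :
    CauchySeq fun k => (hp k).memLp_sqrt.toLp := by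
  rw [EMetric.cauchySeq_iff]
  intro δ hδ
  have small : ∀ᶠ N in atTop, 4 * ε N < δ ^ 2 := by
    have tendsto_zero := ENNReal.Tendsto.const_mul hε (Or.inr (ENNReal.ofNat_ne_top (n := 4)))
    rw [mul_zero] at tendsto_zero
    exact tendsto_zero.eventually_lt_const (by positivity)
  obtain ⟨N, hN⟩ := small.exists
  refine ⟨N, fun k hk l hl => (ENNReal.pow_lt_pow_left_iff two_ne_zero).1 ?_⟩
  rw [Lp.edist_toLp_toLp]
  exact ((eLpNorm_sqrt_sub_sqrt_sq _ _).trans_le (by gcongr; exact h N k l hk hl)).trans_lt hN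

/-- The square roots of the densities converge in `L²`, and a limit of unit vectors is a unit
vector. -/
lemma exists_isDensity_tendsto_ae {p : ℕ → X → ℝ≥0} (hp : ∀ k, IsDensity π (p k)) {ε : ℕ → ℝ≥0∞}
    (hε : Tendsto ε atTop (𝓝 0))
    (h : ∀ N k l, N ≤ k → N ≤ l → hellinger π (p k) (p l) ≤ ε N) :
    ∃ P, IsDensity π P ∧ ∃ u : ℕ → ℕ, StrictMono u ∧
      ∀ᵐ x ∂π, Tendsto (fun i => p (u i) x) atTop (𝓝 (P x)) := by
  obtain ⟨g, hg⟩ := cauchySeq_tendsto_of_complete (cauchySeq_toLp_sqrt hp hε h)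
  have hg_meas : Measurable g := (Lp.stronglyMeasurable g).measurable
  have norm_g : ‖g‖ = 1 := tendsto_nhds_unique hg.norm (by simp [(hp _).eLpNorm_sqrt])
  have eLpNorm_g : eLpNorm g 2 π = 1 := by
    rw [← ENNReal.ofReal_toReal (Lp.eLpNorm_ne_top g), ← Lp.norm_def, norm_g, ENNReal.ofReal_one]
  obtain ⟨u, hu, tendsto_ae⟩ := (tendstoInMeasure_of_tendsto_Lp hg).exists_seq_tendsto_ae
  refine ⟨fun x => (g x ^ 2).toNNReal, ⟨by fun_prop, ?_⟩, u, hu, ?_⟩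
  · exact (eLpNorm_two_sq g).symm.trans (by rw [eLpNorm_g, one_pow])
  · filter_upwards [tendsto_ae, ae_all_iff.2 fun k => (hp k).memLp_sqrt.coeFn_toLp] with x hx hsqrt
    refine ((continuous_real_toNNReal.tendsto _).comp (hx.pow 2)).congr fun i => ?_
    rw [Function.comp_apply, hsqrt, Real.sq_sqrt (p (u i) x).coe_nonneg, Real.toNNReal_coe]

lemma kernelEnergy_densityMeasure [SFinite π] {k : X → X → ℝ≥0∞}
    (hk : Measurable (Function.uncurry k)) (hp : Measurable p) (hq : Measurable q) :
    kernelEnergy k (densityMeasure π p) (densityMeasure π q) =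
      ∫⁻ w, p w.1 * (q w.2 * k w.1 w.2) ∂π.prod π := by
  have hk_right := fun x => hk.of_uncurry_left (x := x)
  have hk' : Measurable fun w : X × X => k w.1 w.2 := hk
  have hk_potential : Measurable fun x => ∫⁻ y, k x y ∂densityMeasure π q :=
    hk.lintegral_prod_right'
  rw [lintegral_prod _ (by fun_prop), kernelEnergy,
    lintegral_withDensity_eq_lintegral_mul _ (by fun_prop) hk_potential]
  refine lintegral_congr fun x => ?_
  rw [Pi.mul_apply, lintegral_withDensity_eq_lintegral_mul _ (by fun_prop) (hk_right x)]
  exact (lintegral_const_mul _ (by fun_prop)).symm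

lemma kernelEnergy_le_liminf [SFinite π] {k : X → X → ℝ≥0∞}
    (hk : Measurable (Function.uncurry k)) {p : ℕ → X → ℝ≥0} (hp : ∀ i, Measurable (p i))
    {P : X → ℝ≥0} (hP : Measurable P) (h : ∀ᵐ x ∂π, Tendsto (fun i => p i x) atTop (𝓝 (P x))) :
    kernelEnergy k (densityMeasure π P) (densityMeasure π P) ≤
      liminf (fun i => kernelEnergy k (densityMeasure π (p i)) (densityMeasure π (p i))) atTop := by
  have hk' : Measurable fun w : X × X => k w.1 w.2 := hk
  rw [kernelEnergy_densityMeasure hk hP hP,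
    funext fun i => kernelEnergy_densityMeasure hk (hp i) (hp i)]
  refine le_trans (lintegral_mono_ae ?_) (lintegral_liminf_le fun i => by fun_prop)
  filter_upwards [Measure.quasiMeasurePreserving_fst.ae h, Measure.quasiMeasurePreserving_snd.ae h]
    with w tendsto_fst tendsto_snd
  simp only [← mul_assoc, ← ENNReal.coe_mul]
  have tendsto_mul := ENNReal.tendsto_coe.2 (tendsto_fst.mul tendsto_snd)
  rcases eq_or_ne (P w.1 * P w.2) 0 with zero | ne_zero
  · simp [zero]
  · exact (ENNReal.Tendsto.mul_const tendsto_mul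
      (Or.inl (ENNReal.coe_ne_zero.2 ne_zero))).liminf_eq.ge

lemma densityEntropy_le_liminf {p : ℕ → X → ℝ≥0} (hp : ∀ i, Measurable (p i)) {P : X → ℝ≥0}
    (h : ∀ᵐ x ∂π, Tendsto (fun i => p i x) atTop (𝓝 (P x))) :
    densityEntropy π P ≤ liminf (fun i => densityEntropy π (p i)) atTop := by
  refine le_trans (lintegral_mono_ae ?_) (lintegral_liminf_le fun i => by fun_prop)
  filter_upwards [h] with x hx
  exact (ENNReal.tendsto_ofReal ((continuous_klFun.tendsto _).comp
    (NNReal.tendsto_coe.2 hx))).liminf_eq.ge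

lemma ennreal_liminf_add_liminf_le (u v : ℕ → ℝ≥0∞) :
    liminf u atTop + liminf v atTop ≤ liminf (fun i => u i + v i) atTop := by
  have monotone_iInf (w : ℕ → ℝ≥0∞) : Monotone fun m => ⨅ i ≥ m, w i :=
    fun _ _ h => le_iInf₂ fun i hi => iInf₂_le i (h.trans hi)
  simp only [liminf_eq_iSup_iInf_of_nat]
  rw [ENNReal.iSup_add_iSup_of_monotone (monotone_iInf u) (monotone_iInf v)]
  exact iSup_mono fun m => le_iInf₂ fun i hi => add_le_add (iInf₂_le i hi) (iInf₂_le i hi)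

lemma kernelFreeEnergy_le_liminf [IsFiniteMeasure π] {k : X → X → ℝ≥0∞}
    (hk : Measurable (Function.uncurry k)) {p : ℕ → X → ℝ≥0} (hp : ∀ i, IsDensity π (p i))
    {P : X → ℝ≥0} (hP : IsDensity π P)
    (h : ∀ᵐ x ∂π, Tendsto (fun i => p i x) atTop (𝓝 (P x))) :
    kernelFreeEnergy k π (densityMeasure π P) ≤
      liminf (fun i => kernelFreeEnergy k π (densityMeasure π (p i))) atTop := by
  simp only [kernelFreeEnergy, klDiv_densityMeasure hP, fun i => klDiv_densityMeasure (hp i)]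
  refine (add_le_add (kernelEnergy_le_liminf hk (fun i => (hp i).measurable) hP.measurable h)
    (densityEntropy_le_liminf (fun i => (hp i).measurable) h)).trans ?_
  exact ennreal_liminf_add_liminf_le _ _

lemma hellinger_le_of_near_minimizers [IsFiniteMeasure π] {k : X → X → ℝ≥0∞}
    (hk : IsPosDefKernel k) (hp : IsDensity π p) (hq : IsDensity π q) {m ε : ℝ≥0∞} (hm : m ≠ ⊤)
    (h_inf : ∀ r, IsDensity π r → m ≤ kernelFreeEnergy k π (densityMeasure π r))
    (hp_le : kernelFreeEnergy k π (densityMeasure π p) ≤ m + ε)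
    (hq_le : kernelFreeEnergy k π (densityMeasure π q) ≤ m + ε) : hellinger π p q ≤ ε := by
  refine ENNReal.le_of_add_le_add_left hm ?_
  calc m + hellinger π p q
      ≤ kernelFreeEnergy k π (densityMeasure π ((2⁻¹ : ℝ≥0) • p + (2⁻¹ : ℝ≥0) • q)) +
          hellinger π p q := by
        gcongr
        exact h_inf _ (hp.smul_add_smul hq (by ring))
    _ ≤ 2⁻¹ * (m + ε + (m + ε)) := (kernelFreeEnergy_midpoint_add_le hk hp hq).trans (by gcongr)
    _ = m + ε := by
        rw [← two_mul, ← mul_assoc, ENNReal.inv_mul_cancel two_ne_zero ENNReal.ofNat_ne_top,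
          one_mul]

theorem exists_isDensity_forall_kernelFreeEnergy_le [IsFiniteMeasure π] {k : X → X → ℝ≥0∞}
    (hk : IsPosDefKernel k) (hq : IsDensity π q)
    (hq_ne_top : kernelFreeEnergy k π (densityMeasure π q) ≠ ⊤) :
    ∃ p, IsDensity π p ∧ ∀ r, IsDensity π r →
      kernelFreeEnergy k π (densityMeasure π p) ≤ kernelFreeEnergy k π (densityMeasure π r) := by
  set m : ℝ≥0∞ := ⨅ (r) (_ : IsDensity π r), kernelFreeEnergy k π (densityMeasure π r) with hm
  have m_le : ∀ r, IsDensity π r → m ≤ kernelFreeEnergy k π (densityMeasure π r) :=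
    fun r hr => iInf₂_le r hr
  have m_ne_top : m ≠ ⊤ := ne_top_of_le_ne_top hq_ne_top (m_le q hq)
  have exists_near (i : ℕ) : ∃ p, IsDensity π p ∧
      kernelFreeEnergy k π (densityMeasure π p) ≤ m + (i : ℝ≥0∞)⁻¹ := by
    have lt := ENNReal.lt_add_right m_ne_top (ENNReal.inv_ne_zero.2 (ENNReal.natCast_ne_top i))
    obtain ⟨p, hp, p_lt⟩ : ∃ p, ∃ _ : IsDensity π p, _ := by
      simpa only [hm, iInf_lt_iff] using lt
    exact ⟨p, hp, p_lt.le⟩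
  choose p hp hp_le using exists_near
  obtain ⟨P, hP, u, hu, tendsto_ae⟩ := exists_isDensity_tendsto_ae hp
    ENNReal.tendsto_inv_nat_nhds_zero fun N i j hi hj =>
      hellinger_le_of_near_minimizers hk (hp i) (hp j) m_ne_top m_le
        ((hp_le i).trans (by gcongr)) ((hp_le j).trans (by gcongr))
  refine ⟨P, hP, fun r hr => le_trans ?_ (m_le r hr)⟩
  have tendsto_m : Tendsto (fun i => m + (u i : ℝ≥0∞)⁻¹) atTop (𝓝 m) := by
    simpa using tendsto_const_nhds.add (ENNReal.tendsto_inv_nat_nhds_zero.comp hu.tendsto_atTop)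
  calc kernelFreeEnergy k π (densityMeasure π P)
      ≤ liminf (fun i => kernelFreeEnergy k π (densityMeasure π (p (u i)))) atTop :=
        kernelFreeEnergy_le_liminf hk.measurable_uncurry (fun i => hp (u i)) hP tendsto_ae
    _ ≤ liminf (fun i => m + (u i : ℝ≥0∞)⁻¹) atTop :=
        liminf_le_liminf (Eventually.of_forall fun i => hp_le (u i))
    _ = m := tendsto_m.liminf_eq

end Existence

section GibbsMeasure

open InformationTheory

variable {X : Type*} [MeasurableSpace X] {π : Measure X} {w : X → ℝ≥0∞}

/-- The probability measure proportional to `e^{-w} dπ`. -/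
noncomputable def gibbsMeasure (π : Measure X) (w : X → ℝ≥0∞) : Measure X :=
  (∫⁻ x, expNeg (w x) ∂π)⁻¹ • π.withDensity fun x => expNeg (w x)

/-- The density of `gibbsMeasure π w` with respect to `π`. -/
noncomputable def gibbsDensity (π : Measure X) (w : X → ℝ≥0∞) (x : X) : ℝ≥0 :=
  ((∫⁻ y, expNeg (w y) ∂π)⁻¹ * expNeg (w x)).toNNReal

lemma lintegral_expNeg_le_one [IsProbabilityMeasure π] (w : X → ℝ≥0∞) :
    ∫⁻ x, expNeg (w x) ∂π ≤ 1 :=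
  (lintegral_mono fun x => expNeg_le_one (w x)).trans_eq (by simp)

lemma lintegral_expNeg_ne_zero (hw : Measurable w) (hw_fin : ∃ᶠ x in ae π, w x ≠ ⊤) :
    ∫⁻ x, expNeg (w x) ∂π ≠ 0 := by
  intro h
  obtain ⟨x, hx_fin, hx⟩ :=
    (hw_fin.and_eventually ((lintegral_eq_zero_iff (by fun_prop)).1 h)).exists
  exact (expNeg_pos hx_fin).ne' hx

lemma measurable_gibbsDensity (hw : Measurable w) : Measurable (gibbsDensity π w) := by
  unfold gibbsDensity
  fun_prop

lemma coe_gibbsDensity (hw : Measurable w) (hw_fin : ∃ᶠ x in ae π, w x ≠ ⊤) (x : X) :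
    (gibbsDensity π w x : ℝ≥0∞) = (∫⁻ y, expNeg (w y) ∂π)⁻¹ * expNeg (w x) :=
  ENNReal.coe_toNNReal (ENNReal.mul_ne_top
    (ENNReal.inv_ne_top.2 (lintegral_expNeg_ne_zero hw hw_fin)) (expNeg_ne_top _))

lemma densityMeasure_gibbsDensity (hw : Measurable w) (hw_fin : ∃ᶠ x in ae π, w x ≠ ⊤) :
    densityMeasure π (gibbsDensity π w) = gibbsMeasure π w := by
  rw [gibbsMeasure, ← withDensity_smul _ (by fun_prop)]
  exact congrArg π.withDensity (funext (coe_gibbsDensity hw hw_fin))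

lemma isDensity_gibbsDensity [IsProbabilityMeasure π] (hw : Measurable w)
    (hw_fin : ∀ᵐ x ∂π, w x ≠ ⊤) : IsDensity π (gibbsDensity π w) := by
  refine ⟨measurable_gibbsDensity hw, ?_⟩
  simp only [coe_gibbsDensity hw hw_fin.frequently]
  rw [lintegral_const_mul _ (by fun_prop)]
  exact ENNReal.inv_mul_cancel (lintegral_expNeg_ne_zero hw hw_fin.frequently)
    ((lintegral_expNeg_le_one w).trans_lt ENNReal.one_lt_top).ne

lemma gibbsMeasure_le_smul (hw : Measurable w) :
    gibbsMeasure π w ≤ (∫⁻ x, expNeg (w x) ∂π)⁻¹ • π := by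
  rw [gibbsMeasure, ← withDensity_smul _ (by fun_prop), ← withDensity_const]
  exact withDensity_mono (ae_of_all _ fun x => mul_le_of_le_one_right' (expNeg_le_one _))

lemma toReal_lintegral_expNeg_pos [IsProbabilityMeasure π] (hw : Measurable w)
    (hw_fin : ∀ᵐ x ∂π, w x ≠ ⊤) : 0 < (∫⁻ x, expNeg (w x) ∂π).toReal :=
  ENNReal.toReal_pos (lintegral_expNeg_ne_zero hw hw_fin.frequently)
    ((lintegral_expNeg_le_one w).trans_lt ENNReal.one_lt_top).ne

lemma gibbsDensity_toReal (hw : Measurable w) (hw_fin : ∃ᶠ x in ae π, w x ≠ ⊤) {x : X}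
    (hx : w x ≠ ⊤) : (gibbsDensity π w x : ℝ) =
      (∫⁻ y, expNeg (w y) ∂π).toReal⁻¹ * Real.exp (-(w x).toReal) := by
  rw [← ENNReal.coe_toReal, coe_gibbsDensity hw hw_fin, ENNReal.toReal_mul, ENNReal.toReal_inv,
    expNeg_of_ne_top hx, ENNReal.toReal_ofReal (Real.exp_pos _).le]

lemma gibbsDensity_pos (hw : Measurable w) (hw_fin : ∃ᶠ x in ae π, w x ≠ ⊤)
    (h_top : ∫⁻ x, expNeg (w x) ∂π ≠ ⊤) {x : X} (hx : w x ≠ ⊤) : 0 < gibbsDensity π w x := by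
  rw [← ENNReal.coe_pos, coe_gibbsDensity hw hw_fin]
  exact ENNReal.mul_pos (ENNReal.inv_ne_zero.2 h_top) (expNeg_pos hx).ne'

lemma densityMeasure_gibbsMeasure_div [IsProbabilityMeasure π] (hw : Measurable w)
    (hw_fin : ∀ᵐ x ∂π, w x ≠ ⊤) {q : X → ℝ≥0} (hq : Measurable q) :
    densityMeasure (gibbsMeasure π w) (fun x => q x / gibbsDensity π w x) = densityMeasure π q := by
  have hσ_meas := measurable_gibbsDensity (π := π) hw
  rw [← densityMeasure_gibbsDensity hw hw_fin.frequently, densityMeasure,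
    ← withDensity_mul _ (by fun_prop) (by fun_prop)]
  refine withDensity_congr_ae ?_
  filter_upwards [hw_fin] with x hx
  rw [Pi.mul_apply, ← ENNReal.coe_mul, mul_div_cancel₀ _ (gibbsDensity_pos hw hw_fin.frequently
    ((lintegral_expNeg_le_one w).trans_lt ENNReal.one_lt_top).ne hx).ne']

lemma klDiv_gibbsMeasure [IsProbabilityMeasure π] (hw : Measurable w) (hw_fin : ∀ᵐ x ∂π, w x ≠ ⊤)
    {q : X → ℝ≥0} (hq : IsDensity π q) :
    klDiv (densityMeasure π q) (gibbsMeasure π w) =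
      ∫⁻ x, gibbsDensity π w x * ENNReal.ofReal (klFun (q x / gibbsDensity π w x)) ∂π := by
  have hσ_meas := measurable_gibbsDensity (π := π) hw
  have hq_meas := hq.measurable
  have quotient_density :
      IsDensity (gibbsMeasure π w) fun x => q x / gibbsDensity π w x := by
    refine ⟨by fun_prop, ?_⟩
    have mass := hq.isProbabilityMeasure.measure_univ
    rwa [← densityMeasure_gibbsMeasure_div hw hw_fin hq_meas,
      withDensity_apply _ MeasurableSet.univ, Measure.restrict_univ] at mass
  have : IsProbabilityMeasure (gibbsMeasure π w) :=
    densityMeasure_gibbsDensity hw hw_fin.frequently ▸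
      (isDensity_gibbsDensity hw hw_fin).isProbabilityMeasure
  rw [← densityMeasure_gibbsMeasure_div hw hw_fin hq_meas, klDiv_densityMeasure quotient_density,
    densityEntropy, ← densityMeasure_gibbsDensity hw hw_fin.frequently,
    lintegral_withDensity_eq_lintegral_mul _ (by fun_prop) (by fun_prop)]
  rfl

lemma klFun_add_mul_add_eq {q w z : ℝ} (hq : 0 ≤ q) (hz : 0 < z) :
    klFun q + w * q + z⁻¹ * Real.exp (-w) =
      z⁻¹ * Real.exp (-w) * klFun (q / (z⁻¹ * Real.exp (-w))) + -Real.log z * q + 1 := by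
  simp only [klFun_apply]
  rcases hq.eq_or_lt with rfl | hq
  · simp [add_comm]
  · rw [Real.log_div hq.ne' (by positivity), Real.log_mul (by positivity) (Real.exp_pos _).ne',
      Real.log_exp, Real.log_inv]
    field_simp
    ring

/-- Gibbs' variational principle: the free energy in the external potential `w` exceeds its
minimum by the entropy relative to the minimizer `gibbsMeasure π w`. -/
lemma densityEntropy_add_lintegral_eq [IsProbabilityMeasure π] (hw : Measurable w)
    (hw_fin : ∀ᵐ x ∂π, w x ≠ ⊤) {q : X → ℝ≥0} (hq : IsDensity π q) :
    densityEntropy π q + ∫⁻ x, w x ∂densityMeasure π q =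
      klDiv (densityMeasure π q) (gibbsMeasure π w) +
        ENNReal.ofReal (-Real.log (∫⁻ x, expNeg (w x) ∂π).toReal) := by
  set z := (∫⁻ x, expNeg (w x) ∂π).toReal
  set σ := gibbsDensity π w
  have hq_meas := hq.measurable
  have hσ := isDensity_gibbsDensity hw hw_fin
  have hσ_meas := hσ.measurable
  have z_pos : 0 < z := toReal_lintegral_expNeg_pos hw hw_fin
  have log_nonneg : 0 ≤ -Real.log z := neg_nonneg.2 (Real.log_nonpos z_pos.le
    (ENNReal.toReal_le_of_le_ofReal zero_le_one (by simpa using lintegral_expNeg_le_one w)))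
  have pointwise : ∀ᵐ x ∂π, ENNReal.ofReal (klFun (q x)) + q x * w x + σ x =
      σ x * ENNReal.ofReal (klFun (q x / σ x)) + ENNReal.ofReal (-Real.log z) * q x + 1 := by
    filter_upwards [hw_fin] with x hx
    have identity := klFun_add_mul_add_eq (w := (w x).toReal) (q x).coe_nonneg z_pos
    rw [← gibbsDensity_toReal hw hw_fin.frequently hx] at identity
    have klFun_q := klFun_nonneg (q x).coe_nonneg
    have klFun_div := klFun_nonneg (x := (q x / σ x : ℝ)) (by positivity)
    simp only [← ENNReal.ofReal_coe_nnreal, ← ENNReal.ofReal_one]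
    rw [← ENNReal.ofReal_toReal hx, ← ENNReal.ofReal_mul (by positivity),
      ← ENNReal.ofReal_mul (by positivity), ← ENNReal.ofReal_mul log_nonneg,
      ← ENNReal.ofReal_add klFun_q (by positivity), ← ENNReal.ofReal_add (by positivity)
      (by positivity), ← ENNReal.ofReal_add (by positivity) (by positivity),
      ← ENNReal.ofReal_add (by positivity) zero_le_one, mul_comm (q x : ℝ), identity]
  have integrated := lintegral_congr_ae pointwise
  rw [lintegral_add_right _ (by fun_prop), lintegral_add_left (by fun_prop),
    lintegral_add_right _ (by fun_prop), lintegral_add_right _ (by fun_prop), hσ.lintegral_eq_one,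
    lintegral_const_mul _ (by fun_prop), hq.lintegral_eq_one, lintegral_const, measure_univ,
    mul_one, mul_one] at integrated
  rw [klDiv_gibbsMeasure hw hw_fin hq,
    lintegral_withDensity_eq_lintegral_mul _ (by fun_prop) hw]
  exact (ENNReal.add_left_inj ENNReal.one_ne_top).1 integrated

lemma exists_gibbsDensity_le (hw : Measurable w) (hw_fin : ∃ᶠ x in ae π, w x ≠ ⊤) :
    ∃ G, ∀ x, gibbsDensity π w x ≤ G := by
  lift (∫⁻ x, expNeg (w x) ∂π)⁻¹ to ℝ≥0
    using ENNReal.inv_ne_top.2 (lintegral_expNeg_ne_zero hw hw_fin) with G hG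
  refine ⟨G, fun x => ?_⟩
  rw [← ENNReal.coe_le_coe, coe_gibbsDensity hw hw_fin, hG]
  exact mul_le_of_le_one_right' (expNeg_le_one _)

end GibbsMeasure

section Minimizer

open InformationTheory

variable {X : Type*} [MeasurableSpace X] {π : Measure X} {k : X → X → ℝ≥0∞} {p q : X → ℝ≥0}

lemma le_of_forall_le_quadratic_interpolation {a b c h g : ℝ}
    (H : ∀ t ∈ Set.Ioo (0 : ℝ) 1, a + h ≤ (1 - t) ^ 2 * a + 2 * ((1 - t) * t) * b + t ^ 2 * c +
      ((1 - t) * h + t * g)) : h + 2 * a ≤ g + 2 * b := by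
  have tendsto_quotient : Tendsto (fun t : ℝ => g + 2 * b + t * (a - 2 * b + c)) (𝓝[>] 0)
      (𝓝 (g + 2 * b + 0 * (a - 2 * b + c))) :=
    (by fun_prop : Continuous fun t : ℝ => g + 2 * b + t * (a - 2 * b + c)).tendsto 0 |>.mono_left
      nhdsWithin_le_nhds
  rw [zero_mul, add_zero] at tendsto_quotient
  refine ge_of_tendsto tendsto_quotient ?_
  filter_upwards [Ioo_mem_nhdsGT zero_lt_one] with t ht
  refine le_of_mul_le_mul_left ?_ ht.1
  linarith [H t ht]

lemma kernelFreeEnergy_smul_add_smul_le [IsFiniteMeasure π] (hk : IsPosDefKernel k)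
    (hp : IsDensity π p) (hq : IsDensity π q) {a b : ℝ≥0} (hab : a + b = 1) :
    kernelFreeEnergy k π (densityMeasure π (a • p + b • q)) ≤
      a * a * kernelEnergy k (densityMeasure π p) (densityMeasure π p) +
      2 * (a * b) * kernelEnergy k (densityMeasure π p) (densityMeasure π q) +
      b * b * kernelEnergy k (densityMeasure π q) (densityMeasure π q) +
      (a * densityEntropy π p + b * densityEntropy π q) := by
  have := hp.isProbabilityMeasure
  have := hq.isProbabilityMeasure
  rw [kernelFreeEnergy, klDiv_densityMeasure (hp.smul_add_smul hq hab),
    densityMeasure_smul_add_smul hp.measurable hq.measurable,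
    kernelEnergy_smul_add_smul hk.measurable_uncurry hk.symm]
  gcongr
  exact densityEntropy_smul_add_smul_le hp.measurable hq.measurable hab

/-- Compare `p` with `(1 - b) p + b q` and let `b → 0`. -/
lemma densityEntropy_add_two_mul_kernelEnergy_le [IsFiniteMeasure π] (hk : IsPosDefKernel k)
    (hp : IsDensity π p) (hq : IsDensity π q)
    (hp_min : ∀ r, IsDensity π r →
      kernelFreeEnergy k π (densityMeasure π p) ≤ kernelFreeEnergy k π (densityMeasure π r))
    (hq_fin : kernelFreeEnergy k π (densityMeasure π q) ≠ ⊤) :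
    densityEntropy π p + 2 * kernelEnergy k (densityMeasure π p) (densityMeasure π p) ≤
      densityEntropy π q + 2 * kernelEnergy k (densityMeasure π p) (densityMeasure π q) := by
  have := hp.isProbabilityMeasure
  have := hq.isProbabilityMeasure
  have hp_fin := ne_top_of_le_ne_top hq_fin (hp_min q hq)
  have interpolation {a b : ℝ≥0} (hab : a + b = 1) := (hp_min _ (hp.smul_add_smul hq hab)).trans
    (kernelFreeEnergy_smul_add_smul_le hk hp hq hab)
  have cauchy_schwarz := hk.two_mul_energy_le (densityMeasure π p) (densityMeasure π q)
  simp only [kernelFreeEnergy, klDiv_densityMeasure hp, klDiv_densityMeasure hq]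
    at interpolation hp_fin hq_fin
  obtain ⟨energy_p_fin, entropy_p_fin⟩ := ENNReal.add_ne_top.1 hp_fin
  obtain ⟨energy_q_fin, entropy_q_fin⟩ := ENNReal.add_ne_top.1 hq_fin
  have energy_pq_fin : kernelEnergy k (densityMeasure π p) (densityMeasure π q) ≠ ⊤ := by
    intro h
    rw [h, ENNReal.mul_top two_ne_zero, top_le_iff] at cauchy_schwarz
    exact ENNReal.add_ne_top.2 ⟨energy_p_fin, energy_q_fin⟩ cauchy_schwarz
  lift kernelEnergy k (densityMeasure π p) (densityMeasure π p) to ℝ≥0 using energy_p_fin with a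
  lift kernelEnergy k (densityMeasure π q) (densityMeasure π q) to ℝ≥0 using energy_q_fin with c
  lift kernelEnergy k (densityMeasure π p) (densityMeasure π q) to ℝ≥0 using energy_pq_fin with b
  lift densityEntropy π p to ℝ≥0 using entropy_p_fin with h
  lift densityEntropy π q to ℝ≥0 using entropy_q_fin with g
  norm_cast at interpolation ⊢
  rw [← NNReal.coe_le_coe]
  push_cast
  refine le_of_forall_le_quadratic_interpolation (c := c) fun t ht => ?_
  lift t to ℝ≥0 using ht.1.le
  have add_eq_one : 1 - t + t = 1 := tsub_add_cancel_of_le (mod_cast ht.2.le)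
  have real_interpolation := NNReal.coe_le_coe.2 (interpolation add_eq_one)
  push_cast [NNReal.coe_sub (mod_cast ht.2.le : t ≤ 1)] at real_interpolation
  linarith

/-- `μ` minimizes the free energy over all probability measures. -/
def IsKernelFreeEnergyMinimizer (k : X → X → ℝ≥0∞) (π : Measure X) (μ : ProbabilityMeasure X) :
    Prop :=
  ∀ ν : ProbabilityMeasure X, kernelFreeEnergy k π μ ≤ kernelFreeEnergy k π ν

lemma kernelFreeEnergy_of_not_absolutelyContinuous {μ : Measure X} (h : ¬ μ ≪ π) :
    kernelFreeEnergy k π μ = ⊤ := by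
  rw [kernelFreeEnergy, klDiv_of_not_ac h, add_top]

lemma kernelFreeEnergy_self_ne_top [IsProbabilityMeasure π] {B : ℝ≥0}
    (hB : ∀ x, ∫⁻ y, k x y ∂π ≤ B) : kernelFreeEnergy k π π ≠ ⊤ := by
  rw [kernelFreeEnergy, klDiv_self, add_zero]
  exact ((lintegral_mono hB).trans_lt (by simp)).ne

theorem exists_isKernelFreeEnergyMinimizer [IsProbabilityMeasure π] (hk : IsPosDefKernel k)
    {B : ℝ≥0} (hB : ∀ x, ∫⁻ y, k x y ∂π ≤ B) : ∃ μ, IsKernelFreeEnergyMinimizer k π μ := by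
  obtain ⟨q, hq, density_eq⟩ :=
    exists_isDensity_of_absolutelyContinuous (Measure.AbsolutelyContinuous.refl π)
  obtain ⟨p, hp, hp_min⟩ := exists_isDensity_forall_kernelFreeEnergy_le hk hq
    (by rw [density_eq]; exact kernelFreeEnergy_self_ne_top hB)
  refine ⟨⟨densityMeasure π p, hp.isProbabilityMeasure⟩, fun ν => ?_⟩
  by_cases h : (ν : Measure X) ≪ π
  · obtain ⟨r, hr, hr_eq⟩ := exists_isDensity_of_absolutelyContinuous h
    exact hr_eq ▸ hp_min r hr
  · exact le_top.trans_eq (kernelFreeEnergy_of_not_absolutelyContinuous h).symm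

lemma IsKernelFreeEnergyMinimizer.exists_isDensity [IsProbabilityMeasure π] {B : ℝ≥0}
    (hB : ∀ x, ∫⁻ y, k x y ∂π ≤ B) {μ : ProbabilityMeasure X}
    (hμ : IsKernelFreeEnergyMinimizer k π μ) :
    ∃ p, IsDensity π p ∧ densityMeasure π p = μ ∧ ∀ r, IsDensity π r →
      kernelFreeEnergy k π (densityMeasure π p) ≤ kernelFreeEnergy k π (densityMeasure π r) := by
  have absolutely_continuous : (μ : Measure X) ≪ π := by
    by_contra h
    have := hμ ⟨π, inferInstance⟩
    rw [kernelFreeEnergy_of_not_absolutelyContinuous h, top_le_iff] at this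
    exact kernelFreeEnergy_self_ne_top hB this
  obtain ⟨p, hp, hp_eq⟩ := exists_isDensity_of_absolutelyContinuous absolutely_continuous
  exact ⟨p, hp, hp_eq, fun r hr => hp_eq ▸ hμ ⟨densityMeasure π r, hr.isProbabilityMeasure⟩⟩

theorem IsKernelFreeEnergyMinimizer.unique [IsProbabilityMeasure π] (hk : IsPosDefKernel k)
    {B : ℝ≥0} (hB : ∀ x, ∫⁻ y, k x y ∂π ≤ B) {μ ν : ProbabilityMeasure X}
    (hμ : IsKernelFreeEnergyMinimizer k π μ) (hν : IsKernelFreeEnergyMinimizer k π ν) : μ = ν := by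
  obtain ⟨p, hp, hp_eq, hp_min⟩ := hμ.exists_isDensity hB
  obtain ⟨q, hq, hq_eq, hq_min⟩ := hν.exists_isDensity hB
  have min_ne_top : kernelFreeEnergy k π (densityMeasure π p) ≠ ⊤ :=
    hp_eq ▸ ne_top_of_le_ne_top (kernelFreeEnergy_self_ne_top hB) (hμ ⟨π, inferInstance⟩)
  have hellinger_le_zero : hellinger π p q ≤ 0 :=
    hellinger_le_of_near_minimizers hk hp hq min_ne_top hp_min (by simp)
      (by simpa using hq_min p hp)
  have ae_eq := ae_eq_of_hellinger_eq_zero hp.measurable hq.measurable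
    (nonpos_iff_eq_zero.1 hellinger_le_zero)
  refine Subtype.ext ?_
  exact hp_eq.symm.trans
    ((withDensity_congr_ae (ae_eq.mono fun x hx => congrArg ENNReal.ofNNReal hx)).trans hq_eq)

lemma lintegral_lintegral_le_of_forall_le [SFinite π] {μ : Measure X} [IsProbabilityMeasure μ]
    (hk : IsPosDefKernel k) {B : ℝ≥0∞} (hB : ∀ x, ∫⁻ y, k x y ∂π ≤ B) :
    ∫⁻ x, ∫⁻ y, k x y ∂μ ∂π ≤ B := by
  change kernelEnergy k π μ ≤ B
  rw [kernelEnergy_comm hk.measurable_uncurry hk.symm]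
  exact (lintegral_mono hB).trans_eq (by simp)

lemma kernelEnergy_ne_top_of_le_smul {B : ℝ≥0} {C : ℝ≥0∞} (hC : C ≠ ⊤)
    (hB : ∀ x, ∫⁻ y, k x y ∂π ≤ B) {μ : Measure X} [IsProbabilityMeasure μ] (hμ : μ ≤ C • π) :
    kernelEnergy k μ μ ≠ ⊤ := by
  have potential_le (x : X) : ∫⁻ y, k x y ∂μ ≤ C * B :=
    (lintegral_mono' hμ le_rfl).trans (by
      rw [lintegral_smul_measure, smul_eq_mul]
      gcongr
      exact hB x)
  refine ((lintegral_mono potential_le).trans_lt ?_).ne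
  simpa using ENNReal.mul_lt_top hC.lt_top ENNReal.coe_lt_top

/-- Combines the first variation at the minimizer with the Gibbs principle for its potential. -/
lemma klDiv_gibbsMeasure_potential_le [IsProbabilityMeasure π] (hk : IsPosDefKernel k)
    (hp : IsDensity π p) {w : X → ℝ≥0∞} (hw : Measurable w) (hw_fin : ∀ᵐ x ∂π, w x ≠ ⊤)
    (hw_eq : ∀ x, w x = 2 * ∫⁻ y, k x y ∂densityMeasure π p)
    (hp_min : ∀ r, IsDensity π r →
      kernelFreeEnergy k π (densityMeasure π p) ≤ kernelFreeEnergy k π (densityMeasure π r))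
    (hq : IsDensity π q) (hq_fin : kernelFreeEnergy k π (densityMeasure π q) ≠ ⊤) :
    klDiv (densityMeasure π p) (gibbsMeasure π w) ≤
      klDiv (densityMeasure π q) (gibbsMeasure π w) := by
  have := hp.isProbabilityMeasure
  have lintegral_w {r : X → ℝ≥0} (hr : IsDensity π r) : ∫⁻ x, w x ∂densityMeasure π r =
      2 * kernelEnergy k (densityMeasure π p) (densityMeasure π r) := by
    have := hr.isProbabilityMeasure
    simp only [hw_eq]
    rw [lintegral_const_mul' _ _ ENNReal.ofNat_ne_top,
      kernelEnergy_comm hk.measurable_uncurry hk.symm, kernelEnergy]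
  have first_variation := densityEntropy_add_two_mul_kernelEnergy_le hk hp hq hp_min hq_fin
  rw [← lintegral_w hp, ← lintegral_w hq, densityEntropy_add_lintegral_eq hw hw_fin hp,
    densityEntropy_add_lintegral_eq hw hw_fin hq] at first_variation
  exact (ENNReal.add_le_add_iff_right ENNReal.ofReal_ne_top).1 first_variation

lemma kernelFreeEnergy_gibbsDensity_ne_top [IsProbabilityMeasure π] {B : ℝ≥0}
    (hB : ∀ x, ∫⁻ y, k x y ∂π ≤ B) {w : X → ℝ≥0∞} (hw : Measurable w)
    (hw_fin : ∀ᵐ x ∂π, w x ≠ ⊤) :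
    kernelFreeEnergy k π (densityMeasure π (gibbsDensity π w)) ≠ ⊤ := by
  have hσ := isDensity_gibbsDensity hw hw_fin
  have := hσ.isProbabilityMeasure
  refine ENNReal.add_ne_top.2 ⟨?_, ?_⟩
  · refine kernelEnergy_ne_top_of_le_smul
      (ENNReal.inv_ne_top.2 (lintegral_expNeg_ne_zero hw hw_fin.frequently)) hB ?_
    rw [densityMeasure_gibbsDensity hw hw_fin.frequently]
    exact gibbsMeasure_le_smul hw
  · have principle := densityEntropy_add_lintegral_eq hw hw_fin hσ
    rw [densityMeasure_gibbsDensity hw hw_fin.frequently] at *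
    rw [klDiv_self, zero_add] at principle
    rw [← densityMeasure_gibbsDensity hw hw_fin.frequently, klDiv_densityMeasure hσ]
    exact ne_top_of_le_ne_top ENNReal.ofReal_ne_top (le_self_add.trans_eq principle)

theorem IsKernelFreeEnergyMinimizer.eq_gibbsMeasure [IsProbabilityMeasure π]
    (hk : IsPosDefKernel k) {B : ℝ≥0} (hB : ∀ x, ∫⁻ y, k x y ∂π ≤ B) {μ : ProbabilityMeasure X}
    (hμ : IsKernelFreeEnergyMinimizer k π μ) :
    (μ : Measure X) = gibbsMeasure π fun x => 2 * ∫⁻ y, k x y ∂μ := by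
  obtain ⟨p, hp, hp_eq, hp_min⟩ := hμ.exists_isDensity hB
  rw [← hp_eq]
  have := hp.isProbabilityMeasure
  have potential_meas : Measurable fun x => ∫⁻ y, k x y ∂densityMeasure π p :=
    hk.measurable_uncurry.lintegral_prod_right'
  have hw := potential_meas.const_mul 2
  have hw_fin : ∀ᵐ x ∂π, 2 * ∫⁻ y, k x y ∂densityMeasure π p ≠ ⊤ := by
    filter_upwards [ae_lt_top potential_meas ((lintegral_lintegral_le_of_forall_le hk hB).trans_lt
      ENNReal.coe_lt_top).ne] with x hx using ENNReal.mul_ne_top ENNReal.ofNat_ne_top hx.ne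
  have hσ := isDensity_gibbsDensity hw hw_fin
  have := hσ.isProbabilityMeasure
  have klDiv_le := klDiv_gibbsMeasure_potential_le hk hp hw hw_fin (fun _ => rfl) hp_min hσ
    (kernelFreeEnergy_gibbsDensity_ne_top hB hw hw_fin)
  rw [densityMeasure_gibbsDensity hw hw_fin.frequently] at *
  rw [klDiv_self, nonpos_iff_eq_zero] at klDiv_le
  exact klDiv_eq_zero_iff.1 klDiv_le

end Minimizer

section GibbsOperations

variable {X Y : Type*} [MeasurableSpace X] [MeasurableSpace Y] {ν : Measure X} {v w : X → ℝ≥0∞}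

lemma isProbabilityMeasure_gibbsMeasure (h_zero : ∫⁻ x, expNeg (w x) ∂ν ≠ 0)
    (h_top : ∫⁻ x, expNeg (w x) ∂ν ≠ ⊤) : IsProbabilityMeasure (gibbsMeasure ν w) := by
  refine ⟨?_⟩
  rw [gibbsMeasure, Measure.smul_apply, withDensity_apply _ MeasurableSet.univ,
    Measure.restrict_univ, smul_eq_mul, ENNReal.inv_mul_cancel h_zero h_top]

lemma gibbsMeasure_smul_measure {c : ℝ≥0∞} (hc_zero : c ≠ 0) (hc_top : c ≠ ⊤) :
    gibbsMeasure (c • ν) w = gibbsMeasure ν w := by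
  rw [gibbsMeasure, lintegral_smul_measure, withDensity_smul_measure, smul_smul, smul_eq_mul,
    ENNReal.mul_inv (.inl hc_zero) (.inl hc_top), mul_right_comm,
    ENNReal.inv_mul_cancel hc_zero hc_top, one_mul, gibbsMeasure]

lemma gibbsMeasure_withDensity_expNeg (hv : Measurable v) (hw : Measurable w) :
    gibbsMeasure (ν.withDensity fun x => expNeg (v x)) w = gibbsMeasure ν fun x => v x + w x := by
  simp only [gibbsMeasure, expNeg_add]
  rw [lintegral_withDensity_eq_lintegral_mul _ (by fun_prop) (by fun_prop),
    ← withDensity_mul _ (by fun_prop) (by fun_prop)]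
  rfl

lemma gibbsMeasure_add (hv : Measurable v) (hw : Measurable w)
    (h_zero : ∫⁻ x, expNeg (v x) ∂ν ≠ 0) (h_top : ∫⁻ x, expNeg (v x) ∂ν ≠ ⊤) :
    (gibbsMeasure ν fun x => v x + w x) = gibbsMeasure (gibbsMeasure ν v) w := by
  rw [← gibbsMeasure_withDensity_expNeg hv hw, gibbsMeasure.eq_def ν v,
    gibbsMeasure_smul_measure (ENNReal.inv_ne_zero.2 h_top) (ENNReal.inv_ne_top.2 h_zero)]

lemma map_gibbsMeasure_comp {ν' : Measure Y} {f : X → Y} (hf : MeasurePreserving f ν ν')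
    {w : Y → ℝ≥0∞} (hw : Measurable w) :
    (gibbsMeasure ν fun x => w (f x)).map f = gibbsMeasure ν' w := by
  have h_exp : Measurable fun y => expNeg (w y) := by fun_prop
  ext t ht
  simp only [gibbsMeasure, Measure.map_apply hf.measurable ht, Measure.smul_apply,
    withDensity_apply _ ht, withDensity_apply _ (hf.measurable ht), hf.lintegral_comp h_exp,
    hf.setLIntegral_comp_preimage ht h_exp]

lemma gibbsMeasure_prod_snd [IsProbabilityMeasure ν] (ξ : Measure Y) [SFinite ξ] {v : Y → ℝ≥0∞}
    (hv : Measurable v) :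
    (gibbsMeasure (ν.prod ξ) fun q => v q.2) = ν.prod (gibbsMeasure ξ v) := by
  have h_exp : Measurable fun y => expNeg (v y) := by fun_prop
  rw [gibbsMeasure, gibbsMeasure, Measure.prod_smul_right, prod_withDensity_right h_exp,
    measurePreserving_snd.lintegral_comp h_exp]

lemma lintegral_pi_prod [SigmaFinite ν] : ∀ {N : ℕ} {f : Fin N → X → ℝ≥0∞},
    (∀ i, Measurable (f i)) →
    ∫⁻ x, ∏ i, f i (x i) ∂(Measure.pi fun _ => ν) = ∏ i, ∫⁻ a, f i a ∂ν
  | 0, f, _ => by simp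
  | N + 1, f, hf => by
    have hp := (measurePreserving_piFinSuccAbove (fun _ : Fin (N + 1) => ν) 0).symm
    rw [← hp.lintegral_comp (by fun_prop), Fin.prod_univ_succ,
      ← lintegral_pi_prod fun i => hf i.succ,
      ← lintegral_prod_mul (hf 0).aemeasurable (Finset.measurable_prod _ fun i _ =>
        (hf i.succ).comp (measurable_pi_apply i)).aemeasurable]
    refine lintegral_congr fun q => ?_
    simp [Fin.prod_univ_succ, MeasurableEquiv.piFinSuccAbove]

lemma pi_withDensity [SigmaFinite ν] {f : X → ℝ≥0∞} (hf : Measurable f)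
    [SigmaFinite (ν.withDensity f)] (N : ℕ) :
    (Measure.pi fun _ : Fin N => ν.withDensity f) =
      (Measure.pi fun _ : Fin N => ν).withDensity fun x => ∏ i, f (x i) := by
  refine Measure.pi_eq fun t ht => ?_
  have h_indicator (x : Fin N → X) : (Set.univ.pi t).indicator (fun x => ∏ i, f (x i)) x =
      ∏ i, (t i).indicator f (x i) := by
    by_cases hx : ∀ i, x i ∈ t i
    · simp [Set.indicator, hx]
    · obtain ⟨i, hi⟩ := not_forall.1 hx
      rw [Set.indicator_of_notMem (by simpa using hx),
        Finset.prod_eq_zero (Finset.mem_univ i) (Set.indicator_of_notMem hi f)]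
  rw [withDensity_apply _ (.univ_pi ht), ← lintegral_indicator (.univ_pi ht)]
  simp only [h_indicator]
  rw [lintegral_pi_prod fun i => hf.indicator (ht i)]
  simp only [lintegral_indicator (ht _), withDensity_apply _ (ht _)]

lemma gibbsMeasure_pi [SigmaFinite ν] (hv : Measurable v) (h_zero : ∫⁻ x, expNeg (v x) ∂ν ≠ 0)
    (h_top : ∫⁻ x, expNeg (v x) ∂ν ≠ ⊤) (N : ℕ) :
    (gibbsMeasure (Measure.pi fun _ : Fin N => ν) fun x => ∑ i, v (x i)) =
      Measure.pi fun _ : Fin N => gibbsMeasure ν v := by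
  have h_density : gibbsMeasure ν v =
      ν.withDensity fun x => (∫⁻ x, expNeg (v x) ∂ν)⁻¹ * expNeg (v x) := by
    rw [gibbsMeasure, ← withDensity_smul _ (by fun_prop)]
    rfl
  have : IsProbabilityMeasure (ν.withDensity fun x => (∫⁻ x, expNeg (v x) ∂ν)⁻¹ * expNeg (v x)) :=
    h_density ▸ isProbabilityMeasure_gibbsMeasure h_zero h_top
  simp only [h_density]
  rw [pi_withDensity (by fun_prop)]
  simp only [gibbsMeasure, expNeg_sum, Finset.prod_mul_distrib, Finset.prod_const]
  rw [lintegral_pi_prod (f := fun _ x => expNeg (v x)) fun _ => by fun_prop,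
    Finset.prod_const, ENNReal.inv_pow, ← withDensity_smul _ (by fun_prop)]
  rfl

end GibbsOperations

section Comparison

open InformationTheory

variable {X : Type*} [MeasurableSpace X] {π : Measure X} [IsProbabilityMeasure π] {v w : X → ℝ≥0∞}

lemma lintegral_expNeg_eq_expNeg_neg_log (hw : Measurable w) (hw_fin : ∀ᵐ x ∂π, w x ≠ ⊤) :
    ∫⁻ x, expNeg (w x) ∂π =
      expNeg (ENNReal.ofReal (-Real.log (∫⁻ x, expNeg (w x) ∂π).toReal)) := by
  have z_pos := toReal_lintegral_expNeg_pos hw hw_fin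
  have z_le_one : (∫⁻ x, expNeg (w x) ∂π).toReal ≤ 1 :=
    ENNReal.toReal_le_of_le_ofReal zero_le_one (by simpa using lintegral_expNeg_le_one w)
  rw [expNeg_ofReal (neg_nonneg.2 (Real.log_nonpos z_pos.le z_le_one)), neg_neg,
    Real.exp_log z_pos,
    ENNReal.ofReal_toReal ((lintegral_expNeg_le_one w).trans_lt ENNReal.one_lt_top).ne]

lemma gibbs_bogoliubov_inequality (hv : Measurable v) (hv_fin : ∀ᵐ x ∂π, v x ≠ ⊤)
    (hw : Measurable w) (hw_fin : ∀ᵐ x ∂π, w x ≠ ⊤) :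
    ENNReal.ofReal (-Real.log (∫⁻ x, expNeg (w x) ∂π).toReal) + ∫⁻ x, v x ∂gibbsMeasure π v ≤
      ∫⁻ x, w x ∂gibbsMeasure π v + ENNReal.ofReal (-Real.log (∫⁻ x, expNeg (v x) ∂π).toReal) := by
  have hq := isDensity_gibbsDensity hv hv_fin
  have : IsProbabilityMeasure (gibbsMeasure π v) :=
    densityMeasure_gibbsDensity hv hv_fin.frequently ▸ hq.isProbabilityMeasure
  have free_energy_v := densityEntropy_add_lintegral_eq hv hv_fin hq
  have free_energy_w := densityEntropy_add_lintegral_eq hw hw_fin hq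
  rw [densityMeasure_gibbsDensity hv hv_fin.frequently] at free_energy_v free_energy_w
  rw [klDiv_self, zero_add] at free_energy_v
  rw [← free_energy_v, add_left_comm, ← add_assoc, free_energy_w]
  gcongr
  exact le_add_self

/-- By the Gibbs–Bogoliubov inequality it suffices to compare the energies after subtracting their
means under the Gibbs measure on the right. -/
lemma gibbsMeasure_le_smul_gibbsMeasure (hv : Measurable v) (hw : Measurable w)
    (hv_mean : ∫⁻ x, v x ∂gibbsMeasure π v ≠ ⊤) (hw_mean : ∫⁻ x, w x ∂gibbsMeasure π v ≠ ⊤)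
    (hv_fin : ∀ᵐ x ∂π, v x ≠ ⊤) (hw_fin : ∀ᵐ x ∂π, w x ≠ ⊤) {c : ℝ≥0}
    (h : ∀ x, v x + ∫⁻ x, w x ∂gibbsMeasure π v ≤ w x + ∫⁻ x, v x ∂gibbsMeasure π v + c) :
    gibbsMeasure π w ≤ ENNReal.ofReal (Real.exp c) • gibbsMeasure π v := by
  have bogoliubov := gibbs_bogoliubov_inequality hv hv_fin hw hw_fin
  set a := ENNReal.ofReal (-Real.log (∫⁻ x, expNeg (w x) ∂π).toReal)
  set d := ENNReal.ofReal (-Real.log (∫⁻ x, expNeg (v x) ∂π).toReal)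
  set Iv := ∫⁻ x, v x ∂gibbsMeasure π v
  set Iw := ∫⁻ x, w x ∂gibbsMeasure π v
  have energy_le (x : X) : v x + a ≤ w x + (c + d) := by
    rw [← ENNReal.add_le_add_iff_right (ENNReal.add_ne_top.2 ⟨hw_mean, hv_mean⟩)]
    calc v x + a + (Iw + Iv) = (v x + Iw) + (a + Iv) := by ring
      _ ≤ (w x + Iv + c) + (Iw + d) := add_le_add (h x) bogoliubov
      _ = w x + (c + d) + (Iw + Iv) := by ring
  have exp_c : ENNReal.ofReal (Real.exp c) = (expNeg c)⁻¹ := by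
    rw [expNeg_coe, Real.exp_neg, ENNReal.ofReal_inv_of_pos (Real.exp_pos _), inv_inv]
  rw [gibbsMeasure, gibbsMeasure, ← withDensity_smul _ (by fun_prop),
    ← withDensity_smul _ (by fun_prop), ← withDensity_smul _ (by fun_prop),
    lintegral_expNeg_eq_expNeg_neg_log hw hw_fin, lintegral_expNeg_eq_expNeg_neg_log hv hv_fin,
    exp_c]
  refine withDensity_mono (ae_of_all _ fun x => ?_)
  simp only [Pi.smul_apply, smul_eq_mul]
  have exp_le := expNeg_antitone (energy_le x)
  simp only [expNeg_add] at exp_le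
  rw [← mul_assoc, ← ENNReal.mul_inv (.inl (expNeg_pos ENNReal.coe_ne_top).ne')
    (.inl (expNeg_ne_top _)), mul_comm, mul_comm _ (expNeg (v x)), ← div_eq_mul_inv,
    ← div_eq_mul_inv]
  rw [ENNReal.div_le_iff (expNeg_pos ENNReal.ofReal_ne_top).ne' (expNeg_ne_top _),
    ← ENNReal.mul_div_right_comm, ENNReal.le_div_iff_mul_le
    (.inl (mul_ne_zero (expNeg_pos ENNReal.coe_ne_top).ne' (expNeg_pos ENNReal.ofReal_ne_top).ne'))
    (.inl (ENNReal.mul_ne_top (expNeg_ne_top _) (expNeg_ne_top _)))]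
  exact exp_le

end Comparison

section PairEnergy

variable {X : Type*}

/-- The total interaction of a configuration, each pair of particles being counted once. -/
noncomputable def pairEnergy (k : X → X → ℝ≥0∞) {N : ℕ} (x : Fin N → X) : ℝ≥0∞ :=
  ∑ i, ∑ j ∈ Finset.Ioi i, k (x i) (x j)

lemma two_mul_sum_sum_Ioi {N : ℕ} {a : Fin N → Fin N → ℝ≥0∞} (ha : ∀ i j, a i j = a j i) :
    2 * ∑ i, ∑ j ∈ Finset.Ioi i, a i j = ∑ i, ∑ j ∈ {i}ᶜ, a i j := by
  have split (i : Fin N) :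
      ∑ j ∈ {i}ᶜ, a i j = ∑ j ∈ Finset.Ioi i, a i j + ∑ j ∈ Finset.Iio i, a i j := by
    rw [← Finset.sum_union (Finset.disjoint_left.2 fun j => by simpa using fun h => h.le)]
    congr 1
    ext j
    simp only [Finset.mem_compl, Finset.mem_singleton, Finset.mem_union, Finset.mem_Ioi,
      Finset.mem_Iio]
    exact ne_iff_gt_or_lt
  have swap : ∑ i, ∑ j ∈ Finset.Iio i, a i j = ∑ i, ∑ j ∈ Finset.Ioi i, a i j := by
    rw [Finset.sum_comm' (t' := Finset.univ) (s' := fun j => Finset.Ioi j) (by simp)]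
    simp only [ha]
  simp only [split, Finset.sum_add_distrib, swap, two_mul]

lemma two_mul_pairEnergy {k : X → X → ℝ≥0∞} (hk_symm : ∀ x y, k x y = k y x) {N : ℕ}
    (x : Fin N → X) : 2 * pairEnergy k x = ∑ i, ∑ j ∈ {i}ᶜ, k (x i) (x j) :=
  two_mul_sum_sum_Ioi fun _ _ => hk_symm _ _

lemma pairEnergy_insertNth {k : X → X → ℝ≥0∞} (hk_symm : ∀ x y, k x y = k y x) {N : ℕ}
    (i : Fin (N + 1)) (a : X) (y : Fin N → X) :
    pairEnergy k (i.insertNth a y : Fin (N + 1) → X) = pairEnergy k y + ∑ j, k a (y j) := by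
  have compl_succAbove (j : Fin N) :
      ({i.succAbove j}ᶜ : Finset (Fin (N + 1))) =
        insert i (({j}ᶜ : Finset (Fin N)).map i.succAboveEmb) := by
    ext l
    rcases Fin.eq_self_or_eq_succAbove i l with rfl | ⟨l, rfl⟩ <;> simp [eq_comm]
  have compl_self : ({i}ᶜ : Finset (Fin (N + 1))) = Finset.univ.map i.succAboveEmb := by
    ext l
    rcases Fin.eq_self_or_eq_succAbove i l with rfl | ⟨l, rfl⟩ <;> simp
  refine (ENNReal.mul_right_inj two_ne_zero ENNReal.ofNat_ne_top).1 ?_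
  rw [mul_add, two_mul_pairEnergy hk_symm, two_mul_pairEnergy hk_symm,
    Fin.sum_univ_succAbove _ i, compl_self]
  simp only [compl_succAbove]
  simp [Finset.sum_add_distrib, Fin.succAbove_ne, hk_symm _ a]
  ring

variable [MeasurableSpace X] {k : X → X → ℝ≥0∞}

lemma measurable_pairEnergy (hk : Measurable (Function.uncurry k)) (N : ℕ) :
    Measurable fun x : Fin N → X => pairEnergy k x := by
  unfold pairEnergy
  fun_prop

lemma lintegral_pi_pair (hk : Measurable (Function.uncurry k)) (μ : Measure X)
    [IsProbabilityMeasure μ] {N : ℕ} {i j : Fin N} (hij : i ≠ j) :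
    ∫⁻ x, k (x i) (x j) ∂(Measure.pi fun _ : Fin N => μ) = kernelEnergy k μ μ := by
  have indep := (ProbabilityTheory.iIndepFun_pi (μ := fun _ : Fin N => μ) (X := fun _ => id)
    fun _ => aemeasurable_id).indepFun hij
  have law := (ProbabilityTheory.indepFun_iff_map_prod_eq_prod_map_map
    (measurable_pi_apply i).aemeasurable (measurable_pi_apply j).aemeasurable).1 indep
  simp only [(measurePreserving_eval (fun _ : Fin N => μ) _).map_eq] at law
  have change_variables := lintegral_map (μ := Measure.pi fun _ : Fin N => μ) hk
    ((measurable_pi_apply i).prodMk (measurable_pi_apply j))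
  rw [law, lintegral_prod _ hk.aemeasurable] at change_variables
  exact change_variables.symm

lemma two_mul_lintegral_pairEnergy_le (hk : Measurable (Function.uncurry k))
    (hk_symm : ∀ x y, k x y = k y x) (μ : Measure X) [IsProbabilityMeasure μ] (N : ℕ) :
    2 * ∫⁻ x, pairEnergy k x ∂(Measure.pi fun _ : Fin N => μ) ≤ N * (N * kernelEnergy k μ μ) := by
  rw [← lintegral_const_mul _ (measurable_pairEnergy hk N)]
  simp only [two_mul_pairEnergy hk_symm]
  rw [lintegral_finsetSum _ fun _ _ => by fun_prop]
  calc ∑ i, ∫⁻ x, ∑ j ∈ {i}ᶜ, k (x i) (x j) ∂(Measure.pi fun _ : Fin N => μ)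
      = ∑ i : Fin N, ∑ _j ∈ {i}ᶜ, kernelEnergy k μ μ := by
        refine Finset.sum_congr rfl fun _ _ => ?_
        rw [lintegral_finsetSum _ fun _ _ => by fun_prop]
        exact Finset.sum_congr rfl fun _ hj => lintegral_pi_pair hk μ (by simpa [eq_comm] using hj)
    _ ≤ ∑ _i : Fin N, ∑ _j : Fin N, kernelEnergy k μ μ :=
        Finset.sum_le_sum fun i _ => Finset.sum_le_sum_of_subset (Finset.subset_univ _)
    _ = N * (N * kernelEnergy k μ μ) := by simp

end PairEnergy

section KernelGibbs

variable {X : Type*} [MeasurableSpace X] {k : X → X → ℝ≥0∞} {π : Measure X}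
  [IsProbabilityMeasure π] {b B : ℝ≥0}

/-- The Gibbs measure of `N` particles with pair interaction `b k` and one-particle reference
measure `π`. -/
noncomputable def kernelGibbs (k : X → X → ℝ≥0∞) (π : Measure X) (b : ℝ≥0) (N : ℕ) :
    Measure (Fin N → X) :=
  gibbsMeasure (Measure.pi fun _ => π) fun x => b * pairEnergy k x

lemma kernelEnergy_self_le (hB : ∀ x, ∫⁻ y, k x y ∂π ≤ B) : kernelEnergy k π π ≤ B :=
  (lintegral_mono hB).trans_eq (by simp)

lemma ae_pairEnergy_ne_top (hk : Measurable (Function.uncurry k))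
    (hk_symm : ∀ x y, k x y = k y x) (hE : kernelEnergy k π π ≠ ⊤) (b : ℝ≥0) (N : ℕ) :
    ∀ᵐ x ∂(Measure.pi fun _ : Fin N => π), b * pairEnergy k x ≠ ⊤ := by
  have mean_ne_top : ∫⁻ x, pairEnergy k x ∂(Measure.pi fun _ : Fin N => π) ≠ ⊤ :=
    ne_top_of_le_ne_top (by finiteness)
      ((le_mul_of_one_le_left' one_le_two).trans (two_mul_lintegral_pairEnergy_le hk hk_symm π N))
  filter_upwards [ae_lt_top (measurable_pairEnergy hk N) mean_ne_top] with x hx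
  exact ENNReal.mul_ne_top ENNReal.coe_ne_top hx.ne

lemma isProbabilityMeasure_kernelGibbs (hk : Measurable (Function.uncurry k))
    (hk_symm : ∀ x y, k x y = k y x) (hE : kernelEnergy k π π ≠ ⊤) (b : ℝ≥0) (N : ℕ) :
    IsProbabilityMeasure (kernelGibbs k π b N) :=
  isProbabilityMeasure_gibbsMeasure
    (lintegral_expNeg_ne_zero ((measurable_pairEnergy hk N).const_mul _)
      (ae_pairEnergy_ne_top hk hk_symm hE b N).frequently)
    ((lintegral_expNeg_le_one _).trans_lt ENNReal.one_lt_top).ne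

lemma measurable_insertNth {N : ℕ} (i : Fin (N + 1)) :
    Measurable fun q : X × (Fin N → X) => (i.insertNth q.1 q.2 : Fin (N + 1) → X) :=
  (MeasurableEquiv.piFinSuccAbove (fun _ => X) i).symm.measurable

lemma kernelGibbs_succ (hk : Measurable (Function.uncurry k)) (hk_symm : ∀ x y, k x y = k y x)
    (hE : kernelEnergy k π π ≠ ⊤) (b : ℝ≥0) {N : ℕ} (i : Fin (N + 1)) :
    kernelGibbs k π b (N + 1) =
      (gibbsMeasure (π.prod (kernelGibbs k π b N)) fun q => b * ∑ j, k q.1 (q.2 j)).map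
        fun q => i.insertNth q.1 q.2 := by
  have h_insert : MeasurePreserving
      (fun q : X × (Fin N → X) => (i.insertNth q.1 q.2 : Fin (N + 1) → X))
      (π.prod (Measure.pi fun _ => π)) (Measure.pi fun _ => π) :=
    (measurePreserving_piFinSuccAbove (fun _ => π) i).symm
  have h_pairs := (measurable_pairEnergy hk N).const_mul (b : ℝ≥0∞)
  have h_pairs_fin := ae_pairEnergy_ne_top hk hk_symm hE b N
  have h_exp : Measurable fun x : Fin N → X => expNeg (b * pairEnergy k x) := by fun_prop
  have partition_eq : ∫⁻ q : X × (Fin N → X), expNeg (b * pairEnergy k q.2)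
      ∂π.prod (Measure.pi fun _ => π) = ∫⁻ x, expNeg (b * pairEnergy k x) ∂Measure.pi fun _ => π :=
    measurePreserving_snd.lintegral_comp h_exp
  rw [kernelGibbs, ← map_gibbsMeasure_comp h_insert
    ((measurable_pairEnergy hk (N + 1)).const_mul _)]
  simp only [pairEnergy_insertNth hk_symm, mul_add]
  rw [gibbsMeasure_add (v := fun q : X × (Fin N → X) => b * pairEnergy k q.2)
      (h_pairs.comp measurable_snd) (by fun_prop)
      (partition_eq ▸ lintegral_expNeg_ne_zero h_pairs h_pairs_fin.frequently)
      (partition_eq ▸ ((lintegral_expNeg_le_one _).trans_lt ENNReal.one_lt_top).ne),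
    gibbsMeasure_prod_snd _ h_pairs, kernelGibbs]

/-- Jensen's inequality for the position of the inserted particle. -/
lemma expNeg_le_lintegral_expNeg_field (hk : Measurable (Function.uncurry k))
    (hk_symm : ∀ x y, k x y = k y x) (hB : ∀ x, ∫⁻ y, k x y ∂π ≤ B) (b : ℝ≥0) {N : ℕ}
    (P : Measure (Fin N → X)) [IsProbabilityMeasure P] :
    expNeg (b * N * B) ≤ ∫⁻ q, expNeg (b * ∑ j, k q.1 (q.2 j)) ∂π.prod P := by
  rw [lintegral_prod_symm _ (by fun_prop)]
  have inner (y : Fin N → X) : expNeg (b * N * B) ≤ ∫⁻ a, expNeg (b * ∑ j, k a (y j)) ∂π := by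
    refine (expNeg_antitone ?_).trans (expNeg_lintegral_le π (by fun_prop))
    rw [lintegral_const_mul _ (by fun_prop), lintegral_finsetSum _ fun j _ => by fun_prop,
      mul_assoc]
    gcongr
    calc ∑ j, ∫⁻ a, k a (y j) ∂π ≤ ∑ _j : Fin N, (B : ℝ≥0∞) :=
          Finset.sum_le_sum fun j _ => by simpa only [hk_symm] using hB (y j)
      _ = N * B := by simp
  calc expNeg (b * N * B) = ∫⁻ _, expNeg (b * N * B) ∂P := by simp
    _ ≤ _ := lintegral_mono inner

lemma lintegral_kernelGibbs_succ_eval_le (hk : Measurable (Function.uncurry k))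
    (hk_symm : ∀ x y, k x y = k y x) (hB : ∀ x, ∫⁻ y, k x y ∂π ≤ B) (b : ℝ≥0) {N : ℕ}
    (i : Fin (N + 1)) {f : X → ℝ≥0∞} (hf : Measurable f) :
    ∫⁻ x, f (x i) ∂kernelGibbs k π b (N + 1) ≤ (expNeg (b * N * B))⁻¹ * ∫⁻ x, f x ∂π := by
  have hE : kernelEnergy k π π ≠ ⊤ :=
    ne_top_of_le_ne_top ENNReal.coe_ne_top (kernelEnergy_self_le hB)
  have := isProbabilityMeasure_kernelGibbs hk hk_symm hE b N
  rw [kernelGibbs_succ hk hk_symm hE b i, lintegral_map (by fun_prop) (measurable_insertNth i)]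
  simp only [Fin.insertNth_apply_same]
  calc ∫⁻ q, f q.1 ∂gibbsMeasure (π.prod (kernelGibbs k π b N)) (fun q => b * ∑ j, k q.1 (q.2 j))
      ≤ ∫⁻ q, f q.1 ∂((expNeg (b * N * B))⁻¹ • π.prod (kernelGibbs k π b N)) := by
        refine lintegral_mono' ((gibbsMeasure_le_smul (by fun_prop)).trans ?_) le_rfl
        gcongr
        exact expNeg_le_lintegral_expNeg_field hk hk_symm hB b _
    _ = (expNeg (b * N * B))⁻¹ * ∫⁻ x, f x ∂π := by
        rw [lintegral_smul_measure, measurePreserving_fst.lintegral_comp hf, smul_eq_mul]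

lemma lintegral_kernelGibbs_sum_le (hk : Measurable (Function.uncurry k))
    (hk_symm : ∀ x y, k x y = k y x) (hB : ∀ x, ∫⁻ y, k x y ∂π ≤ B) (b : ℝ≥0) (N : ℕ)
    {f : X → ℝ≥0∞} (hf : Measurable f) :
    ∫⁻ x, ∑ i, f (x i) ∂kernelGibbs k π b N ≤
      N * ((expNeg (b * N * B))⁻¹ * ∫⁻ x, f x ∂π) := by
  rw [lintegral_finsetSum _ fun i _ => by fun_prop]
  have summand (i : Fin N) : ∫⁻ x, f (x i) ∂kernelGibbs k π b N ≤
      (expNeg (b * N * B))⁻¹ * ∫⁻ x, f x ∂π := by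
    obtain ⟨M, rfl⟩ := Nat.exists_eq_succ_of_ne_zero (Fin.pos i).ne'
    refine (lintegral_kernelGibbs_succ_eval_le hk hk_symm hB b i hf).trans ?_
    gcongr
    refine expNeg_antitone ?_
    gcongr
    exact M.le_succ
  exact (Finset.sum_le_sum fun i _ => summand i).trans_eq (by simp)

end KernelGibbs

section MeanField

variable {X : Type*} [MeasurableSpace X] {k j r : X → X → ℝ≥0∞} {π μ : Measure X} {J τ : ℝ≥0}

/-- A splitting `k = j + r` of a kernel into a bounded positive definite part `j` and a remainder
`r` whose potential is at most `τ`. -/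
structure IsTruncation (k : X → X → ℝ≥0∞) (π : Measure X) (j r : X → X → ℝ≥0∞) (J τ : ℝ≥0) :
    Prop where
  isPosDefKernel : IsPosDefKernel j
  measurable_remainder : Measurable (Function.uncurry r)
  add_eq : ∀ x y, j x y + r x y = k x y
  le_bound : ∀ x y, j x y ≤ J
  lintegral_remainder_le : ∀ x, ∫⁻ y, r x y ∂π ≤ τ

/-- `μ` solves the mean-field equation `μ ∝ exp (-γ ∫ k(·, y) μ(dy)) π`; the constants `C` and `B`
bound its density and the potentials. -/
structure IsMeanFieldState (k : X → X → ℝ≥0∞) (π : Measure X) (γ : ℝ≥0) (μ : Measure X)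
    (C B : ℝ≥0) : Prop where
  measurable_kernel : Measurable (Function.uncurry k)
  symm : ∀ x y, k x y = k y x
  isProbabilityMeasure : IsProbabilityMeasure μ
  eq_gibbsMeasure : μ = gibbsMeasure π fun x => γ * ∫⁻ y, k x y ∂μ
  le_smul : μ ≤ C • π
  lintegral_le : ∀ x, ∫⁻ y, k x y ∂μ ≤ B
  lintegral_reference_le : ∀ x, ∫⁻ y, k x y ∂π ≤ B

lemma tendsto_zero_of_tendsto_natCast_mul {b : ℕ → ℝ≥0} {γ : ℝ≥0}
    (hb : Tendsto (fun N : ℕ => N * b N) atTop (𝓝 γ)) : Tendsto b atTop (𝓝 0) := by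
  have := hb.mul (tendsto_inv_atTop_zero.comp (tendsto_natCast_atTop_atTop (R := ℝ≥0)))
  rw [mul_zero] at this
  refine this.congr' ?_
  filter_upwards [eventually_ne_atTop 0] with N hN
  simp only [Function.comp_apply]
  field_simp

/-- Positive definiteness of the interaction of `∑ δ_{x_i}` with `N μ`. -/
lemma two_mul_sum_potential_le (hj : IsPosDefKernel j) (hJ : ∀ x y, j x y ≤ J) (μ : Measure X)
    [SFinite μ] {N : ℕ} (x : Fin N → X) :
    2 * (N * ∑ i, ∫⁻ y, j (x i) y ∂μ) ≤
      2 * pairEnergy j x + N * J + N * (N * kernelEnergy j μ μ) := by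
  have hj_meas := hj.measurable_uncurry
  have cross : kernelEnergy j (∑ i, Measure.dirac (x i)) ((N : ℝ≥0∞) • μ) =
      N * ∑ i, ∫⁻ y, j (x i) y ∂μ := by
    simp only [kernelEnergy, lintegral_smul_measure, smul_eq_mul, lintegral_finsetSum_measure]
    rw [Finset.mul_sum]
    exact Finset.sum_congr rfl fun i _ => lintegral_dirac' _ (by fun_prop)
  have background : kernelEnergy j ((N : ℝ≥0∞) • μ) ((N : ℝ≥0∞) • μ) =
      N * (N * kernelEnergy j μ μ) := by
    simp only [kernelEnergy, lintegral_smul_measure, smul_eq_mul]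
    rw [lintegral_const_mul _ (by fun_prop)]
  have particles : kernelEnergy j (∑ i, Measure.dirac (x i)) (∑ i, Measure.dirac (x i)) ≤
      2 * pairEnergy j x + N * J := by
    have discrete : kernelEnergy j (∑ i, Measure.dirac (x i)) (∑ i, Measure.dirac (x i)) =
        ∑ i, ∑ l, j (x i) (x l) := by
      simp only [kernelEnergy, lintegral_finsetSum_measure]
      refine Finset.sum_congr rfl fun i _ => ?_
      rw [lintegral_dirac' _ (by fun_prop)]
      exact Finset.sum_congr rfl fun l _ => lintegral_dirac' _ (hj.measurable_right _)
    rw [discrete, two_mul_pairEnergy hj.symm]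
    calc ∑ i, ∑ l, j (x i) (x l)
        = ∑ i, (∑ l ∈ {i}ᶜ, j (x i) (x l) + j (x i) (x i)) :=
          Finset.sum_congr rfl fun i _ => by
            rw [add_comm, ← Fintype.sum_eq_add_sum_compl i fun l => j (x i) (x l)]
      _ ≤ ∑ i, (∑ l ∈ {i}ᶜ, j (x i) (x l) + J) := by gcongr; exact hJ _ _
      _ = _ := by simp [Finset.sum_add_distrib]
  rw [← cross, ← background]
  exact (hj.two_mul_energy_le _ _).trans (add_le_add_left particles _)

namespace IsTruncation

lemma le_kernel (h : IsTruncation k π j r J τ) (x y : X) : j x y ≤ k x y :=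
  h.add_eq x y ▸ le_self_add

lemma lintegral_le_add (h : IsTruncation k π j r J τ) {C : ℝ≥0} (hμ : μ ≤ C • π) (x : X) :
    ∫⁻ y, k x y ∂μ ≤ ∫⁻ y, j x y ∂μ + C * τ := by
  simp only [← h.add_eq]
  rw [lintegral_add_left (h.isPosDefKernel.measurable_right x)]
  gcongr
  calc ∫⁻ y, r x y ∂μ ≤ ∫⁻ y, r x y ∂(C • π) := lintegral_mono' hμ le_rfl
    _ = C * ∫⁻ y, r x y ∂π := lintegral_smul_measure _ _
    _ ≤ C * τ := by gcongr; exact h.lintegral_remainder_le x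

end IsTruncation

namespace IsMeanFieldState

variable {γ C B b : ℝ≥0}

lemma measurable_potential (h : IsMeanFieldState k π γ μ C B) :
    Measurable fun x => ∫⁻ y, k x y ∂μ :=
  have := h.isProbabilityMeasure
  h.measurable_kernel.lintegral_prod_right'

lemma potential_ne_top (h : IsMeanFieldState k π γ μ C B) (x : X) : ∫⁻ y, k x y ∂μ ≠ ⊤ :=
  ne_top_of_le_ne_top ENNReal.coe_ne_top (h.lintegral_le x)

lemma kernelEnergy_le (h : IsMeanFieldState k π γ μ C B) : kernelEnergy k μ μ ≤ B :=
  have := h.isProbabilityMeasure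
  kernelEnergy_self_le h.lintegral_le

lemma kernelEnergy_reference_ne_top [IsProbabilityMeasure π] (h : IsMeanFieldState k π γ μ C B) :
    kernelEnergy k π π ≠ ⊤ :=
  ne_top_of_le_ne_top ENNReal.coe_ne_top (kernelEnergy_self_le h.lintegral_reference_le)

lemma pi_eq_gibbsMeasure [IsProbabilityMeasure π] (h : IsMeanFieldState k π γ μ C B) (N : ℕ) :
    (Measure.pi fun _ : Fin N => μ) =
      gibbsMeasure (Measure.pi fun _ => π) fun x => ∑ i, γ * ∫⁻ y, k (x i) y ∂μ := by
  have h_meas := h.measurable_potential.const_mul (γ : ℝ≥0∞)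
  rw [gibbsMeasure_pi h_meas (lintegral_expNeg_ne_zero h_meas (.of_forall fun x =>
      ENNReal.mul_ne_top ENNReal.coe_ne_top (h.potential_ne_top x)))
    ((lintegral_expNeg_le_one _).trans_lt ENNReal.one_lt_top).ne]
  exact congrArg (fun ν : Measure X => Measure.pi fun _ => ν) h.eq_gibbsMeasure

lemma sum_potential_add_le (h : IsMeanFieldState k π γ μ C B) (hT : IsTruncation k π j r J τ)
    {N : ℕ} {δ : ℝ≥0} (h_le : γ ≤ N * b + δ) (h_ge : N * b ≤ γ + δ) (x : Fin N → X) :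
    ∑ i, γ * ∫⁻ y, k (x i) y ∂μ + b * ∫⁻ x, pairEnergy k x ∂Measure.pi (fun _ : Fin N => μ) ≤
      b * pairEnergy k x + N * (γ * kernelEnergy k μ μ) +
        (N * (b * J + N * b * C * τ + 2 * δ * B) : ℝ≥0) := by
  have := h.isProbabilityMeasure
  set E := kernelEnergy k μ μ
  have hE : E ≤ B := h.kernelEnergy_le
  have pd := two_mul_sum_potential_le hT.isPosDefKernel hT.le_bound μ x
  have pairs_le : pairEnergy j x ≤ pairEnergy k x :=
    Finset.sum_le_sum fun i _ => Finset.sum_le_sum fun l _ => hT.le_kernel _ _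
  have energy_le : kernelEnergy j μ μ ≤ E :=
    lintegral_mono fun x => lintegral_mono fun y => hT.le_kernel x y
  have mean_le := two_mul_lintegral_pairEnergy_le h.measurable_kernel h.symm μ N
  set Uj := ∑ i, ∫⁻ y, j (x i) y ∂μ
  have potential_le : ∑ i, ∫⁻ y, k (x i) y ∂μ ≤ Uj + N * (C * τ) :=
    (Finset.sum_le_sum fun i _ => hT.lintegral_le_add h.le_smul (x i)).trans_eq
      (by simp [Finset.sum_add_distrib, Uj])
  have potential_le_bound : ∑ i, ∫⁻ y, k (x i) y ∂μ ≤ N * B :=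
    (Finset.sum_le_sum fun i _ => h.lintegral_le (x i)).trans_eq (by simp)
  rw [← Finset.mul_sum]
  set U := ∑ i, ∫⁻ y, k (x i) y ∂μ
  set M := ∫⁻ x, pairEnergy k x ∂Measure.pi (fun _ : Fin N => μ)
  have h_le' : (γ : ℝ≥0∞) ≤ N * b + δ := by exact_mod_cast h_le
  have h_ge' : (N * b : ℝ≥0∞) ≤ γ + δ := by exact_mod_cast h_ge
  refine (ENNReal.mul_le_mul_iff_right two_ne_zero ENNReal.ofNat_ne_top).1 ?_
  calc 2 * (γ * U + b * M) ≤ 2 * ((N * b + δ) * U) + b * (2 * M) := by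
        rw [mul_add, mul_left_comm 2 (b : ℝ≥0∞)]; gcongr
    _ = 2 * (N * b * U) + 2 * (δ * U) + b * (2 * M) := by ring
    _ ≤ 2 * (N * b * (Uj + N * (C * τ))) + 2 * (δ * (N * B)) + b * (N * (N * E)) := by gcongr
    _ = b * (2 * (N * Uj)) + N * b * (N * E) + N * (2 * (N * b * C * τ) + 2 * δ * B) := by ring
    _ ≤ b * (2 * pairEnergy k x + N * J + N * (N * E)) + N * b * (N * E) +
          N * (2 * (N * b * C * τ) + 2 * δ * B) := by
        gcongr
        exact pd.trans (by gcongr)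
    _ = 2 * (b * pairEnergy k x) + 2 * (N * b * (N * E)) +
          N * (b * J + 2 * (N * b * C * τ) + 2 * δ * B) := by ring
    _ ≤ 2 * (b * pairEnergy k x) + (2 * (N * (γ * E)) + 2 * (δ * (N * B))) +
          N * (2 * (b * J) + 2 * (N * b * C * τ) + 2 * δ * B) := by
        gcongr 2 * (b * pairEnergy k x) + ?_ + N * (?_ + _ + _)
        · calc 2 * (N * b * (N * E)) ≤ 2 * ((γ + δ) * (N * E)) := by gcongr
            _ = 2 * (N * (γ * E)) + 2 * (δ * (N * E)) := by ring
            _ ≤ _ := by gcongr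
        · exact le_mul_of_one_le_left' one_le_two
    _ = _ := by push_cast; ring

lemma kernelGibbs_le_smul_pi [IsProbabilityMeasure π] (h : IsMeanFieldState k π γ μ C B)
    (hT : IsTruncation k π j r J τ) {N : ℕ} {δ : ℝ≥0} (h_le : γ ≤ N * b + δ)
    (h_ge : N * b ≤ γ + δ) :
    kernelGibbs k π b N ≤
      ENNReal.ofReal (Real.exp (N * (b * J + N * b * C * τ + 2 * δ * B) : ℝ≥0)) •
        Measure.pi fun _ : Fin N => μ := by
  have := h.isProbabilityMeasure
  have h_meas := h.measurable_potential.const_mul (γ : ℝ≥0∞)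
  have h_meas_eval (i : Fin N) : Measurable fun x : Fin N → X => γ * ∫⁻ y, k (x i) y ∂μ :=
    h_meas.comp (measurable_pi_apply i)
  have mean_potential : ∫⁻ x, ∑ i, γ * ∫⁻ y, k (x i) y ∂μ ∂Measure.pi (fun _ : Fin N => μ) =
      N * (γ * kernelEnergy k μ μ) := by
    rw [lintegral_finsetSum _ fun i _ => h_meas_eval i]
    have marginal (i : Fin N) : ∫⁻ x, γ * ∫⁻ y, k (x i) y ∂μ ∂Measure.pi (fun _ : Fin N => μ) =
        γ * kernelEnergy k μ μ := by
      rw [(measurePreserving_eval (fun _ : Fin N => μ) i).lintegral_comp h_meas,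
        lintegral_const_mul _ h.measurable_potential, kernelEnergy]
    simp [marginal]
  have mean_pairs : ∫⁻ x, b * pairEnergy k x ∂Measure.pi (fun _ : Fin N => μ) =
      b * ∫⁻ x, pairEnergy k x ∂Measure.pi (fun _ : Fin N => μ) :=
    lintegral_const_mul _ (measurable_pairEnergy h.measurable_kernel N)
  have energy_ne_top := ne_top_of_le_ne_top ENNReal.coe_ne_top h.kernelEnergy_le
  have mean_pairs_ne_top : ∫⁻ x, pairEnergy k x ∂Measure.pi (fun _ : Fin N => μ) ≠ ⊤ :=
    ne_top_of_le_ne_top (by finiteness) ((le_mul_of_one_le_left' one_le_two).trans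
      (two_mul_lintegral_pairEnergy_le h.measurable_kernel h.symm μ N))
  have potential_fin (x : Fin N → X) : ∑ i, γ * ∫⁻ y, k (x i) y ∂μ ≠ ⊤ :=
    ENNReal.sum_ne_top.2 fun i _ => ENNReal.mul_ne_top ENNReal.coe_ne_top (h.potential_ne_top _)
  rw [h.pi_eq_gibbsMeasure N] at mean_potential mean_pairs mean_pairs_ne_top ⊢
  refine gibbsMeasure_le_smul_gibbsMeasure (Finset.measurable_sum _ fun i _ => h_meas_eval i)
    ((measurable_pairEnergy h.measurable_kernel N).const_mul _) (by rw [mean_potential]; finiteness)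
    (by rw [mean_pairs]; finiteness) (ae_of_all _ potential_fin)
    (ae_pairEnergy_ne_top h.measurable_kernel h.symm h.kernelEnergy_reference_ne_top b N)
    fun x => ?_
  rw [mean_potential, mean_pairs, ← h.pi_eq_gibbsMeasure N]
  exact h.sum_potential_add_le hT h_le h_ge x

lemma eventually_kernelGibbs_le_smul_pi [IsProbabilityMeasure π] (h : IsMeanFieldState k π γ μ C B)
    (hk : ∀ τ : ℝ≥0, τ ≠ 0 → ∃ j r J, IsTruncation k π j r J τ) {b : ℕ → ℝ≥0}
    (hb : Tendsto (fun N : ℕ => N * b N) atTop (𝓝 γ)) {κ : ℝ} (hκ : 0 < κ) :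
    ∀ᶠ N : ℕ in atTop, kernelGibbs k π (b N) N ≤
      ENNReal.ofReal (Real.exp (N * κ)) • Measure.pi fun _ : Fin N => μ := by
  lift κ to ℝ≥0 using hκ.le
  have κ_pos : 0 < κ := hκ
  obtain ⟨j, r, J, hT⟩ := hk (κ / (γ * C + 1)) (by positivity)
  have b_tendsto := tendsto_zero_of_tendsto_natCast_mul hb
  have dist_tendsto : Tendsto (fun N : ℕ => nndist (N * b N) γ) atTop (𝓝 0) := by
    simpa using hb.nndist (tendsto_const_nhds (x := γ))
  have rate_tendsto : Tendsto (fun N : ℕ => b N * J + N * b N * C * (κ / (γ * C + 1)) +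
      2 * nndist (N * b N) γ * B) atTop (𝓝 (0 * J + γ * C * (κ / (γ * C + 1)) + 2 * 0 * B)) :=
    ((b_tendsto.mul_const _).add ((hb.mul_const _).mul_const _)).add
      ((dist_tendsto.const_mul _).mul_const _)
  have limit_lt : 0 * J + γ * C * (κ / (γ * C + 1)) + 2 * 0 * B < κ := by
    rw [zero_mul, mul_zero, zero_mul, zero_add, add_zero, ← mul_div_assoc,
      div_lt_iff₀ (by positivity), mul_comm κ]
    gcongr
    exact lt_add_one _
  filter_upwards [rate_tendsto.eventually_lt_const limit_lt] with N hN
  refine (h.kernelGibbs_le_smul_pi hT (δ := nndist (N * b N) γ) ?_ ?_).trans ?_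
  · rw [← NNReal.coe_le_coe, NNReal.coe_add, coe_nndist, NNReal.dist_eq]
    linarith [neg_abs_le (((N * b N : ℝ≥0) : ℝ) - γ)]
  · rw [← NNReal.coe_le_coe, NNReal.coe_add, coe_nndist, NNReal.dist_eq]
    linarith [le_abs_self (((N * b N : ℝ≥0) : ℝ) - γ)]
  · have : (N * (b N * J + N * b N * C * (κ / (γ * C + 1)) + 2 * nndist (N * b N) γ * B) : ℝ≥0) ≤
        N * κ := by gcongr
    gcongr
    exact_mod_cast this

end IsMeanFieldState

end MeanField

section LawOfLargeNumbers

open ProbabilityTheory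

lemma integral_exp_mul_le_of_hasSubgaussianMGF {Ω : Type*} [MeasurableSpace Ω] {P Q : Measure Ω}
    {S : Ω → ℝ} {c : ℝ≥0} {a : ℝ} (hS : HasSubgaussianMGF S c Q)
    (hPQ : P ≤ ENNReal.ofReal (Real.exp a) • Q) (u : ℝ) :
    ∫ ω, Real.exp (u * S ω) ∂P ≤ Real.exp a * Real.exp (c * u ^ 2 / 2) := by
  calc ∫ ω, Real.exp (u * S ω) ∂P
      ≤ ∫ ω, Real.exp (u * S ω) ∂(ENNReal.ofReal (Real.exp a) • Q) :=
        integral_mono_measure hPQ (ae_of_all _ fun ω => (Real.exp_pos _).le)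
          ((hS.integrable_exp_mul u).smul_measure ENNReal.ofReal_ne_top)
    _ = Real.exp a * mgf S Q u := by
        rw [integral_smul_measure, ENNReal.toReal_ofReal (Real.exp_pos a).le, smul_eq_mul, mgf]
    _ ≤ _ := by gcongr; exact hS.mgf_le u

/-- Jensen's inequality for `exp (t |S|) ≤ exp (t S) + exp (-t S)`. -/
lemma mul_integral_abs_le_of_hasSubgaussianMGF {Ω : Type*} [MeasurableSpace Ω] {P Q : Measure Ω}
    [IsProbabilityMeasure P] {S : Ω → ℝ} {c : ℝ≥0} {a t : ℝ} (hS : HasSubgaussianMGF S c Q)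
    (hPQ : P ≤ ENNReal.ofReal (Real.exp a) • Q) :
    t * ∫ ω, |S ω| ∂P ≤ a + c * t ^ 2 / 2 + Real.log 2 := by
  have exp_integrable (u : ℝ) : Integrable (fun ω => Real.exp (u * S ω)) P :=
    ((hS.integrable_exp_mul u).smul_measure ENNReal.ofReal_ne_top).mono_measure hPQ
  have exp_abs_le (ω : Ω) :
      Real.exp (t * |S ω|) ≤ Real.exp (t * S ω) + Real.exp (-t * S ω) := by
    rcases abs_cases (S ω) with ⟨h, -⟩ | ⟨h, -⟩ <;> rw [h]
    · exact le_add_of_nonneg_right (Real.exp_pos _).le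
    · rw [mul_neg, ← neg_mul]; exact le_add_of_nonneg_left (Real.exp_pos _).le
  have S_integrable : Integrable S P :=
    (hS.integrable.smul_measure ENNReal.ofReal_ne_top).mono_measure hPQ
  have exp_abs_integrable : Integrable (fun ω => Real.exp (t * |S ω|)) P :=
    ((exp_integrable t).add (exp_integrable (-t))).mono'
      (Real.continuous_exp.comp_aestronglyMeasurable
        (S_integrable.abs.aestronglyMeasurable.const_mul t))
      (ae_of_all _ fun ω => by
        rw [Real.norm_of_nonneg (Real.exp_pos _).le]; exact exp_abs_le ω)
  have jensen : Real.exp (t * ∫ ω, |S ω| ∂P) ≤ ∫ ω, Real.exp (t * |S ω|) ∂P := by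
    rw [← integral_const_mul]
    exact convexOn_exp.map_integral_le Real.continuous_exp.continuousOn isClosed_univ
      (ae_of_all _ fun ω => Set.mem_univ _) (S_integrable.abs.const_mul t) exp_abs_integrable
  rw [← Real.exp_le_exp, Real.exp_add, Real.exp_add, Real.exp_log two_pos]
  calc Real.exp (t * ∫ ω, |S ω| ∂P)
      ≤ ∫ ω, (Real.exp (t * S ω) + Real.exp (-t * S ω)) ∂P :=
        jensen.trans (integral_mono exp_abs_integrable
          ((exp_integrable t).add (exp_integrable (-t))) exp_abs_le)
    _ ≤ Real.exp a * Real.exp (c * t ^ 2 / 2) + Real.exp a * Real.exp (c * (-t) ^ 2 / 2) := by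
        rw [integral_add (exp_integrable t) (exp_integrable (-t))]
        exact add_le_add (integral_exp_mul_le_of_hasSubgaussianMGF hS hPQ t)
          (integral_exp_mul_le_of_hasSubgaussianMGF hS hPQ (-t))
    _ = _ := by rw [neg_sq]; ring

variable {X : Type*} [MeasurableSpace X] {μ : Measure X} [IsProbabilityMeasure μ] {f : X → ℝ}
  {J : ℝ≥0}

lemma hasSubgaussianMGF_sum_sub_integral (hf : Measurable f) (hfJ : ∀ x, f x ∈ Set.Icc 0 (J : ℝ))
    (N : ℕ) :
    HasSubgaussianMGF (fun x : Fin N → X => ∑ i, (f (x i) - ∫ y, f y ∂μ)) (N * (J / 2) ^ 2)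
      (Measure.pi fun _ => μ) := by
  have centered : HasSubgaussianMGF (fun x => f x - ∫ y, f y ∂μ) ((J / 2) ^ 2) μ := by
    simpa using hasSubgaussianMGF_of_mem_Icc hf.aemeasurable (ae_of_all μ hfJ)
  have summand (i : Fin N) : HasSubgaussianMGF
      (fun x : Fin N → X => f (x i) - ∫ y, f y ∂μ) ((J / 2) ^ 2) (Measure.pi fun _ => μ) := by
    refine HasSubgaussianMGF.of_map (X := fun y => f y - ∫ y, f y ∂μ)
      (Y := fun x : Fin N → X => x i) (measurable_pi_apply i).aemeasurable ?_
    rwa [(measurePreserving_eval (fun _ => μ) i).map_eq]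
  have independent : iIndepFun (fun i (x : Fin N → X) => f (x i) - ∫ y, f y ∂μ)
      (Measure.pi fun _ => μ) :=
    iIndepFun_pi (X := fun _ x => f x - ∫ y, f y ∂μ) fun _ => (hf.sub_const _).aemeasurable
  simpa using HasSubgaussianMGF.sum_of_iIndepFun independent (s := Finset.univ)
    (c := fun _ => (J / 2) ^ 2) fun i _ => summand i

theorem eventually_integral_abs_sum_sub_le {P : ∀ N, Measure (Fin N → X)}
    [∀ N, IsProbabilityMeasure (P N)]
    (hP : ∀ κ > 0, ∀ᶠ N : ℕ in atTop,
      P N ≤ ENNReal.ofReal (Real.exp (N * κ)) • Measure.pi fun _ => μ)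
    (J : ℝ≥0) {ε : ℝ} (hε : 0 < ε) :
    ∀ᶠ N : ℕ in atTop, ∀ f : X → ℝ, Measurable f → (∀ x, f x ∈ Set.Icc 0 (J : ℝ)) →
      ∫ x, |∑ i, (f (x i) - ∫ y, f y ∂μ)| ∂P N ≤ N * ε := by
  set K : ℝ := 2 + J ^ 2 / 8
  have K_pos : 0 < K := by positivity
  set t : ℝ := ε / K
  have t_pos : 0 < t := by positivity
  have log_le : ∀ᶠ N : ℕ in atTop, Real.log 2 ≤ N * t ^ 2 :=
    (tendsto_natCast_atTop_atTop.atTop_mul_const (by positivity)).eventually_ge_atTop _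
  filter_upwards [hP (t ^ 2) (by positivity), log_le] with N hN log_le f hf hfJ
  have bound := mul_integral_abs_le_of_hasSubgaussianMGF (t := t)
    (hasSubgaussianMGF_sum_sub_integral (μ := μ) hf hfJ N) hN
  push_cast at bound
  have : t * ∫ x, |∑ i, (f (x i) - ∫ y, f y ∂μ)| ∂P N ≤ t * (N * ε) := by
    have : ε = t * K := (div_mul_cancel₀ _ K_pos.ne').symm
    rw [this]
    simp only [K]
    linarith
  exact le_of_mul_le_mul_left this t_pos

end LawOfLargeNumbers

section MeanFieldApproximation

lemma abs_exp_neg_sub_exp_neg_le {x y : ℝ} (hx : 0 ≤ x) (hy : 0 ≤ y) :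
    |Real.exp (-x) - Real.exp (-y)| ≤ |x - y| := by
  have one_sided {x y : ℝ} (hx : 0 ≤ x) (hxy : x ≤ y) :
      Real.exp (-x) - Real.exp (-y) ≤ y - x := by
    have factor : Real.exp (-y) = Real.exp (-x) * Real.exp (x - y) := by
      rw [← Real.exp_add]; ring_nf
    rw [factor]
    nlinarith [Real.add_one_le_exp (x - y), Real.exp_pos (-x),
      Real.exp_le_one_iff.2 (neg_nonpos.2 hx)]
  rcases le_total x y with hxy | hxy
  · rw [abs_sub_comm x y, abs_of_nonneg (sub_nonneg.2 (by gcongr)),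
      abs_of_nonneg (sub_nonneg.2 hxy)]
    exact one_sided hx hxy
  · rw [abs_sub_comm, abs_of_nonneg (sub_nonneg.2 (by gcongr)), abs_of_nonneg (sub_nonneg.2 hxy)]
    exact one_sided hy hxy

lemma enorm_toReal_expNeg_add_sub_le {t u : ℝ≥0∞} (ht : t ≠ ⊤) (hu : u ≠ ⊤) (r : ℝ≥0∞) :
    ‖(expNeg (t + r)).toReal - (expNeg u).toReal‖ₑ ≤ ‖t.toReal - u.toReal‖ₑ + r := by
  rcases eq_or_ne r ⊤ with rfl | hr
  · simp
  lift t to ℝ≥0 using ht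
  lift u to ℝ≥0 using hu
  lift r to ℝ≥0 using hr
  rw [← ENNReal.coe_add, expNeg_coe, expNeg_coe, ENNReal.toReal_ofReal (Real.exp_pos _).le,
    ENNReal.toReal_ofReal (Real.exp_pos _).le]
  calc ‖Real.exp (-(t + r : ℝ≥0)) - Real.exp (-u)‖ₑ
      ≤ ‖((t + r : ℝ≥0) : ℝ) - u‖ₑ := by
        simp only [Real.enorm_eq_ofReal_abs]
        exact ENNReal.ofReal_le_ofReal (abs_exp_neg_sub_exp_neg_le (t + r).2 u.2)
    _ = ‖((t : ℝ) - u) + r‖ₑ := by rw [NNReal.coe_add, add_sub_right_comm]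
    _ ≤ ‖(t : ℝ) - u‖ₑ + r := by simpa using enorm_add_le ((t : ℝ) - u) r

variable {X : Type*} [MeasurableSpace X] {k j r : X → X → ℝ≥0∞} {π μ : Measure X}
  {γ C B J τ b : ℝ≥0}

lemma abs_mul_sum_sub_le_of_abs_le {N : ℕ} {b γ δ u v B η : ℝ} (hb : 0 ≤ b) (hγ : 0 ≤ γ)
    (hu : u ∈ Set.Icc 0 B) (hδ : |N * b - γ| ≤ δ) (huv : |u - v| ≤ η) (z : Fin N → ℝ) :
    |b * ∑ i, z i - γ * v| ≤ b * |∑ i, (z i - u)| + (δ * B + γ * η) := by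
  have split : b * ∑ i, z i - γ * v =
      b * ∑ i, (z i - u) + ((N * b - γ) * u + γ * (u - v)) := by
    simp [Finset.sum_sub_distrib]; ring
  rw [split]
  refine (abs_add_le _ _).trans (add_le_add (by rw [abs_mul, abs_of_nonneg hb])
    ((abs_add_le _ _).trans (add_le_add ?_ ?_)))
  · rw [abs_mul, abs_of_nonneg hu.1]
    exact mul_le_mul hδ hu.2 hu.1 ((abs_nonneg _).trans hδ)
  · rw [abs_mul, abs_of_nonneg hγ]
    gcongr

namespace IsMeanFieldState

lemma abs_integral_truncation_sub_le (h : IsMeanFieldState k π γ μ C B)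
    (hT : IsTruncation k π j r J τ) (a : X) :
    |∫ y, (j a y).toReal ∂μ - (∫⁻ y, k a y ∂μ).toReal| ≤ C * τ := by
  have j_le : ∫⁻ y, j a y ∂μ ≤ ∫⁻ y, k a y ∂μ := lintegral_mono fun y => hT.le_kernel a y
  have k_ne_top := h.potential_ne_top a
  have j_ne_top := ne_top_of_le_ne_top k_ne_top j_le
  rw [integral_toReal (hT.isPosDefKernel.measurable_right a).aemeasurable
    (ae_of_all _ fun y => (hT.le_bound a y).trans_lt ENNReal.coe_lt_top), abs_sub_comm,
    abs_of_nonneg (sub_nonneg.2 (ENNReal.toReal_mono k_ne_top j_le)), sub_le_iff_le_add']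
  have := ENNReal.toReal_mono (by finiteness) (hT.lintegral_le_add h.le_smul a)
  rwa [ENNReal.toReal_add j_ne_top (by finiteness)] at this

lemma enorm_expNeg_field_sub_le (h : IsMeanFieldState k π γ μ C B)
    (hT : IsTruncation k π j r J τ) {N : ℕ} (a : X) (y : Fin N → X) :
    ‖(expNeg (b * ∑ i, k a (y i))).toReal - (expNeg (γ * ∫⁻ z, k a z ∂μ)).toReal‖ₑ ≤
      b * ENNReal.ofReal |∑ i, ((j a (y i)).toReal - ∫ z, (j a z).toReal ∂μ)| +
        (nndist (N * b) γ * B + γ * (C * τ) : ℝ≥0) + b * ∑ i, r a (y i) := by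
  have j_ne_top (y : X) : j a y ≠ ⊤ := ne_top_of_le_ne_top ENNReal.coe_ne_top (hT.le_bound a y)
  have split : (b : ℝ≥0∞) * ∑ i, k a (y i) = b * ∑ i, j a (y i) + b * ∑ i, r a (y i) := by
    rw [← mul_add, ← Finset.sum_add_distrib]; simp only [hT.add_eq]
  have mean_mem : ∫ z, (j a z).toReal ∂μ ∈ Set.Icc 0 (B : ℝ) := by
    refine ⟨integral_nonneg fun z => ENNReal.toReal_nonneg, ?_⟩
    rw [integral_toReal (hT.isPosDefKernel.measurable_right a).aemeasurable
      (ae_of_all _ fun y => (j_ne_top y).lt_top)]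
    exact ENNReal.toReal_le_coe_of_le_coe
      ((lintegral_mono fun y => hT.le_kernel a y).trans (h.lintegral_le a))
  have real_bound := abs_mul_sum_sub_le_of_abs_le b.coe_nonneg γ.coe_nonneg mean_mem
    (δ := nndist (N * b) γ) (by simp [coe_nndist, NNReal.dist_eq])
    (h.abs_integral_truncation_sub_le hT a) fun i => (j a (y i)).toReal
  rw [split]
  refine (enorm_toReal_expNeg_add_sub_le
    (ENNReal.mul_ne_top ENNReal.coe_ne_top (ENNReal.sum_ne_top.2 fun i _ => j_ne_top _))
    (ENNReal.mul_ne_top ENNReal.coe_ne_top (h.potential_ne_top a)) _).trans ?_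
  gcongr
  rw [ENNReal.toReal_mul, ENNReal.toReal_mul, ENNReal.toReal_sum fun i _ => j_ne_top _,
    Real.enorm_eq_ofReal_abs]
  refine (ENNReal.ofReal_le_ofReal real_bound).trans_eq ?_
  rw [ENNReal.ofReal_add (mul_nonneg b.coe_nonneg (abs_nonneg _)) (by positivity),
    ENNReal.ofReal_mul b.coe_nonneg]
  congr 1
  · simp
  · rw [← ENNReal.ofReal_coe_nnreal]; push_cast; rfl

lemma lintegral_enorm_expNeg_field_sub_le [IsProbabilityMeasure π]
    (h : IsMeanFieldState k π γ μ C B) (hT : IsTruncation k π j r J τ) {N : ℕ} {ε : ℝ≥0} (a : X)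
    (lln : ∫ y, |∑ i, ((j a (y i)).toReal - ∫ z, (j a z).toReal ∂μ)| ∂kernelGibbs k π b N ≤
      N * ε) :
    ∫⁻ y, ‖(expNeg (b * ∑ i, k a (y i))).toReal - (expNeg (γ * ∫⁻ z, k a z ∂μ)).toReal‖ₑ
        ∂kernelGibbs k π b N ≤
      (N * b * (ε + (Real.exp (b * N * B)).toNNReal * τ) + nndist (N * b) γ * B +
        γ * (C * τ) : ℝ≥0) := by
  have := isProbabilityMeasure_kernelGibbs h.measurable_kernel h.symm
    h.kernelEnergy_reference_ne_top b N
  have j_meas := hT.isPosDefKernel.measurable_right a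
  have r_meas : Measurable (r a) := hT.measurable_remainder.of_uncurry_left
  have remainder_le := lintegral_kernelGibbs_sum_le h.measurable_kernel h.symm
    h.lintegral_reference_le b N r_meas
  have fluctuation_le : ∫⁻ y, ENNReal.ofReal |∑ i, ((j a (y i)).toReal - ∫ z, (j a z).toReal ∂μ)|
      ∂kernelGibbs k π b N ≤ N * ε := by
    rw [← ofReal_integral_eq_lintegral_ofReal]
    · exact (ENNReal.ofReal_le_ofReal lln).trans_eq (by simp [ENNReal.ofReal_mul])
    · refine (integrable_finsetSum _ fun i _ => Integrable.sub ?_ (integrable_const _)).abs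
      exact Integrable.of_bound (C := J)
        (j_meas.comp (measurable_pi_apply i)).ennreal_toReal.aestronglyMeasurable
        (ae_of_all _ fun y => by
          simpa using ENNReal.toReal_le_coe_of_le_coe (hT.le_bound a (y i)))
    · exact ae_of_all _ fun y => abs_nonneg _
  have exp_eq : (expNeg (b * N * B))⁻¹ = (Real.exp (b * N * B)).toNNReal := by
    have : (b * N * B : ℝ≥0∞) = (b * N * B : ℝ≥0) := by push_cast; rfl
    rw [this, expNeg_coe, ← ENNReal.ofReal_inv_of_pos (Real.exp_pos _), ← Real.exp_neg, neg_neg]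
    rfl
  refine (lintegral_mono fun y => h.enorm_expNeg_field_sub_le hT a y).trans ?_
  rw [lintegral_add_right _ (by fun_prop), lintegral_add_right _ measurable_const,
    lintegral_const_mul _ (by fun_prop), lintegral_const_mul _ (by fun_prop), lintegral_const,
    measure_univ, mul_one]
  calc _ ≤ (b : ℝ≥0∞) * (N * ε) + (nndist (N * b) γ * B + γ * (C * τ) : ℝ≥0) +
        b * (N * ((Real.exp (b * N * B)).toNNReal * τ)) := by
        gcongr
        refine remainder_le.trans ?_
        rw [exp_eq]
        gcongr
        exact hT.lintegral_remainder_le a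
    _ = (N * b * (ε + (Real.exp (b * N * B)).toNNReal * τ) + nndist (N * b) γ * B +
        γ * (C * τ) : ℝ≥0) := by push_cast; ring

theorem eventually_lintegral_enorm_expNeg_field_sub_le [IsProbabilityMeasure π]
    (h : IsMeanFieldState k π γ μ C B)
    (hk : ∀ τ : ℝ≥0, τ ≠ 0 → ∃ j r J, IsTruncation k π j r J τ) {b : ℕ → ℝ≥0}
    (hb : Tendsto (fun N : ℕ => N * b N) atTop (𝓝 γ)) {η : ℝ≥0} (hη : 0 < η) :
    ∀ᶠ N : ℕ in atTop, ∀ a,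
      ∫⁻ y, ‖(expNeg (b N * ∑ i, k a (y i))).toReal - (expNeg (γ * ∫⁻ z, k a z ∂μ)).toReal‖ₑ
        ∂kernelGibbs k π (b N) N ≤ η := by
  have := h.isProbabilityMeasure
  have (N : ℕ) := isProbabilityMeasure_kernelGibbs h.measurable_kernel h.symm
    h.kernelEnergy_reference_ne_top (b N) N
  set K : ℝ≥0 := γ * (1 + (Real.exp (γ * B)).toNNReal) + γ * C
  set τ : ℝ≥0 := η / (K + 1)
  have τ_pos : 0 < τ := by positivity
  obtain ⟨j, r, J, hT⟩ := hk τ τ_pos.ne'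
  have lln := eventually_integral_abs_sum_sub_le
    (fun κ hκ => h.eventually_kernelGibbs_le_smul_pi hk hb hκ) J (NNReal.coe_pos.2 τ_pos)
  have dist_tendsto : Tendsto (fun N : ℕ => nndist (N * b N) γ) atTop (𝓝 0) := by
    simpa using hb.nndist (tendsto_const_nhds (x := γ))
  have exp_tendsto : Tendsto (fun N : ℕ => (Real.exp (b N * N * B)).toNNReal) atTop
      (𝓝 (Real.exp (γ * B)).toNNReal) := by
    have : Continuous fun g : ℝ≥0 => (Real.exp (g * B)).toNNReal := by fun_prop
    simpa [Function.comp_def, mul_comm] using (this.tendsto γ).comp hb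
  have rate_tendsto : Tendsto (fun N : ℕ => N * b N * (τ + (Real.exp (b N * N * B)).toNNReal * τ) +
      nndist (N * b N) γ * B + γ * (C * τ)) atTop
      (𝓝 (γ * (τ + (Real.exp (γ * B)).toNNReal * τ) + 0 * B + γ * (C * τ))) :=
    ((hb.mul ((exp_tendsto.mul_const _).const_add _)).add (dist_tendsto.mul_const _)).add_const _
  have limit_lt : γ * (τ + (Real.exp (γ * B)).toNNReal * τ) + 0 * B + γ * (C * τ) < η := by
    calc _ = K * τ := by ring
      _ < (K + 1) * τ := by gcongr; exact lt_add_one K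
      _ = η := mul_div_cancel₀ _ (by positivity)
  filter_upwards [lln, rate_tendsto.eventually_lt_const limit_lt] with N lln hN a
  refine (h.lintegral_enorm_expNeg_field_sub_le hT a (lln (fun y => (j a y).toReal)
    (hT.isPosDefKernel.measurable_right a).ennreal_toReal fun y => ⟨ENNReal.toReal_nonneg,
      ENNReal.toReal_le_coe_of_le_coe (hT.le_bound a y)⟩)).trans ?_
  exact_mod_cast hN.le

end IsMeanFieldState

end MeanFieldApproximation

section Decoupling

variable {X Y : Type*} [MeasurableSpace X] [MeasurableSpace Y]

lemma integral_gibbsMeasure (π : Measure X) {w : X → ℝ≥0∞} (hw : Measurable w) (f : X → ℝ) :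
    ∫ x, f x ∂gibbsMeasure π w =
      (∫⁻ x, expNeg (w x) ∂π).toReal⁻¹ * ∫ x, f x * (expNeg (w x)).toReal ∂π := by
  rw [gibbsMeasure, integral_smul_measure, integral_withDensity_eq_integral_toReal_smul
    (by fun_prop) (ae_of_all _ fun x => (expNeg_ne_top _).lt_top), ENNReal.toReal_inv]
  simp only [smul_eq_mul, mul_comm]

lemma integrable_of_mem_Icc_zero_one {P : Measure X} [IsFiniteMeasure P] {f : X → ℝ}
    (hf : Measurable f) (hf_mem : ∀ x, f x ∈ Set.Icc 0 1) : Integrable f P :=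
  Integrable.of_mem_Icc 0 1 hf.aemeasurable (ae_of_all _ hf_mem)

lemma mul_mem_Icc_zero_one {a b : ℝ} (ha : a ∈ Set.Icc 0 1) (hb : b ∈ Set.Icc 0 1) :
    a * b ∈ Set.Icc 0 1 :=
  ⟨mul_nonneg ha.1 hb.1, mul_le_one₀ ha.2 hb.1 hb.2⟩

lemma toReal_expNeg_mem_Icc (t : ℝ≥0∞) : (expNeg t).toReal ∈ Set.Icc 0 1 :=
  ⟨ENNReal.toReal_nonneg, ENNReal.toReal_mono ENNReal.one_ne_top (expNeg_le_one t)⟩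

variable {π : Measure X} [IsProbabilityMeasure π] {P : Measure Y} [IsProbabilityMeasure P]
  {w : X × Y → ℝ≥0∞} {v : X → ℝ≥0∞} {η : ℝ≥0} {F : X → ℝ} {g : Y → ℝ}

lemma abs_integral_prod_mul_sub_le (hw : Measurable w) (hv : Measurable v)
    (hη : ∀ a, ∫⁻ y, ‖(expNeg (w (a, y))).toReal - (expNeg (v a)).toReal‖ₑ ∂P ≤ η)
    (hF : Measurable F) (hF_mem : ∀ x, F x ∈ Set.Icc 0 1)
    (hg : Measurable g) (hg_mem : ∀ y, g y ∈ Set.Icc 0 1) :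
    |∫ q, F q.1 * g q.2 * (expNeg (w q)).toReal ∂π.prod P -
        (∫ x, F x * (expNeg (v x)).toReal ∂π) * ∫ y, g y ∂P| ≤ η * ∫ x, F x ∂π := by
  have w_int : Integrable (fun q => F q.1 * g q.2 * (expNeg (w q)).toReal) (π.prod P) :=
    integrable_of_mem_Icc_zero_one (by fun_prop) fun q =>
      mul_mem_Icc_zero_one (mul_mem_Icc_zero_one (hF_mem _) (hg_mem _)) (toReal_expNeg_mem_Icc _)
  have v_int : Integrable (fun q : X × Y => F q.1 * (expNeg (v q.1)).toReal * g q.2)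
      (π.prod P) :=
    integrable_of_mem_Icc_zero_one (by fun_prop) fun q =>
      mul_mem_Icc_zero_one (mul_mem_Icc_zero_one (hF_mem _) (toReal_expNeg_mem_Icc _)) (hg_mem _)
  have mean_nonneg : 0 ≤ ∫ x, F x ∂π := integral_nonneg fun x => (hF_mem x).1
  rw [← integral_prod_mul, ← integral_sub w_int v_int,
    ← ENNReal.ofReal_le_ofReal_iff (by positivity), ← Real.enorm_eq_ofReal_abs]
  calc ‖∫ q, F q.1 * g q.2 * (expNeg (w q)).toReal -
          F q.1 * (expNeg (v q.1)).toReal * g q.2 ∂π.prod P‖ₑ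
      ≤ ∫⁻ q, ‖F q.1 * g q.2 * (expNeg (w q)).toReal -
          F q.1 * (expNeg (v q.1)).toReal * g q.2‖ₑ ∂π.prod P := enorm_integral_le_lintegral_enorm _
    _ ≤ ∫⁻ q, ‖F q.1‖ₑ * ‖(expNeg (w q)).toReal - (expNeg (v q.1)).toReal‖ₑ ∂π.prod P := by
        refine lintegral_mono fun q => ?_
        rw [mul_right_comm, ← sub_mul, ← mul_sub, enorm_mul, enorm_mul]
        refine mul_le_of_le_one_right' ?_
        rw [Real.enorm_of_nonneg (hg_mem _).1]
        exact ENNReal.ofReal_le_one.2 (hg_mem _).2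
    _ = ∫⁻ a, ‖F a‖ₑ * ∫⁻ y, ‖(expNeg (w (a, y))).toReal - (expNeg (v a)).toReal‖ₑ ∂P ∂π := by
        rw [lintegral_prod _ (by fun_prop)]
        refine lintegral_congr fun a => ?_
        simp only
        rw [lintegral_const_mul _ (by fun_prop)]
    _ ≤ ∫⁻ a, ‖F a‖ₑ * η ∂π := by gcongr with a; exact hη a
    _ = ENNReal.ofReal (η * ∫ x, F x ∂π) := by
        rw [lintegral_mul_const _ (by fun_prop), mul_comm, ENNReal.ofReal_mul η.coe_nonneg,
          ENNReal.ofReal_coe_nnreal, ofReal_integral_eq_lintegral_ofReal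
            (integrable_of_mem_Icc_zero_one hF hF_mem) (ae_of_all _ fun x => (hF_mem x).1)]
        simp only [Real.enorm_of_nonneg (hF_mem _).1]

lemma abs_integral_gibbsMeasure_prod_mul_sub_le (hw : Measurable w) (hv : Measurable v)
    (hw_zero : ∫⁻ q, expNeg (w q) ∂π.prod P ≠ 0) (hv_zero : ∫⁻ x, expNeg (v x) ∂π ≠ 0)
    (hη : ∀ a, ∫⁻ y, ‖(expNeg (w (a, y))).toReal - (expNeg (v a)).toReal‖ₑ ∂P ≤ η)
    (hF : Measurable F) (hF_mem : ∀ x, F x ∈ Set.Icc 0 1)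
    (hg : Measurable g) (hg_mem : ∀ y, g y ∈ Set.Icc 0 1) :
    |∫ q, F q.1 * g q.2 ∂gibbsMeasure (π.prod P) w -
        (∫ x, F x ∂gibbsMeasure π v) * ∫ q, g q.2 ∂gibbsMeasure (π.prod P) w| ≤
      (∫⁻ q, expNeg (w q) ∂π.prod P).toReal⁻¹ *
        (η * (∫ x, F x ∂π + ∫ x, F x ∂gibbsMeasure π v)) := by
  have joint := abs_integral_prod_mul_sub_le (π := π) hw hv hη hF hF_mem hg hg_mem
  have marginal := abs_integral_prod_mul_sub_le (π := π) hw hv hη (F := fun _ => 1)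
    measurable_const (fun _ => ⟨zero_le_one, le_rfl⟩) hg hg_mem
  have ζ_pos : 0 < (∫⁻ q, expNeg (w q) ∂π.prod P).toReal :=
    ENNReal.toReal_pos hw_zero ((lintegral_expNeg_le_one w).trans_lt ENNReal.one_lt_top).ne
  have Z_pos : 0 < (∫⁻ x, expNeg (v x) ∂π).toReal :=
    ENNReal.toReal_pos hv_zero ((lintegral_expNeg_le_one v).trans_lt ENNReal.one_lt_top).ne
  have Z_eq : ∫ x, (expNeg (v x)).toReal ∂π = (∫⁻ x, expNeg (v x) ∂π).toReal :=
    integral_toReal (by fun_prop) (ae_of_all _ fun x => (expNeg_ne_top _).lt_top)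
  simp only [one_mul, Z_eq, integral_const, probReal_univ, smul_eq_mul, mul_one] at marginal
  rw [integral_gibbsMeasure _ hw, integral_gibbsMeasure _ hw (fun q => g q.2)]
  set f := ∫ x, F x ∂gibbsMeasure π v with hf
  have f_nonneg : 0 ≤ f := integral_nonneg fun x => (hF_mem x).1
  have f_eq : ∫ x, F x * (expNeg (v x)).toReal ∂π = f * (∫⁻ x, expNeg (v x) ∂π).toReal := by
    rw [hf, integral_gibbsMeasure _ hv]
    field_simp
  rw [f_eq, mul_assoc] at joint
  rw [mul_left_comm f, ← mul_sub, abs_mul, abs_of_pos (inv_pos.2 ζ_pos)]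
  gcongr
  calc |_ - f * _| ≤ _ + |f * _ - f * _| := abs_sub_le _ _ _
    _ ≤ η * ∫ x, F x ∂π + f * η := by
        rw [← mul_sub f, abs_mul, abs_of_nonneg f_nonneg, abs_sub_comm _ (∫ q, _ ∂_)]
        gcongr
    _ = _ := by ring

end Decoupling

section PoissonLimit

lemma exp_neg_le_toReal {t : ℝ≥0} {z : ℝ≥0∞} (hz : z ≠ ⊤) (h : expNeg t ≤ z) :
    Real.exp (-t) ≤ z.toReal := by
  rwa [expNeg_coe, ENNReal.ofReal_le_iff_le_toReal hz] at h

/-- Removing one factor at a time shows that approximately decoupled factors multiply. -/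
lemma abs_integral_prod_one_sub_sub_pow_le {Ω ι : Type*} [MeasurableSpace Ω]
    {P : Measure Ω} [IsProbabilityMeasure P] {φ : ι → Ω → ℝ} (hφ : ∀ i, Measurable (φ i))
    (hφ_mem : ∀ i ω, φ i ω ∈ Set.Icc 0 1) {m ε : ℝ} (hm : m ∈ Set.Icc 0 1)
    (decoupling : ∀ (k : ι) (S : Finset ι), k ∉ S →
      |∫ ω, φ k ω * ∏ i ∈ S, (1 - φ i ω) ∂P - m * ∫ ω, ∏ i ∈ S, (1 - φ i ω) ∂P| ≤ ε)
    (S : Finset ι) : |∫ ω, ∏ i ∈ S, (1 - φ i ω) ∂P - (1 - m) ^ S.card| ≤ S.card * ε := by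
  classical
  have prod_mem (S : Finset ι) (ω : Ω) : ∏ i ∈ S, (1 - φ i ω) ∈ Set.Icc 0 1 :=
    ⟨Finset.prod_nonneg fun i _ => sub_nonneg.2 (hφ_mem i ω).2,
      Finset.prod_le_one (fun i _ => sub_nonneg.2 (hφ_mem i ω).2)
        fun i _ => sub_le_self _ (hφ_mem i ω).1⟩
  induction S using Finset.induction_on with
  | empty => simp
  | insert k S hk ih =>
    have split : ∫ ω, ∏ i ∈ insert k S, (1 - φ i ω) ∂P =
        ∫ ω, ∏ i ∈ S, (1 - φ i ω) ∂P - ∫ ω, φ k ω * ∏ i ∈ S, (1 - φ i ω) ∂P := by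
      rw [← integral_sub]
      · simp only [Finset.prod_insert hk, sub_mul, one_mul]
      · exact integrable_of_mem_Icc_zero_one (by fun_prop) (prod_mem S)
      · exact integrable_of_mem_Icc_zero_one (by fun_prop)
          fun ω => mul_mem_Icc_zero_one (hφ_mem k ω) (prod_mem S ω)
    rw [split, Finset.card_insert_of_notMem hk, pow_succ]
    set G := ∫ ω, ∏ i ∈ S, (1 - φ i ω) ∂P
    set H := ∫ ω, φ k ω * ∏ i ∈ S, (1 - φ i ω) ∂P
    calc |G - H - (1 - m) ^ S.card * (1 - m)|
        = |(G - (1 - m) ^ S.card) * (1 - m) - (H - m * G)| := by ring_nf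
      _ ≤ |G - (1 - m) ^ S.card| * |1 - m| + |H - m * G| := by
          rw [← abs_mul]; exact abs_sub _ _
      _ ≤ S.card * ε * 1 + ε := by
          gcongr
          · exact (abs_nonneg _).trans ih
          · exact abs_le.2 ⟨by linarith [hm.2], by linarith [hm.1]⟩
          · exact decoupling k S hk
      _ = (S.card + 1 : ℕ) * ε := by push_cast; ring

lemma prod_ite_removeNth {X : Type*} {N : ℕ} {i : Fin (N + 1)} {S : Finset (Fin (N + 1))}
    (hi : i ∉ S) (f : X → ℝ) (x : Fin (N + 1) → X) :
    ∏ j, (if i.succAbove j ∈ S then f (i.removeNth x j) else 1) = ∏ j ∈ S, f (x j) := by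
  rw [← Fintype.prod_ite_mem S, Fin.prod_univ_succAbove _ i, if_neg hi, one_mul]
  rfl

variable {X : Type*} [MeasurableSpace X] {k : X → X → ℝ≥0∞} {π μ : Measure X} {γ C B : ℝ≥0}

namespace IsMeanFieldState

lemma exp_neg_mul_integral_le [IsProbabilityMeasure π] (h : IsMeanFieldState k π γ μ C B)
    {F : X → ℝ} (hF : Measurable F) (hF_mem : ∀ x, F x ∈ Set.Icc 0 1) :
    Real.exp (-(γ * B)) * ∫ x, F x ∂π ≤ ∫ x, F x ∂μ := by
  have h_meas := h.measurable_potential.const_mul (γ : ℝ≥0∞)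
  have h_fin (x : X) : γ * ∫⁻ y, k x y ∂μ ≠ ⊤ :=
    ENNReal.mul_ne_top ENNReal.coe_ne_top (h.potential_ne_top x)
  have Z_pos := toReal_lintegral_expNeg_pos (π := π) h_meas (ae_of_all _ h_fin)
  have Z_le : (∫⁻ x, expNeg (γ * ∫⁻ y, k x y ∂μ) ∂π).toReal ≤ 1 :=
    ENNReal.toReal_mono ENNReal.one_ne_top (lintegral_expNeg_le_one _)
  have weight_ge (x : X) : Real.exp (-(γ * B)) ≤ (expNeg (γ * ∫⁻ y, k x y ∂μ)).toReal := by
    rw [← NNReal.coe_mul]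
    refine exp_neg_le_toReal (expNeg_ne_top _) (expNeg_antitone ?_)
    rw [ENNReal.coe_mul]
    gcongr
    exact h.lintegral_le x
  calc Real.exp (-(γ * B)) * ∫ x, F x ∂π = ∫ x, F x * Real.exp (-(γ * B)) ∂π := by
        rw [integral_mul_const, mul_comm]
    _ ≤ ∫ x, F x * (expNeg (γ * ∫⁻ y, k x y ∂μ)).toReal ∂π := by
        refine integral_mono ((integrable_of_mem_Icc_zero_one hF hF_mem).mul_const _)
          (integrable_of_mem_Icc_zero_one (by fun_prop) fun x =>
            mul_mem_Icc_zero_one (hF_mem x) (toReal_expNeg_mem_Icc _)) fun x => ?_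
        exact mul_le_mul_of_nonneg_left (weight_ge x) (hF_mem x).1
    _ ≤ (∫⁻ x, expNeg (γ * ∫⁻ y, k x y ∂μ) ∂π).toReal⁻¹ *
          ∫ x, F x * (expNeg (γ * ∫⁻ y, k x y ∂μ)).toReal ∂π :=
        le_mul_of_one_le_left (integral_nonneg fun x =>
          mul_nonneg (hF_mem x).1 ENNReal.toReal_nonneg) ((one_le_inv₀ Z_pos).2 Z_le)
    _ = ∫ x, F x ∂μ := by rw [← integral_gibbsMeasure π h_meas, ← h.eq_gibbsMeasure]

lemma abs_integral_kernelGibbs_mul_sub_le [IsProbabilityMeasure π]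
    (h : IsMeanFieldState k π γ μ C B) {b η : ℝ≥0} {N : ℕ}
    (field_le : ∀ a, ∫⁻ y, ‖(expNeg (b * ∑ i, k a (y i))).toReal -
      (expNeg (γ * ∫⁻ z, k a z ∂μ)).toReal‖ₑ ∂kernelGibbs k π b N ≤ η)
    (i : Fin (N + 1)) {F : X → ℝ} {g : (Fin N → X) → ℝ} (hF : Measurable F)
    (hF_mem : ∀ x, F x ∈ Set.Icc 0 1) (hg : Measurable g) (hg_mem : ∀ y, g y ∈ Set.Icc 0 1) :
    |∫ x, F (x i) * g (i.removeNth x) ∂kernelGibbs k π b (N + 1) -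
        (∫ x, F x ∂μ) * ∫ x, g (i.removeNth x) ∂kernelGibbs k π b (N + 1)| ≤
      Real.exp (b * N * B) * (η * (Real.exp (γ * B) * ∫ x, F x ∂μ + ∫ x, F x ∂μ)) := by
  have k_meas := h.measurable_kernel
  have hE := h.kernelEnergy_reference_ne_top
  have := isProbabilityMeasure_kernelGibbs k_meas h.symm hE b N
  have h_meas := h.measurable_potential.const_mul (γ : ℝ≥0∞)
  have insert_embedding : MeasurableEmbedding
      fun q : X × (Fin N → X) => (i.insertNth q.1 q.2 : Fin (N + 1) → X) :=
    (MeasurableEquiv.piFinSuccAbove (fun _ => X) i).symm.measurableEmbedding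
  have ζ_ge := expNeg_le_lintegral_expNeg_field k_meas h.symm h.lintegral_reference_le b
    (kernelGibbs k π b N)
  have ζ_toReal_ge := exp_neg_le_toReal (t := b * N * B)
    ((lintegral_expNeg_le_one _).trans_lt ENNReal.one_lt_top).ne (by exact_mod_cast ζ_ge)
  have bound := abs_integral_gibbsMeasure_prod_mul_sub_le (by fun_prop) h_meas
    ((expNeg_pos (by finiteness)).trans_le ζ_ge).ne'
    (lintegral_expNeg_ne_zero (π := π) h_meas (.of_forall fun x =>
      ENNReal.mul_ne_top ENNReal.coe_ne_top (h.potential_ne_top x))) field_le hF hF_mem hg hg_mem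
  rw [← h.eq_gibbsMeasure] at bound
  rw [kernelGibbs_succ k_meas h.symm hE b i, insert_embedding.integral_map,
    insert_embedding.integral_map]
  simp only [Fin.insertNth_apply_same, Fin.removeNth_insertNth]
  have F_nonneg (ν : Measure X) : 0 ≤ ∫ x, F x ∂ν := integral_nonneg fun x => (hF_mem x).1
  refine bound.trans (mul_le_mul ?_ ?_ ?_ (Real.exp_pos _).le)
  · refine (inv_anti₀ (Real.exp_pos _) ζ_toReal_ge).trans_eq ?_
    rw [← Real.exp_neg, neg_neg, NNReal.coe_mul, NNReal.coe_mul, NNReal.coe_natCast]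
  · have := h.exp_neg_mul_integral_le hF hF_mem
    rw [Real.exp_neg, inv_mul_le_iff₀ (Real.exp_pos _)] at this
    gcongr
  · exact mul_nonneg η.coe_nonneg (add_nonneg (F_nonneg π) (F_nonneg μ))

lemma eventually_abs_integral_kernelGibbs_mul_sub_le [IsProbabilityMeasure π]
    (h : IsMeanFieldState k π γ μ C B)
    (hk : ∀ τ : ℝ≥0, τ ≠ 0 → ∃ j r J, IsTruncation k π j r J τ) {b : ℕ → ℝ≥0}
    (hb : Tendsto (fun N : ℕ => N * b N) atTop (𝓝 γ)) {ε : ℝ} (hε : 0 < ε) :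
    ∀ᶠ N : ℕ in atTop, ∀ (i : Fin (N + 1)) (F : X → ℝ) (g : (Fin N → X) → ℝ),
      Measurable F → (∀ x, F x ∈ Set.Icc 0 1) → Measurable g → (∀ y, g y ∈ Set.Icc 0 1) →
      |∫ x, F (x i) * g (i.removeNth x) ∂kernelGibbs k π (b N) (N + 1) -
          (∫ x, F x ∂μ) * ∫ x, g (i.removeNth x) ∂kernelGibbs k π (b N) (N + 1)| ≤
        ε * ∫ x, F x ∂μ := by
  set K : ℝ := Real.exp (γ * B + 1) * (Real.exp (γ * B) + 1)
  have K_pos : 0 < K := by positivity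
  obtain ⟨η, η_eq⟩ : ∃ η : ℝ≥0, (η : ℝ) = ε / K := ⟨⟨ε / K, by positivity⟩, rfl⟩
  have exponent_tendsto : Tendsto (fun N : ℕ => (b N * N * B : ℝ)) atTop (𝓝 (γ * B)) := by
    simpa [mul_comm] using NNReal.tendsto_coe.2 (hb.mul_const B)
  filter_upwards [exponent_tendsto.eventually_lt_const (lt_add_one _),
    h.eventually_lintegral_enorm_expNeg_field_sub_le hk hb
      (η := η) (NNReal.coe_pos.1 (η_eq ▸ by positivity))]
    with N hN field_le i F g hF hF_mem hg hg_mem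
  have F_nonneg : 0 ≤ ∫ x, F x ∂μ := integral_nonneg fun x => (hF_mem x).1
  calc _ ≤ Real.exp (b N * N * B) * (η * (Real.exp (γ * B) * ∫ x, F x ∂μ + ∫ x, F x ∂μ)) :=
        h.abs_integral_kernelGibbs_mul_sub_le field_le i hF hF_mem hg hg_mem
    _ ≤ Real.exp (γ * B + 1) * (η * (Real.exp (γ * B) * ∫ x, F x ∂μ + ∫ x, F x ∂μ)) := by gcongr
    _ = η * K * ∫ x, F x ∂μ := by ring
    _ = ε * ∫ x, F x ∂μ := by rw [η_eq, div_mul_cancel₀ _ K_pos.ne']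

lemma eventually_abs_integral_prod_one_sub_sub_pow_le [IsProbabilityMeasure π]
    (h : IsMeanFieldState k π γ μ C B)
    (hk : ∀ τ : ℝ≥0, τ ≠ 0 → ∃ j r J, IsTruncation k π j r J τ) {b : ℕ → ℝ≥0}
    (hb : Tendsto (fun N : ℕ => N * b N) atTop (𝓝 γ)) {ε : ℝ} (hε : 0 < ε) :
    ∀ᶠ N : ℕ in atTop, ∀ φ : X → ℝ, Measurable φ → (∀ x, φ x ∈ Set.Icc 0 1) →
      |∫ x, ∏ j, (1 - φ (x j)) ∂kernelGibbs k π (b N) N - (1 - ∫ x, φ x ∂μ) ^ N| ≤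
        N * (ε * ∫ x, φ x ∂μ) := by
  have hb_succ : Tendsto (fun N : ℕ => N * b (N + 1)) atTop (𝓝 γ) := by
    have := ((tendsto_add_atTop_iff_nat 1).2 hb).sub
      ((tendsto_add_atTop_iff_nat 1).2 (tendsto_zero_of_tendsto_natCast_mul hb))
    simpa [add_mul] using this
  rw [← map_add_atTop_eq_nat 1, eventually_map]
  filter_upwards [h.eventually_abs_integral_kernelGibbs_mul_sub_le hk hb_succ hε]
    with N decoupled φ hφ hφ_mem
  have := h.isProbabilityMeasure
  have := isProbabilityMeasure_kernelGibbs h.measurable_kernel h.symm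
    h.kernelEnergy_reference_ne_top (b (N + 1)) (N + 1)
  have factor_mem (x : X) : 1 - φ x ∈ Set.Icc 0 1 :=
    ⟨sub_nonneg.2 (hφ_mem x).2, sub_le_self _ (hφ_mem x).1⟩
  have mean_mem : ∫ x, φ x ∂μ ∈ Set.Icc 0 1 :=
    ⟨integral_nonneg fun x => (hφ_mem x).1, by
      simpa using integral_mono (integrable_of_mem_Icc_zero_one (P := μ) hφ hφ_mem)
        (integrable_const 1) fun x => (hφ_mem x).2⟩
  simpa using abs_integral_prod_one_sub_sub_pow_le (P := kernelGibbs k π (b (N + 1)) (N + 1))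
    (φ := fun i x => φ (x i)) (fun i => by fun_prop) (fun i x => hφ_mem (x i)) mean_mem
    (fun i S hi => by
      have ite_mem (y : Fin N → X) (j : Fin N) :
          (if i.succAbove j ∈ S then 1 - φ (y j) else 1) ∈ Set.Icc (0 : ℝ) 1 := by
        split_ifs
        exacts [factor_mem _, ⟨zero_le_one, le_rfl⟩]
      simpa only [prod_ite_removeNth hi fun x => 1 - φ x] using decoupled i φ
        (fun y => ∏ j, if i.succAbove j ∈ S then 1 - φ (y j) else 1) hφ hφ_mem
        (Finset.measurable_prod _ fun j _ => by split_ifs <;> fun_prop)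
        fun y => ⟨Finset.prod_nonneg fun j _ => (ite_mem y j).1,
          Finset.prod_le_one (fun j _ => (ite_mem y j).1) fun j _ => (ite_mem y j).2⟩) Finset.univ

theorem tendsto_integral_prod_one_sub [IsProbabilityMeasure π]
    (h : IsMeanFieldState k π γ μ C B)
    (hk : ∀ τ : ℝ≥0, τ ≠ 0 → ∃ j r J, IsTruncation k π j r J τ) {b : ℕ → ℝ≥0}
    (hb : Tendsto (fun N : ℕ => N * b N) atTop (𝓝 γ)) {φ : ℕ → X → ℝ}
    (hφ : ∀ N, Measurable (φ N)) (hφ_mem : ∀ N x, φ N x ∈ Set.Icc 0 1) {α : ℝ}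
    (hα : Tendsto (fun N : ℕ => N * ∫ x, φ N x ∂μ) atTop (𝓝 α)) :
    Tendsto (fun N => ∫ x, ∏ j, (1 - φ N (x j)) ∂kernelGibbs k π (b N) N) atTop
      (𝓝 (Real.exp (-α))) := by
  have independent : Tendsto (fun N => (1 - ∫ x, φ N x ∂μ) ^ N) atTop (𝓝 (Real.exp (-α))) := by
    simpa [sub_eq_add_neg] using Real.tendsto_one_add_pow_exp_of_tendsto
      (g := fun N => -∫ x, φ N x ∂μ) (by simpa using hα.neg)
  refine independent.congr_dist (Metric.tendsto_nhds.2 fun ε hε => ?_)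
  have α_nonneg : 0 ≤ α := ge_of_tendsto' hα fun N =>
    mul_nonneg N.cast_nonneg (integral_nonneg fun x => (hφ_mem N x).1)
  filter_upwards [h.eventually_abs_integral_prod_one_sub_sub_pow_le hk hb
    (ε := ε / (α + 1)) (by positivity), hα.eventually_lt_const (lt_add_one α)] with N error_le hN
  rw [Real.dist_0_eq_abs, abs_dist, dist_comm, Real.dist_eq]
  calc _ ≤ N * (ε / (α + 1) * ∫ x, φ N x ∂μ) := error_le (φ N) (hφ N) (hφ_mem N)
    _ = ε / (α + 1) * (N * ∫ x, φ N x ∂μ) := by ring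
    _ < ε / (α + 1) * (α + 1) := by gcongr
    _ = ε := div_mul_cancel₀ _ (by positivity)

end IsMeanFieldState

end PoissonLimit

section PoissonProcess

open ProbabilityTheory

variable {ι X : Type*} [MeasurableSpace X]

lemma lintegral_pow_poissonMeasure (r : ℝ≥0) {L : ℝ≥0∞} (hL : L ≤ 1) :
    ∫⁻ k, L ^ k ∂(poissonMeasure r) = expNeg (r * (1 - L)) := by
  lift L to ℝ≥0 using (hL.trans_lt ENNReal.one_lt_top).ne
  have exp_series : HasSum (fun k : ℕ => Real.exp (-r) * ((r * L : ℝ) ^ k / k.factorial))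
      (Real.exp (-r) * Real.exp (r * L)) := by
    rw [Real.exp_eq_exp_ℝ]
    exact (NormedSpace.expSeries_div_hasSum_exp (r * L : ℝ)).mul_left _
  have term_eq (k : ℕ) : (L : ℝ≥0∞) ^ k * poissonMeasure r {k} =
      ENNReal.ofReal (Real.exp (-r) * ((r * L : ℝ) ^ k / k.factorial)) := by
    rw [poissonMeasure_singleton, ← ENNReal.ofReal_coe_nnreal,
      ← ENNReal.ofReal_pow L.coe_nonneg, ← ENNReal.ofReal_mul (by positivity), mul_pow]
    congr 1
    ring
  simp only [lintegral_countable', term_eq]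
  rw [← ENNReal.ofReal_tsum_of_nonneg (fun k => by positivity) exp_series.summable,
    exp_series.tsum_eq, ← ENNReal.coe_one, ← ENNReal.coe_sub, ← ENNReal.coe_mul, expNeg_coe,
    ← Real.exp_add, NNReal.coe_mul, NNReal.coe_sub (by exact_mod_cast hL), NNReal.coe_one]
  congr 2
  ring

/-- The sum of the Dirac masses at `ω.2 ⟨k, j⟩` for `j < ω.1 k`: there are `ω.1 k` points of the
`k`-th kind. -/
noncomputable def superposition (ω : (ι → ℕ) × ((_ : ι) × ℕ → X)) : Measure X :=
  Measure.sum fun i : (_ : ι) × ℕ => if i.2 < ω.1 i.1 then Measure.dirac (ω.2 i) else 0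

/-- The law under which the number of points of the `k`-th kind is Poisson with mean `c k`, the
points of the `k`-th kind have distribution `ν k`, and all of these are independent. -/
noncomputable def superpositionLaw (c : ι → ℝ≥0) (ν : ι → Measure X)
    [∀ k, IsProbabilityMeasure (ν k)] : Measure ((ι → ℕ) × ((_ : ι) × ℕ → X)) :=
  (Measure.infinitePi fun k => poissonMeasure (c k)).prod
    (Measure.infinitePi fun i : (_ : ι) × ℕ => ν i.1)

instance (c : ι → ℝ≥0) (ν : ι → Measure X) [∀ k, IsProbabilityMeasure (ν k)] :
    IsProbabilityMeasure (superpositionLaw c ν) := by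
  unfold superpositionLaw
  infer_instance

lemma measurable_ite_lt {f : X → ℝ≥0∞} (hf : Measurable f) (i : (_ : ι) × ℕ) :
    Measurable fun ω : (ι → ℕ) × ((_ : ι) × ℕ → X) => if i.2 < ω.1 i.1 then f (ω.2 i) else 0 :=
  Measurable.ite (measurableSet_lt measurable_const (by fun_prop)) (by fun_prop) measurable_const

lemma lintegral_superposition {f : X → ℝ≥0∞} (hf : Measurable f)
    (ω : (ι → ℕ) × ((_ : ι) × ℕ → X)) :
    ∫⁻ x, f x ∂superposition ω =
      ∑' i : (_ : ι) × ℕ, if i.2 < ω.1 i.1 then f (ω.2 i) else 0 := by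
  rw [superposition, lintegral_sum_measure]
  refine tsum_congr fun i => ?_
  split_ifs
  · exact lintegral_dirac' _ hf
  · exact lintegral_zero_measure _

lemma lintegral_superposition_eq_tsum_sum {f : X → ℝ≥0∞} (hf : Measurable f)
    (ω : (ι → ℕ) × ((_ : ι) × ℕ → X)) :
    ∫⁻ x, f x ∂superposition ω = ∑' k, ∑ j ∈ Finset.range (ω.1 k), f (ω.2 ⟨k, j⟩) := by
  rw [lintegral_superposition hf, ENNReal.tsum_sigma']
  refine tsum_congr fun k => ?_
  rw [tsum_eq_sum (s := Finset.range (ω.1 k)) fun j hj => if_neg (by simpa using hj)]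
  exact Finset.sum_congr rfl fun j hj => if_pos (Finset.mem_range.1 hj)

lemma measurable_sum_range {f : X → ℝ≥0∞} (hf : Measurable f) (k : ι) :
    Measurable fun ω : (ι → ℕ) × ((_ : ι) × ℕ → X) =>
      ∑ j ∈ Finset.range (ω.1 k), f (ω.2 ⟨k, j⟩) := by
  have measurable_fixed_count : Measurable fun q : ℕ × ((ι → ℕ) × ((_ : ι) × ℕ → X)) =>
      ∑ j ∈ Finset.range q.1, f (q.2.2 ⟨k, j⟩) :=
    measurable_from_prod_countable_right fun m => by dsimp only; fun_prop
  exact measurable_fixed_count.comp (f := fun ω => (ω.1 k, ω)) (by fun_prop)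

lemma measurable_expNeg_sum_range {f : X → ℝ≥0∞} (hf : Measurable f) (S : Finset ι) :
    Measurable fun ω : (ι → ℕ) × ((_ : ι) × ℕ → X) =>
      expNeg (∑ k ∈ S, ∑ j ∈ Finset.range (ω.1 k), f (ω.2 ⟨k, j⟩)) :=
  measurable_expNeg.comp (Finset.measurable_fun_sum S fun k _ => measurable_sum_range hf k)

lemma measurable_superposition [Countable ι] : Measurable (superposition (ι := ι) (X := X)) := by
  refine Measure.measurable_of_measurable_coe _ fun t ht => ?_
  have h_indicator : Measurable (t.indicator (1 : X → ℝ≥0∞)) := measurable_one.indicator ht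
  simp only [← lintegral_indicator_one ht, lintegral_superposition h_indicator]
  exact Measurable.tsum fun i => measurable_ite_lt h_indicator i

lemma sum_smul_cond {s : ℕ → Set X} (hs_disj : Pairwise (Function.onFun Disjoint s))
    (hs_meas : ∀ k, MeasurableSet (s k)) (hs_univ : ⋃ k, s k = Set.univ) {θ : Measure X}
    (hθ : ∀ k, θ (s k) ≠ ∞) :
    Measure.sum (fun k : {k // θ (s k) ≠ 0} => (θ (s k)).toNNReal • θ[|s k]) = θ := by
  have smul_cond (k : {k // θ (s k) ≠ 0}) :
      (θ (s k)).toNNReal • θ[|s k] = θ.restrict (s k) := by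
    rw [ProbabilityTheory.cond, ENNReal.smul_def, ENNReal.coe_toNNReal (hθ k), smul_smul,
      ENNReal.mul_inv_cancel k.2 (hθ k), one_smul]
  have sum_restrict : Measure.sum (fun k => θ.restrict (s k)) = θ := by
    rw [← Measure.restrict_iUnion hs_disj hs_meas, hs_univ, Measure.restrict_univ]
  ext t ht
  have apply_eq_tsum : θ t = ∑' k, θ.restrict (s k) t := by
    rw [← Measure.sum_apply _ ht, sum_restrict]
  simp only [Measure.sum_apply _ ht, smul_cond, apply_eq_tsum]
  refine tsum_subtype_eq_of_support_subset (f := fun k => θ.restrict (s k) t) fun k hk h_zero => ?_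
  exact hk (by simp only [Measure.restrict_eq_zero.2 h_zero, Measure.coe_zero, Pi.zero_apply])

variable (c : ι → ℝ≥0) (ν : ι → Measure X) [∀ k, IsProbabilityMeasure (ν k)]

lemma lintegral_prod_pow_poissonMeasure {L : ι → ℝ≥0∞} (hL : ∀ k, L k ≤ 1) (S : Finset ι) :
    ∫⁻ m : ι → ℕ, ∏ k ∈ S, L k ^ m k ∂(Measure.infinitePi fun k => poissonMeasure (c k)) =
      expNeg (∑ k ∈ S, c k * (1 - L k)) := by
  have indep := iIndepFun_infinitePi (P := fun k => poissonMeasure (c k))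
    (X := fun k (m : ℕ) => L k ^ m) fun _ => measurable_from_top
  rw [lintegral_prod_eq_prod_lintegral_of_indepFun _ _ indep fun k =>
    (measurable_from_top (f := fun m : ℕ => L k ^ m)).comp (measurable_pi_apply k), expNeg_sum]
  refine Finset.prod_congr rfl fun k _ => ?_
  rw [← lintegral_pow_poissonMeasure (c k) (hL k)]
  exact (measurePreserving_eval_infinitePi (fun k => poissonMeasure (c k)) k).lintegral_comp
    measurable_from_top

lemma lintegral_expNeg_sum_marks {f : X → ℝ≥0∞} (hf : Measurable f) (S : Finset ι) (m : ι → ℕ) :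
    ∫⁻ x, expNeg (∑ k ∈ S, ∑ j ∈ Finset.range (m k), f (x ⟨k, j⟩))
        ∂(Measure.infinitePi fun i : (_ : ι) × ℕ => ν i.1) =
      ∏ k ∈ S, (∫⁻ a, expNeg (f a) ∂(ν k)) ^ m k := by
  have h_exp : Measurable fun a => expNeg (f a) := by fun_prop
  have indep := iIndepFun_infinitePi (P := fun i : (_ : ι) × ℕ => ν i.1)
    (X := fun _ a => expNeg (f a)) fun _ => h_exp
  simp only [Finset.sum_sigma', expNeg_sum]
  rw [lintegral_prod_eq_prod_lintegral_of_indepFun _ _ indep fun i => by fun_prop,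
    Finset.prod_sigma]
  refine Finset.prod_congr rfl fun k _ => ?_
  rw [Finset.prod_congr rfl fun j _ => (measurePreserving_eval_infinitePi
    (fun i : (_ : ι) × ℕ => ν i.1) ⟨k, j⟩).lintegral_comp h_exp]
  simp only [Finset.prod_const, Finset.card_range]

lemma lintegral_expNeg_sum_superpositionLaw {f : X → ℝ≥0∞} (hf : Measurable f) (S : Finset ι) :
    ∫⁻ ω, expNeg (∑ k ∈ S, ∑ j ∈ Finset.range (ω.1 k), f (ω.2 ⟨k, j⟩)) ∂(superpositionLaw c ν) =
      expNeg (∑ k ∈ S, c k * (1 - ∫⁻ a, expNeg (f a) ∂(ν k))) := by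
  rw [superpositionLaw, lintegral_prod _ (measurable_expNeg_sum_range hf S).aemeasurable,
    ← lintegral_prod_pow_poissonMeasure c fun k => lintegral_expNeg_le_one _]
  exact lintegral_congr fun m => lintegral_expNeg_sum_marks ν hf S m

theorem laplaceFunctional_superposition [Countable ι] {f : X → ℝ≥0} (hf : Measurable f) :
    laplaceFunctional (superpositionLaw c ν) superposition f =
      expNeg (∫⁻ x, (1 - expNeg (f x : ℝ≥0∞)) ∂(Measure.sum fun k => c k • ν k)) := by
  have hf' : Measurable fun x => (f x : ℝ≥0∞) := by fun_prop
  have laplace_limit : Tendsto (fun S : Finset ι =>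
      ∫⁻ ω, expNeg (∑ k ∈ S, ∑ j ∈ Finset.range (ω.1 k), (f (ω.2 ⟨k, j⟩) : ℝ≥0∞))
        ∂(superpositionLaw c ν)) atTop
      (𝓝 (laplaceFunctional (superpositionLaw c ν) superposition f)) := by
    refine tendsto_lintegral_filter_of_dominated_convergence (fun _ => 1)
      (.of_forall fun S => measurable_expNeg_sum_range hf' S)
      (.of_forall fun S => ae_of_all _ fun ω => expNeg_le_one _) (by simp) (ae_of_all _ fun ω => ?_)
    rw [lintegral_superposition_eq_tsum_sum hf']
    exact (continuous_expNeg.tendsto _).comp ENNReal.summable.hasSum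
  have lintegral_intensity : ∫⁻ x, (1 - expNeg (f x : ℝ≥0∞)) ∂(Measure.sum fun k => c k • ν k) =
      ∑' k, c k * (1 - ∫⁻ a, expNeg (f a) ∂(ν k)) := by
    rw [lintegral_sum_measure]
    refine tsum_congr fun k => ?_
    rw [lintegral_smul_measure, lintegral_sub (by fun_prop)
      ((lintegral_expNeg_le_one _).trans_lt ENNReal.one_lt_top).ne
      (ae_of_all _ fun a => expNeg_le_one _), lintegral_one, measure_univ, ENNReal.smul_def,
      smul_eq_mul]
  rw [lintegral_intensity]
  simp only [lintegral_expNeg_sum_superpositionLaw c ν hf'] at laplace_limit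
  exact tendsto_nhds_unique laplace_limit
    ((continuous_expNeg.tendsto _).comp ENNReal.summable.hasSum)

lemma superposition_eq_sum_dirac {ω : (ι → ℕ) × ((_ : ι) × ℕ → X)}
    (hω : Function.Injective ω.2) :
    superposition ω = Measure.sum fun l : (ω.2 '' {i | i.2 < ω.1 i.1} : Set X) =>
      Measure.dirac (l : X) := by
  ext t ht
  rw [superposition, Measure.sum_apply _ ht, Measure.sum_apply _ ht,
    tsum_image (f := fun x => Measure.dirac x t) hω.injOn,
    tsum_subtype {i : (_ : ι) × ℕ | i.2 < ω.1 i.1} fun i => Measure.dirac (ω.2 i) t]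
  refine tsum_congr fun i => ?_
  simp only [Set.indicator_apply, Set.mem_ofPred_eq]
  split_ifs <;> rfl

lemma ae_injective_marks [Countable ι] [MeasurableEq X] [∀ k, NullSingletonClass (ν k)] :
    ∀ᵐ x ∂(Measure.infinitePi fun i : (_ : ι) × ℕ => ν i.1), Function.Injective x := by
  have ae_ne (i j : (_ : ι) × ℕ) (hij : i ≠ j) :
      ∀ᵐ x ∂(Measure.infinitePi fun i : (_ : ι) × ℕ => ν i.1), x i ≠ x j := by
    have diagonal_null : (ν i.1).prod (ν j.1) (Set.diagonal X) = 0 := by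
      rw [Measure.measure_prod_null measurableSet_diagonal]
      refine ae_of_all _ fun a => ?_
      have section_eq : Prod.mk a ⁻¹' Set.diagonal X = {a} := by
        ext b
        simp [Set.mem_diagonal_iff, eq_comm]
      simp only [section_eq, measure_singleton, Pi.zero_apply]
    rw [← Measure.infinitePi_map_eval_prod (P := fun i : (_ : ι) × ℕ => ν i.1) hij,
      Measure.map_apply (by fun_prop) measurableSet_diagonal] at diagonal_null
    exact measure_eq_zero_iff_ae_notMem.1 diagonal_null
  have ae_all_ne := ae_all_iff.2 fun i => ae_all_iff.2 fun j =>
    eventually_imp_distrib_left.2 (ae_ne i j)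
  filter_upwards [ae_all_ne] with x hx i j
  exact not_imp_not.1 (hx i j)

lemma ae_forall_mark_mem [Countable ι] {s : ι → Set X} (hs : ∀ k, ∀ᵐ a ∂(ν k), a ∈ s k) :
    ∀ᵐ x ∂(Measure.infinitePi fun i : (_ : ι) × ℕ => ν i.1), ∀ i, x i ∈ s i.1 :=
  ae_all_iff.2 fun i => (measurePreserving_eval_infinitePi (fun i : (_ : ι) × ℕ => ν i.1)
    i).quasiMeasurePreserving.ae (hs i.1)

end PoissonProcess

section PoissonExistence

open ProbabilityTheory

variable {X : Type*} [TopologicalSpace X]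

lemma not_accPt_of_finite_inter [T1Space X] {Λ U : Set X} {x : X} (hU : U ∈ 𝓝 x)
    (h : (U ∩ Λ).Finite) : ¬ AccPt x (𝓟 Λ) := by
  rw [accPt_iff_nhds]
  push Not
  refine ⟨U \ ((U ∩ Λ) \ {x}), ?_, ?_⟩
  · exact inter_mem hU ((h.subset Set.sdiff_subset).isClosed.compl_mem_nhds fun hx => hx.2 rfl)
  · rintro y ⟨⟨hy, hy'⟩, hyΛ⟩
    by_contra hne
    exact hy' ⟨⟨hy, hyΛ⟩, hne⟩

lemma locallyFinite_disjointed (K : CompactExhaustion X) : LocallyFinite (disjointed K) := by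
  intro x
  obtain ⟨m, hm⟩ := K.exists_mem_nhds x
  refine ⟨K m, hm, (Set.finite_Iic m).subset fun k ⟨y, hyk, hym⟩ => ?_⟩
  by_contra! h_lt
  rw [disjointed_eq_inter_compl] at hyk
  exact Set.mem_iInter₂.1 hyk.2 m (Set.notMem_Iic.1 h_lt) hym

variable [MeasurableSpace X]

theorem isPointProcess_superposition [T1Space X] [MeasurableEq X] {ι : Type*} [Countable ι]
    (c : ι → ℝ≥0) (ν : ι → Measure X) [∀ k, IsProbabilityMeasure (ν k)]
    [∀ k, NullSingletonClass (ν k)] {s : ι → Set X} (hs : ∀ k, ∀ᵐ a ∂(ν k), a ∈ s k)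
    (hs_finite : LocallyFinite s) :
    IsPointProcess (superpositionLaw c ν) (superposition (ι := ι) (X := X)) := by
  refine ⟨measurable_superposition, ?_⟩
  have ae_marks : ∀ᵐ ω ∂(superpositionLaw c ν),
      (∀ i, ω.2 i ∈ s i.1) ∧ Function.Injective ω.2 :=
    Measure.quasiMeasurePreserving_snd.ae ((ae_forall_mark_mem ν hs).and (ae_injective_marks ν))
  filter_upwards [ae_marks] with ω ⟨h_mem, h_inj⟩
  refine ⟨_, (Set.to_countable _).image _, fun x => ?_, superposition_eq_sum_dirac h_inj⟩
  obtain ⟨U, hU, hU_finite⟩ := hs_finite x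
  refine not_accPt_of_finite_inter hU (((hU_finite.toFinset.sigma
    fun k => Finset.range (ω.1 k)).finite_toSet.image ω.2).subset ?_)
  rintro _ ⟨hy, i, hi, rfl⟩
  exact ⟨i, by simpa using ⟨⟨_, h_mem i, hy⟩, hi⟩, rfl⟩

universe u

theorem exists_isPoissonPointProcess {X : Type u} [TopologicalSpace X] [T2Space X]
    [WeaklyLocallyCompactSpace X] [SigmaCompactSpace X] [MeasurableSpace X] [BorelSpace X]
    [MeasurableEq X] (θ : Measure X) [IsFiniteMeasureOnCompacts θ] [NullSingletonClass θ] :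
    ∃ (Ω : Type u) (_ : MeasurableSpace Ω) (P : Measure Ω) (_ : IsProbabilityMeasure P)
      (Ξ : Ω → Measure X), IsPoissonPointProcess P Ξ θ := by
  let K : CompactExhaustion X := default
  have measurableSet_cell : ∀ k, MeasurableSet (disjointed K k) :=
    .disjointed fun m => (K.isCompact m).measurableSet
  have cell_ne_top (k : ℕ) : θ (disjointed K k) ≠ ∞ :=
    measure_ne_top_of_subset (disjointed_subset K k) (K.isCompact k).measure_ne_top
  let ν (k : {k // θ (disjointed K k) ≠ 0}) : Measure X := θ[|disjointed K k]
  have ν_isProbabilityMeasure (k) : IsProbabilityMeasure (ν k) :=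
    cond_isProbabilityMeasure_of_finite k.2 (cell_ne_top k)
  have ν_nullSingletonClass (k) : NullSingletonClass (ν k) :=
    ⟨fun x => cond_absolutelyContinuous (measure_singleton x)⟩
  let c (k : {k // θ (disjointed K k) ≠ 0}) : ℝ≥0 := (θ (disjointed K k)).toNNReal
  refine ⟨_, _, superpositionLaw c ν, inferInstance, superposition, ?_, fun f hf => ?_⟩
  · exact isPointProcess_superposition c ν (fun k => ae_cond_mem (measurableSet_cell k))
      ((locallyFinite_disjointed K).comp_injective Subtype.val_injective)
  · rw [laplaceFunctional_superposition c ν hf, sum_smul_cond (disjoint_disjointed K)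
      measurableSet_cell (iUnion_disjointed.trans K.iUnion_eq) cell_ne_top]

end PoissonExistence

section LocalProcess

variable {n : ℕ} {E : Space n}

lemma mul_integral_rescale (hn : n ≠ 0) (E : Space n) (g φ : Space n → ℝ) {N : ℕ} (hN : N ≠ 0) :
    N * ∫ x, g x * φ (((N : ℝ) ^ (1 / (n : ℝ))) • (x - E)) =
      ∫ y, g (E + ((N : ℝ) ^ (1 / (n : ℝ)))⁻¹ • y) * φ y := by
  have N_pos : (0 : ℝ) < N := by positivity
  set R := (N : ℝ) ^ (1 / (n : ℝ)) with R_def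
  have R_pos : 0 < R := Real.rpow_pos_of_pos N_pos _
  have R_pow : R ^ n = N := by
    rw [R_def, one_div, Real.rpow_inv_natCast_pow N_pos.le hn]
  have dilate := Measure.integral_comp_smul (volume : Measure (Space n))
    (fun y => g (E + R⁻¹ • y) * φ y) R
  have translate := integral_sub_right_eq_self (μ := (volume : Measure (Space n)))
    (fun x => g (E + R⁻¹ • R • x) * φ (R • x)) E
  simp only [smul_smul, inv_mul_cancel₀ R_pos.ne', one_smul, add_sub_cancel] at dilate translate
  rw [translate, dilate, finrank_euclideanSpace_fin, R_pow, abs_of_pos (by positivity), smul_eq_mul,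
    ← mul_assoc, mul_inv_cancel₀ N_pos.ne', one_mul]

lemma tendsto_mul_integral_rescale (hn : n ≠ 0) {g φ : Space n → ℝ} (hg : Measurable g) {G : ℝ}
    (hG : ∀ x, |g x| ≤ G) (hgE : ContinuousAt g E) (hφ : Integrable φ) :
    Tendsto (fun N : ℕ => N * ∫ x, g x * φ (((N : ℝ) ^ (1 / (n : ℝ))) • (x - E))) atTop
      (𝓝 (g E * ∫ y, φ y)) := by
  have scale_tendsto_zero : Tendsto (fun N : ℕ => ((N : ℝ) ^ (1 / (n : ℝ)))⁻¹) atTop (𝓝 0) :=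
    tendsto_inv_atTop_zero.comp ((tendsto_rpow_atTop (by positivity)).comp
      tendsto_natCast_atTop_atTop)
  have rescaled_limit : Tendsto (fun N : ℕ =>
      ∫ y, g (E + ((N : ℝ) ^ (1 / (n : ℝ)))⁻¹ • y) * φ y) atTop (𝓝 (∫ y, g E * φ y)) := by
    refine tendsto_integral_of_dominated_convergence (fun y => G * |φ y|) (fun N => ?_)
      (hφ.abs.const_mul G) (fun N => ae_of_all _ fun y => ?_) (ae_of_all _ fun y => ?_)
    · exact (hg.comp (by fun_prop)).aestronglyMeasurable.mul hφ.aestronglyMeasurable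
    · rw [Real.norm_eq_abs, abs_mul]
      exact mul_le_mul_of_nonneg_right (hG _) (abs_nonneg _)
    · refine Tendsto.mul_const _ (hgE.tendsto.comp ?_)
      simpa using (scale_tendsto_zero.smul_const y).const_add E
  rw [← integral_const_mul]
  refine rescaled_limit.congr' ?_
  filter_upwards [eventually_ne_atTop 0] with N hN
  exact (mul_integral_rescale hn E g φ hN).symm

lemma one_sub_exp_neg_mem_Icc (t : ℝ≥0) : 1 - Real.exp (-t) ∈ Set.Icc (0 : ℝ) 1 :=
  ⟨by simp, by simpa using (Real.exp_pos _).le⟩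

lemma laplaceFunctional_localProcess {N : ℕ} (P : Measure (Fin N → Space n))
    [IsProbabilityMeasure P] (E : Space n) {f : Space n → ℝ≥0} (hf : Measurable f) :
    laplaceFunctional P (localProcess E N) f = ENNReal.ofReal (∫ x, ∏ j,
      (1 - (1 - Real.exp (-(f (((N : ℝ) ^ (1 / (n : ℝ))) • (x j - E)))))) ∂P) := by
  simp only [sub_sub_cancel]
  have prod_mem (x : Fin N → Space n) :
      ∏ j, Real.exp (-(f (((N : ℝ) ^ (1 / (n : ℝ))) • (x j - E)))) ∈ Set.Icc (0 : ℝ) 1 :=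
    ⟨by positivity, Finset.prod_le_one (fun j _ => by positivity) fun j _ => by simp⟩
  have prod_meas : Measurable fun x : Fin N → Space n =>
      ∏ j, Real.exp (-(f (((N : ℝ) ^ (1 / (n : ℝ))) • (x j - E)))) := by fun_prop
  rw [ofReal_integral_eq_lintegral_ofReal (.of_mem_Icc 0 1 prod_meas.aemeasurable
    (ae_of_all _ prod_mem)) (ae_of_all _ fun x => (prod_mem x).1)]
  refine lintegral_congr fun x => ?_
  rw [localProcess, lintegral_finsetSum_measure, expNeg_sum,
    ENNReal.ofReal_prod_of_nonneg fun j _ => (Real.exp_pos _).le]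
  refine Finset.prod_congr rfl fun j _ => ?_
  rw [lintegral_dirac' _ (by fun_prop), expNeg_coe]

lemma lintegral_one_sub_expNeg {X : Type*} [MeasurableSpace X] {θ : Measure X} {f : X → ℝ≥0}
    (hf : Integrable (fun x => 1 - Real.exp (-f x)) θ) :
    ∫⁻ x, (1 - expNeg (f x)) ∂θ = ENNReal.ofReal (∫ x, (1 - Real.exp (-f x)) ∂θ) := by
  rw [ofReal_integral_eq_lintegral_ofReal hf
    (ae_of_all _ fun x => (one_sub_exp_neg_mem_Icc (f x)).1)]
  refine lintegral_congr fun x => ?_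
  rw [expNeg_coe, ENNReal.ofReal_sub _ (Real.exp_pos _).le, ENNReal.ofReal_one]

theorem convergesInDistribution_localProcess (hn : n ≠ 0) {ρ : Space n → ℝ≥0}
    (hρ : Measurable ρ) {G : ℝ≥0} (hG : ∀ x, ρ x ≤ G) (hρE : ContinuousAt ρ E)
    {P' : ∀ N, Measure (Fin N → Space n)} [∀ N, IsProbabilityMeasure (P' N)]
    (hP' : ∀ φ : ℕ → Space n → ℝ, (∀ N, Measurable (φ N)) → (∀ N x, φ N x ∈ Set.Icc 0 1) →
      ∀ α : ℝ, Tendsto (fun N : ℕ => N * ∫ x, φ N x ∂densityMeasure volume ρ) atTop (𝓝 α) →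
      Tendsto (fun N => ∫ x, ∏ j, (1 - φ N (x j)) ∂P' N) atTop (𝓝 (Real.exp (-α))))
    {Ω : Type*} [MeasurableSpace Ω] {P : Measure Ω} {Ξ : Ω → Measure (Space n)}
    (hP : IsPoissonPointProcess P Ξ (ρ E • volume)) :
    ConvergesInDistribution P' (fun N => localProcess E N) P Ξ := by
  intro f hf hf_compact
  set φ : Space n → ℝ := fun y => 1 - Real.exp (-f y)
  have φ_mem (y : Space n) : φ y ∈ Set.Icc 0 1 := one_sub_exp_neg_mem_Icc (f y)
  have φ_cont : Continuous φ := by fun_prop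
  have φ_integrable : Integrable φ := φ_cont.integrable_of_hasCompactSupport
    (hf_compact.comp_left (g := fun t : ℝ≥0 => 1 - Real.exp (-t)) (by simp))
  have expected_count : Tendsto (fun N : ℕ =>
      N * ∫ x, φ (((N : ℝ) ^ (1 / (n : ℝ))) • (x - E)) ∂densityMeasure volume ρ) atTop
      (𝓝 (ρ E * ∫ y, φ y)) := by
    simp only [densityMeasure, integral_withDensity_eq_integral_smul hρ, NNReal.smul_def,
      smul_eq_mul]
    exact tendsto_mul_integral_rescale hn (g := fun x => (ρ x : ℝ)) (by fun_prop) (G := G)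
      (fun x => by simpa using hG x)
      (NNReal.continuous_coe.continuousAt.comp hρE) φ_integrable
  have laplace_limit : laplaceFunctional P Ξ f =
      ENNReal.ofReal (Real.exp (-(ρ E * ∫ y, φ y))) := by
    rw [hP.laplace_eq f hf.measurable, lintegral_smul_measure,
      lintegral_one_sub_expNeg φ_integrable, ENNReal.smul_def, smul_eq_mul,
      ← ENNReal.ofReal_coe_nnreal, ← ENNReal.ofReal_mul (ρ E).coe_nonneg,
      expNeg_ofReal (mul_nonneg (ρ E).coe_nonneg (integral_nonneg fun y => (φ_mem y).1))]
  rw [laplace_limit]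
  have product_limit := hP' (fun N x => φ (((N : ℝ) ^ (1 / (n : ℝ))) • (x - E)))
    (fun N => by fun_prop) (fun N x => φ_mem _) _ expected_count
  refine ((ENNReal.continuous_ofReal.tendsto _).comp product_limit).congr fun N => ?_
  exact (laplaceFunctional_localProcess (P' N) E hf.measurable).symm

end LocalProcess

section ConfiningPotential

variable {X : Type*} [TopologicalSpace X] [MeasurableSpace X] {V w : X → ℝ≥0∞} {ν : Measure X}

lemma measurable_of_continuousOn_lt_top [OpensMeasurableSpace X] (hV_open : IsOpen {x | V x < ⊤})
    (hV_cont : ContinuousOn V {x | V x < ⊤}) : Measurable V := by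
  classical
  have eq_piecewise : {x | V x < ⊤}.piecewise V (fun _ => ⊤) = V := by
    ext x
    by_cases hx : V x < ⊤
    · simp [Set.piecewise, hx]
    · simp [Set.piecewise, not_lt_top_iff.1 hx]
  exact eq_piecewise ▸ hV_cont.measurable_piecewise continuousOn_const hV_open.measurableSet

lemma frequently_ne_top_of_isOpen [ν.IsOpenPosMeasure] (hV_open : IsOpen {x | V x < ⊤})
    (hV_nonempty : {x | V x < ⊤}.Nonempty) : ∃ᶠ x in ae ν, V x ≠ ⊤ := by
  simp only [frequently_ae_iff, ← lt_top_iff_ne_top]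
  exact (hV_open.measure_pos ν hV_nonempty).ne'

lemma continuousOn_gibbsDensity {U : Set X} (hw : Measurable w) (hw_fin : ∃ᶠ x in ae ν, w x ≠ ⊤)
    (hw_cont : ContinuousOn w U) : ContinuousOn (gibbsDensity ν w) U := by
  have inv_ne_top : (∫⁻ x, expNeg (w x) ∂ν)⁻¹ ≠ ⊤ :=
    ENNReal.inv_ne_top.2 (lintegral_expNeg_ne_zero hw hw_fin)
  exact ENNReal.continuousOn_toNNReal.comp
    ((ENNReal.continuous_const_mul inv_ne_top).comp_continuousOn
      (continuous_expNeg.comp_continuousOn hw_cont))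
    fun x _ => ENNReal.mul_ne_top inv_ne_top (expNeg_ne_top _)

end ConfiningPotential

lemma lintegral_expNeg_ne_zero_of_gibbsMeasure_ne_zero {X : Type*} [MeasurableSpace X]
    {ν : Measure X} {w : X → ℝ≥0∞} (hw : Measurable w) (h : gibbsMeasure ν w ≠ 0) :
    ∫⁻ x, expNeg (w x) ∂ν ≠ 0 := by
  intro h_zero
  rw [lintegral_eq_zero_iff (by fun_prop)] at h_zero
  exact h (by rw [gibbsMeasure, withDensity_congr_ae h_zero, Pi.zero_def, withDensity_const,
    zero_smul, smul_zero])

section MeanFieldLimit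

variable {n : ℕ} {s γ : ℝ} {V : Space n → ℝ≥0∞} {μ : ProbabilityMeasure (Space n)}

lemma exists_isTruncation_rieszKernel (hs : 0 < s) (hsn : s < n) {π : Measure (Space n)} {C : ℝ≥0}
    (hπ : π ≤ C • volume) {τ : ℝ≥0} (hτ : τ ≠ 0) :
    ∃ j r J, IsTruncation (rieszKernel s) π j r J τ := by
  obtain ⟨T, hT, hT_le⟩ := exists_lintegral_gaussianMixture_Ioi_le hs (by simpa using hsn) hπ
    (ENNReal.coe_ne_zero.2 hτ)
  have weight_ne_top := (lintegral_mixtureWeight_Ioc_lt_top hs T).ne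
  refine ⟨gaussianMixture s (Set.Ioc 0 T), gaussianMixture s (Set.Ioi T),
    (∫⁻ t in Set.Ioc 0 T, mixtureWeight s t).toNNReal, ?_⟩
  exact
    { isPosDefKernel :=
        isPosDefKernel_gaussianMixture s Set.Ioc_subset_Ioi_self measurableSet_Ioc
      measurable_remainder := (isPosDefKernel_gaussianMixture s (Set.Ioi_subset_Ioi hT.le)
        measurableSet_Ioi).measurable_uncurry
      add_eq := gaussianMixture_Ioc_add_Ioi hs hT
      le_bound := fun x y => (gaussianMixture_le s Set.Ioc_subset_Ioi_self measurableSet_Ioc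
        x y).trans_eq (ENNReal.coe_toNNReal weight_ne_top).symm
      lintegral_remainder_le := hT_le }

lemma isProbabilityMeasure_referenceMeasure (h_zero : ∫⁻ x, expNeg (V x) ≠ 0)
    (h_top : ∫⁻ x, expNeg (V x) ≠ ⊤) : IsProbabilityMeasure (referenceMeasure V) :=
  isProbabilityMeasure_gibbsMeasure h_zero h_top

lemma exists_gibbsMeasure_le_nnreal_smul {X : Type*} [MeasurableSpace X] {ν : Measure X}
    {w : X → ℝ≥0∞} (hw : Measurable w) (h_zero : ∫⁻ x, expNeg (w x) ∂ν ≠ 0) :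
    ∃ C : ℝ≥0, gibbsMeasure ν w ≤ C • ν := by
  lift (∫⁻ x, expNeg (w x) ∂ν)⁻¹ to ℝ≥0 using ENNReal.inv_ne_top.2 h_zero with C hC
  exact ⟨C, (gibbsMeasure_le_smul hw).trans_eq (by rw [← hC]; rfl)⟩

lemma freeEnergy_eq_kernelFreeEnergy (hs : 0 < s) (V : Space n → ℝ≥0∞)
    (μ : ProbabilityMeasure (Space n)) :
    freeEnergy s γ V μ = kernelFreeEnergy
      (fun x y => ENNReal.ofReal (γ / 2) * rieszKernel s x y) (referenceMeasure V) μ := by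
  rw [kernelFreeEnergy, kernelEnergy_const_mul (isPosDefKernel_rieszKernel hs).measurable_uncurry]
  rfl

lemma isFreeEnergyMinimizer_iff (hs : 0 < s) :
    IsFreeEnergyMinimizer s γ V μ ↔ IsKernelFreeEnergyMinimizer
      (fun x y => ENNReal.ofReal (γ / 2) * rieszKernel s x y) (referenceMeasure V) μ := by
  simp only [IsFreeEnergyMinimizer, IsKernelFreeEnergyMinimizer, freeEnergy_eq_kernelFreeEnergy hs]

lemma exists_lintegral_rieszKernel_referenceMeasure_le (hs : 0 < s) (hsn : s < n)
    (hV : Measurable V) (h_zero : ∫⁻ x, expNeg (V x) ≠ 0) (h_top : ∫⁻ x, expNeg (V x) ≠ ⊤) :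
    ∃ B : ℝ≥0, ∀ x, ∫⁻ y, rieszKernel s x y ∂referenceMeasure V ≤ B := by
  have := isProbabilityMeasure_referenceMeasure h_zero h_top
  obtain ⟨C, hC⟩ := exists_gibbsMeasure_le_nnreal_smul hV h_zero
  exact exists_lintegral_rieszKernel_le hs hsn hC

lemma exists_lintegral_const_mul_rieszKernel_referenceMeasure_le (hs : 0 < s) (hsn : s < n)
    (hV : Measurable V) (h_zero : ∫⁻ x, expNeg (V x) ≠ 0) (h_top : ∫⁻ x, expNeg (V x) ≠ ⊤)
    (c : ℝ≥0) :
    ∃ B : ℝ≥0, ∀ x, ∫⁻ y, c * rieszKernel s x y ∂referenceMeasure V ≤ B := by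
  obtain ⟨B, hB⟩ := exists_lintegral_rieszKernel_referenceMeasure_le hs hsn hV h_zero h_top
  refine ⟨c * B, fun x => ?_⟩
  rw [lintegral_const_mul _ ((isPosDefKernel_rieszKernel hs).measurable_right x), ENNReal.coe_mul]
  gcongr
  exact hB x

theorem existsUnique_isFreeEnergyMinimizer (hs : 0 < s) (hsn : s < n) (γ : ℝ)
    (hV : Measurable V) (h_zero : ∫⁻ x, expNeg (V x) ≠ 0) (h_top : ∫⁻ x, expNeg (V x) ≠ ⊤) :
    ∃! μ, IsFreeEnergyMinimizer s γ V μ := by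
  have := isProbabilityMeasure_referenceMeasure h_zero h_top
  obtain ⟨B, hB⟩ := exists_lintegral_const_mul_rieszKernel_referenceMeasure_le hs hsn hV h_zero
    h_top (γ / 2).toNNReal
  have isPosDefKernel := (isPosDefKernel_rieszKernel (n := n) hs).const_mul (ENNReal.ofReal (γ / 2))
  simp only [isFreeEnergyMinimizer_iff hs]
  obtain ⟨μ, hμ⟩ := exists_isKernelFreeEnergyMinimizer isPosDefKernel hB
  exact ⟨μ, hμ, fun ν hν => hν.unique isPosDefKernel hB hμ⟩

lemma IsFreeEnergyMinimizer.eq_gibbsMeasure (hs : 0 < s) (hsn : s < n) (hV : Measurable V)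
    (h_zero : ∫⁻ x, expNeg (V x) ≠ 0) (h_top : ∫⁻ x, expNeg (V x) ≠ ⊤)
    (hμ : IsFreeEnergyMinimizer s γ V μ) :
    (μ : Measure (Space n)) = gibbsMeasure (referenceMeasure V)
      fun x => γ.toNNReal * ∫⁻ y, rieszKernel s x y ∂μ := by
  have := isProbabilityMeasure_referenceMeasure h_zero h_top
  obtain ⟨B, hB⟩ := exists_lintegral_const_mul_rieszKernel_referenceMeasure_le hs hsn hV h_zero
    h_top (γ / 2).toNNReal
  have euler_lagrange := ((isFreeEnergyMinimizer_iff hs).1 hμ).eq_gibbsMeasure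
    ((isPosDefKernel_rieszKernel hs).const_mul _) hB
  have two_mul_half : (2 * (γ / 2).toNNReal : ℝ≥0∞) = γ.toNNReal := by
    change 2 * ENNReal.ofReal (γ / 2) = ENNReal.ofReal γ
    rw [← ENNReal.ofReal_ofNat 2, ← ENNReal.ofReal_mul zero_le_two, mul_div_cancel₀ γ two_ne_zero]
  refine euler_lagrange.trans (congrArg (gibbsMeasure _) (funext fun x => ?_))
  rw [lintegral_const_mul _ ((isPosDefKernel_rieszKernel hs).measurable_right x), ← mul_assoc,
    two_mul_half]

lemma ne_zero_of_pos_of_lt (hs : 0 < s) (hsn : s < n) : n ≠ 0 :=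
  Nat.cast_ne_zero.1 (hs.trans hsn).ne'

lemma measurable_lintegral_rieszKernel (hs : 0 < s) (μ : Measure (Space n)) [SFinite μ] :
    Measurable fun x => ∫⁻ y, rieszKernel s x y ∂μ :=
  (isPosDefKernel_rieszKernel hs).measurable_uncurry.lintegral_prod_right'

lemma IsFreeEnergyMinimizer.exists_le_smul_referenceMeasure (hs : 0 < s) (hsn : s < n)
    (hV : Measurable V) (h_zero : ∫⁻ x, expNeg (V x) ≠ 0) (h_top : ∫⁻ x, expNeg (V x) ≠ ⊤)
    (hμ : IsFreeEnergyMinimizer s γ V μ) :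
    ∃ C : ℝ≥0, (μ : Measure (Space n)) ≤ C • referenceMeasure V := by
  have mean_field := hμ.eq_gibbsMeasure hs hsn hV h_zero h_top
  have h_potential := (measurable_lintegral_rieszKernel hs (μ : Measure (Space n))).const_mul
    (γ.toNNReal : ℝ≥0∞)
  obtain ⟨C, hC⟩ := exists_gibbsMeasure_le_nnreal_smul h_potential
    (lintegral_expNeg_ne_zero_of_gibbsMeasure_ne_zero h_potential
      (mean_field ▸ IsProbabilityMeasure.ne_zero (μ : Measure (Space n))))
  exact ⟨C, mean_field.trans_le hC⟩

lemma IsFreeEnergyMinimizer.exists_le_smul_volume (hs : 0 < s) (hsn : s < n)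
    (hV : Measurable V) (h_zero : ∫⁻ x, expNeg (V x) ≠ 0) (h_top : ∫⁻ x, expNeg (V x) ≠ ⊤)
    (hμ : IsFreeEnergyMinimizer s γ V μ) :
    ∃ C : ℝ≥0, (μ : Measure (Space n)) ≤ C • volume := by
  obtain ⟨C, hC⟩ := hμ.exists_le_smul_referenceMeasure hs hsn hV h_zero h_top
  obtain ⟨D, hD⟩ := exists_gibbsMeasure_le_nnreal_smul hV h_zero
  refine ⟨C * D, hC.trans ?_⟩
  rw [mul_smul]
  gcongr
  exact hD

lemma IsFreeEnergyMinimizer.exists_isMeanFieldState (hs : 0 < s) (hsn : s < n)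
    (hV : Measurable V) (h_zero : ∫⁻ x, expNeg (V x) ≠ 0) (h_top : ∫⁻ x, expNeg (V x) ≠ ⊤)
    (hμ : IsFreeEnergyMinimizer s γ V μ) :
    ∃ C B, IsMeanFieldState (rieszKernel s) (referenceMeasure V) γ.toNNReal μ C B := by
  obtain ⟨C, hC⟩ := hμ.exists_le_smul_referenceMeasure hs hsn hV h_zero h_top
  obtain ⟨D, hD⟩ := hμ.exists_le_smul_volume hs hsn hV h_zero h_top
  obtain ⟨B, hB⟩ := exists_lintegral_rieszKernel_le hs hsn hD
  obtain ⟨B₀, hB₀⟩ := exists_lintegral_rieszKernel_referenceMeasure_le hs hsn hV h_zero h_top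
  exact ⟨C, max B B₀,
    { measurable_kernel := (isPosDefKernel_rieszKernel hs).measurable_uncurry
      symm := (isPosDefKernel_rieszKernel hs).symm
      isProbabilityMeasure := inferInstance
      eq_gibbsMeasure := hμ.eq_gibbsMeasure hs hsn hV h_zero h_top
      le_smul := hC
      lintegral_le := fun x => (hB x).trans (mod_cast le_max_left B B₀)
      lintegral_reference_le := fun x => (hB₀ x).trans (mod_cast le_max_right B B₀) }⟩

/-- The total potential `V + γ ∫ |· - y|^{-s} μ(dy)` seen by a particle in the mean-field limit. -/
noncomputable def effectivePotential (s γ : ℝ) (V : Space n → ℝ≥0∞) (μ : Measure (Space n))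
    (x : Space n) : ℝ≥0∞ :=
  V x + γ.toNNReal * ∫⁻ y, rieszKernel s x y ∂μ

lemma measurable_effectivePotential (hs : 0 < s) (γ : ℝ) (hV : Measurable V)
    (μ : Measure (Space n)) [SFinite μ] : Measurable (effectivePotential s γ V μ) :=
  hV.add ((measurable_lintegral_rieszKernel hs μ).const_mul _)

lemma effectivePotential_ne_top (hs : 0 < s) (hsn : s < n) {μ : Measure (Space n)}
    [IsFiniteMeasure μ] {C : ℝ≥0} (hμ : μ ≤ C • volume) {x : Space n} (hx : V x ≠ ⊤) :
    effectivePotential s γ V μ x ≠ ⊤ := by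
  obtain ⟨B, hB⟩ := exists_lintegral_rieszKernel_le hs hsn hμ
  exact ENNReal.add_ne_top.2
    ⟨hx, ENNReal.mul_ne_top ENNReal.coe_ne_top (ne_top_of_le_ne_top ENNReal.coe_ne_top (hB x))⟩

lemma continuousOn_effectivePotential (hs : 0 < s) (hsn : s < n) {μ : Measure (Space n)}
    [IsFiniteMeasure μ] {C : ℝ≥0} (hμ : μ ≤ C • volume) {U : Set (Space n)}
    (hV : ContinuousOn V U) : ContinuousOn (effectivePotential s γ V μ) U :=
  hV.add ((ENNReal.continuous_const_mul ENNReal.coe_ne_top).comp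
    (continuous_lintegral_rieszKernel hs hsn hμ)).continuousOn

lemma lintegral_expNeg_effectivePotential_le (s γ : ℝ) (V : Space n → ℝ≥0∞)
    (μ : Measure (Space n)) :
    ∫⁻ x, expNeg (effectivePotential s γ V μ x) ≤ ∫⁻ x, expNeg (V x) :=
  lintegral_mono fun _ => expNeg_antitone le_self_add

lemma IsFreeEnergyMinimizer.eq_gibbsMeasure_effectivePotential (hs : 0 < s) (hsn : s < n)
    (hV : Measurable V) (h_zero : ∫⁻ x, expNeg (V x) ≠ 0) (h_top : ∫⁻ x, expNeg (V x) ≠ ⊤)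
    (hμ : IsFreeEnergyMinimizer s γ V μ) :
    (μ : Measure (Space n)) = gibbsMeasure volume (effectivePotential s γ V μ) :=
  (hμ.eq_gibbsMeasure hs hsn hV h_zero h_top).trans (gibbsMeasure_add hV
    ((measurable_lintegral_rieszKernel hs (μ : Measure (Space n))).const_mul _) h_zero h_top).symm

theorem IsFreeEnergyMinimizer.exists_density (hs : 0 < s) (hsn : s < n) (hV : Measurable V)
    (hV_cont : ContinuousOn V {x | V x < ⊤}) (h_fin : ∃ᶠ x in ae volume, V x ≠ ⊤)
    (h_top : ∫⁻ x, expNeg (V x) ≠ ⊤) (hμ : IsFreeEnergyMinimizer s γ V μ) :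
    ∃ ρ : Space n → ℝ≥0, Measurable ρ ∧ ContinuousOn ρ {x | V x < ⊤} ∧
      (μ : Measure (Space n)) = densityMeasure volume ρ ∧ (∀ x, V x < ⊤ → 0 < ρ x) ∧
      ∃ G, ∀ x, ρ x ≤ G := by
  have h_zero := lintegral_expNeg_ne_zero hV h_fin
  obtain ⟨C, hC⟩ := hμ.exists_le_smul_volume hs hsn hV h_zero h_top
  have hw := measurable_effectivePotential hs γ hV (μ : Measure (Space n))
  have hw_fin := h_fin.mono fun _ hx => effectivePotential_ne_top (γ := γ) hs hsn hC hx
  have hw_top := ne_top_of_le_ne_top h_top (lintegral_expNeg_effectivePotential_le s γ V μ)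
  exact ⟨gibbsDensity volume (effectivePotential s γ V μ), measurable_gibbsDensity hw,
    continuousOn_gibbsDensity hw hw_fin (continuousOn_effectivePotential hs hsn hC hV_cont),
    (hμ.eq_gibbsMeasure_effectivePotential hs hsn hV h_zero h_top).trans
      (densityMeasure_gibbsDensity hw hw_fin).symm,
    fun _ hx => gibbsDensity_pos hw hw_fin hw_top (effectivePotential_ne_top hs hsn hC hx.ne),
    exists_gibbsDensity_le hw hw_fin⟩

lemma gibbs_eq_kernelGibbs (hs : 0 < s) (β : ℝ) (hV : Measurable V)
    (h_zero : ∫⁻ x, expNeg (V x) ≠ 0) (h_top : ∫⁻ x, expNeg (V x) ≠ ⊤) (N : ℕ) :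
    gibbs s β V N = kernelGibbs (rieszKernel s) (referenceMeasure V) β.toNNReal N := by
  have partition_eq :
      ∫⁻ x : Fin N → Space n, expNeg (∑ j, V (x j)) = (∫⁻ x, expNeg (V x)) ^ N := by
    simp only [expNeg_sum]
    exact (lintegral_pi_prod (f := fun _ x => expNeg (V x)) fun _ => by fun_prop).trans (by simp)
  have h_pairs := (measurable_pairEnergy
    (isPosDefKernel_rieszKernel (n := n) hs).measurable_uncurry N).const_mul (β.toNNReal : ℝ≥0∞)
  calc gibbs s β V N
      = gibbsMeasure volume
          fun x => ∑ j, V (x j) + β.toNNReal * pairEnergy (rieszKernel s) x :=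
        congrArg (gibbsMeasure volume) (funext fun x => add_comm _ _)
    _ = gibbsMeasure (gibbsMeasure volume fun x => ∑ j, V (x j))
          fun x => β.toNNReal * pairEnergy (rieszKernel s) x :=
        gibbsMeasure_add (by fun_prop) h_pairs (partition_eq ▸ pow_ne_zero N h_zero)
          (partition_eq ▸ ENNReal.pow_ne_top h_top)
    _ = kernelGibbs (rieszKernel s) (referenceMeasure V) β.toNNReal N :=
        congrArg (gibbsMeasure · _) (gibbsMeasure_pi hV h_zero h_top N)

theorem IsFreeEnergyMinimizer.convergesInDistribution_localProcess (hs : 0 < s) (hsn : s < n)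
    (hV : Measurable V) (h_zero : ∫⁻ x, expNeg (V x) ≠ 0) (h_top : ∫⁻ x, expNeg (V x) ≠ ⊤)
    (hμ : IsFreeEnergyMinimizer s γ V μ) {ρ : Space n → ℝ≥0} (hρ : Measurable ρ)
    (hμρ : (μ : Measure (Space n)) = densityMeasure volume ρ) {G : ℝ≥0} (hG : ∀ x, ρ x ≤ G)
    {E : Space n} (hρE : ContinuousAt ρ E) {β : ℕ → ℝ}
    (hβ : Tendsto (fun N : ℕ => N * β N) atTop (𝓝 γ)) {Ω : Type*} [MeasurableSpace Ω]
    {P : Measure Ω} {Ξ : Ω → Measure (Space n)}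
    (hP : IsPoissonPointProcess P Ξ (ρ E • volume)) :
    ConvergesInDistribution (fun N => gibbs s (β N) V N) (fun N => localProcess E N) P Ξ := by
  have := isProbabilityMeasure_referenceMeasure h_zero h_top
  obtain ⟨C, B, h_state⟩ := hμ.exists_isMeanFieldState hs hsn hV h_zero h_top
  obtain ⟨D, hD⟩ := exists_gibbsMeasure_le_nnreal_smul hV h_zero
  have hb : Tendsto (fun N : ℕ => N * (β N).toNNReal) atTop (𝓝 γ.toNNReal) := by
    simpa [Real.toNNReal_mul, Function.comp_def] using
      (continuous_real_toNNReal.tendsto γ).comp hβ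
  have isProbabilityMeasure (N : ℕ) : IsProbabilityMeasure
      (kernelGibbs (rieszKernel s) (referenceMeasure V) (β N).toNNReal N) :=
    isProbabilityMeasure_kernelGibbs h_state.measurable_kernel h_state.symm
      (ne_top_of_le_ne_top ENNReal.coe_ne_top
        (kernelEnergy_self_le h_state.lintegral_reference_le)) _ N
  simp only [gibbs_eq_kernelGibbs hs _ hV h_zero h_top]
  exact RieszGas.convergesInDistribution_localProcess (ne_zero_of_pos_of_lt hs hsn) hρ hG hρE
    (fun φ hφ hφ_mem α hα => h_state.tendsto_integral_prod_one_sub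
      (fun τ hτ => exists_isTruncation_rieszKernel hs hsn hD hτ) hb hφ hφ_mem (hμρ ▸ hα)) hP

end MeanFieldLimit

end RieszGas

theorem mainTheorem2 (n : ℕ) (s : ℝ) (hs : 0 < s) (hsn : s < n)
    (V : RieszGas.Space n → ℝ≥0∞)
    (hV_open : IsOpen {x | V x < ⊤}) (hV_nonempty : {x | V x < ⊤}.Nonempty)
    (hV_cont : ContinuousOn V {x | V x < ⊤})
    (hV_int : ∫⁻ x, RieszGas.expNeg (V x) < ⊤)
    (γ : ℝ) (hγ : 0 ≤ γ) :
    -- the free energy has a unique minimizer `μ`, with a density `ρ` continuous on `{V < ∞}`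
    ∃ μ : ProbabilityMeasure (RieszGas.Space n),
      RieszGas.IsFreeEnergyMinimizer s γ V μ ∧
      (∀ ν, RieszGas.IsFreeEnergyMinimizer s γ V ν → ν = μ) ∧
      ∃ ρ : RieszGas.Space n → ℝ≥0,
        Measurable ρ ∧ ContinuousOn ρ {x | V x < ⊤} ∧
        (μ : Measure (RieszGas.Space n)) = volume.withDensity (fun x => (ρ x : ℝ≥0∞)) ∧
        -- around each `E` in `{V < ∞}` there is Poisson convergence, with intensity `ρ E > 0`
        ∀ E : RieszGas.Space n, V E < ⊤ → 0 < ρ E ∧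
          ∃ (Ω : Type) (_ : MeasurableSpace Ω) (P : Measure Ω) (_ : IsProbabilityMeasure P)
            (Ξ : Ω → Measure (RieszGas.Space n)),
            RieszGas.IsPoissonPointProcess P Ξ (ρ E • volume) ∧
            ∀ β : ℕ → ℝ, (∀ N, 0 < β N) →
              Tendsto (fun N : ℕ => (N : ℝ) * β N) atTop (𝓝 γ) →
              RieszGas.ConvergesInDistribution
                (fun N => RieszGas.gibbs s (β N) V N) (fun N => RieszGas.localProcess E N) P Ξ := by
  have hV := RieszGas.measurable_of_continuousOn_lt_top hV_open hV_cont
  have hV_fin := RieszGas.frequently_ne_top_of_isOpen (ν := volume) hV_open hV_nonempty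
  have h_zero := RieszGas.lintegral_expNeg_ne_zero hV hV_fin
  obtain ⟨μ, hμ, h_unique⟩ :=
    RieszGas.existsUnique_isFreeEnergyMinimizer hs hsn γ hV h_zero hV_int.ne
  obtain ⟨ρ, hρ, hρ_cont, hμρ, hρ_pos, G, hG⟩ :=
    hμ.exists_density hs hsn hV hV_cont hV_fin hV_int.ne
  refine ⟨μ, hμ, h_unique, ρ, hρ, hρ_cont, hμρ, fun E hE => ⟨hρ_pos E hE, ?_⟩⟩
  have : NeZero n := ⟨RieszGas.ne_zero_of_pos_of_lt hs hsn⟩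
  have : NullSingletonClass (ρ E • volume : Measure (RieszGas.Space n)) := ⟨fun x => by simp⟩
  obtain ⟨Ω, _, P, hP, Ξ, h_poisson⟩ :=
    RieszGas.exists_isPoissonPointProcess (X := RieszGas.Space n) (ρ E • volume)
  exact ⟨Ω, _, P, hP, Ξ, h_poisson, fun β _ hβ => hμ.convergesInDistribution_localProcess hs hsn hV
    h_zero hV_int.ne hρ hμρ hG (hρ_cont.continuousAt (hV_open.mem_nhds hE)) hβ h_poisson⟩
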